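/- For $x,M\ge 0$ let $\Phi_{x,M}$ be the single-mode phase-insensitive bosonic Gaussian channel on $L^2(\mathbb R)$, which acts on first moments by $\mathbf m\mapsto\sqrt{x}\,\mathbf m$ and on covariance matrices (normalised so that the vacuum has covariance $I_2$) by $V\mapsto xV+(2M+|1-x|)I_2$; equivalently, on characteristic functions $\chi_\rho(\xi)=\mathrm{Tr}(\rho\, e^{i\xi\cdot\hat{\mathbf r}})$ it acts by $\chi_{\Phi(\rho)}(\xi)=e^{-(2M+|1-x|)|\xi|^2/4}\chi_\rho(\sqrt x\,\xi)$. For $N\ge 0$ let $\mathcal E_{\eta,N}=\Phi_{\eta,(1-\eta)N}$ ($0\le\eta\le 1$) be the thermal attenuator and $\mathcal A_{g,N}=\Phi_{g,(g-1)N}$ ($g\ge 1$) the thermal amplifier. Let $\mathcal K$ be any one of the following capacities of a quantum channel, without energy constraint: the quantum capacity $Q$, the private capacity $P$, the two-way quantum capacity $Q_2$, the secret-key capacity $K$. For $N\ge 0$ put $$N^{(3)}_{g,N}(\eta')=N\,\frac{g-1}{1-\eta'}-1,\qquad N^{(4)}_{g,N}(\eta')=(N+1)\,\frac{g-1}{g}\,\frac{\eta'}{1-\eta'}\qquad(g\ge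 1,\ 0\le\eta'<1),$$ $$N^{(3)}_{\eta,N}(g')=N\,\frac{1-\eta}{\eta}\,\frac{g'}{g'-1}-1\quad(0<\eta\le 1,\ g'>1),\qquad N^{(4)}_{\eta,N}(g')=(N+1)\,\frac{1-\eta}{g'-1}\quad(0\le\eta\le 1,\ g'>1).$$ Then: (i) for all $g\ge1$, $N\ge0$, $\mathcal K(\mathcal E_{\eta',N'})$ with $N'=N^{(4)}_{g,N}(\eta')$ is a non-decreasing function of $\eta'\in[0,1)$; (ii) for all $g\ge1$, $N\ge0$, $\mathcal K(\mathcal E_{\eta',N'})$ with $N'=N^{(3)}_{g,N}(\eta')$ is a non-increasing function of $\eta'$ on the set of $\eta'\in[0,1)$ where $N^{(3)}_{g,N}(\eta')\ge 0$; (iii) for all $0\le\eta\le1$, $N\ge0$, $\mathcal K(\mathcal A_{g',N'})$ with $N'=N^{(4)}_{\eta,N}(g')$ is a non-increasing function of $g'\in(1,\infty)$; (iv) for all $0<\eta\le1$, $N\ge0$, $\mathcal K(\mathcal A_{g',N'})$ with $N'=N^{(3)}_{\eta,N}(g')$ is a non-decreasing function of $g'$ on the set of $g'>1$ where $N^{(3)}_{\eta,N}(g')\ge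 0$. -/

import Mathlib

open scoped ENNReal NNReal TensorProduct InnerProductSpace CStarAlgebra

noncomputable section

/-! ## Quantum systems, observables, states -/

/-- A quantum system: a complex Hilbert space. -/
structure QSystem : Type 1 where
  carrier : Type
  [normedAddCommGroup : NormedAddCommGroup carrier]
  [innerProductSpace : InnerProductSpace ℂ carrier]
  [completeSpace : CompleteSpace carrier]

attribute [instance] QSystem.normedAddCommGroup QSystem.innerProductSpace QSystem.completeSpace

instance : CoeSort QSystem Type := ⟨QSystem.carrier⟩

/-- The bounded operators on (the Hilbert space of) a system. -/
abbrev QSystem.Op (A : QSystem) : Type := A.carrier →L[ℂ] A.carrier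

/-- The system `ℂ^d`. -/
abbrev qudit (d : ℕ) : QSystem := ⟨EuclideanSpace ℂ (Fin d)⟩

/-- The trivial (one-dimensional) system. -/
abbrev trivialSystem : QSystem := ⟨ℂ⟩

/-- One bosonic mode: the Hilbert space `L²(ℝ)`. -/
abbrev oneMode : QSystem := ⟨MeasureTheory.Lp ℂ 2 (MeasureTheory.volume : MeasureTheory.Measure ℝ)⟩

/-- The composite system: the Hilbert space tensor product, i.e. the completion of the algebraic
tensor product with `⟪a ⊗ b, a' ⊗ b'⟫ = ⟪a, a'⟫ ⟪b, b'⟫`. -/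
abbrev QSystem.tensor (A B : QSystem) : QSystem :=
  ⟨UniformSpace.Completion (A.carrier ⊗[ℂ] B.carrier)⟩

infixl:70 " ⊗ₛ " => QSystem.tensor

/-- The bounded operator `X ⊗ Y` on a composite system. -/
def tensorOp {A B : QSystem} (X : A.Op) (Y : B.Op) : (A ⊗ₛ B).Op :=
  (TensorProduct.mapL X Y).completion

infixl:70 " ⊗ₒ " => tensorOp

/-- The matrix unit `|i⟩⟨j|` on `ℂ^d`. -/
def matrixUnit {d : ℕ} (i j : Fin d) : (qudit d).Op :=
  InnerProductSpace.rankOne ℂ (EuclideanSpace.single i (1 : ℂ)) (EuclideanSpace.single j (1 : ℂ))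

/-- `f` is a positive normal functional on the bounded operators, that is, `f X = Tr (ρ X)` for
the positive trace class operator `ρ = ∑ₙ |φₙ⟩⟨φₙ|`, where `∑ₙ ‖φₙ‖² = Tr ρ < ∞`. -/
def IsNormalFunctional {A : QSystem} (f : A.Op → ℂ) : Prop :=
  ∃ φ : ℕ → A, Summable (fun n => ‖φ n‖ ^ 2) ∧
    ∀ X : A.Op, HasSum (fun n => ⟪φ n, X (φ n)⟫_ℂ) (f X)

/-- A positive trace class operator `ρ`, given by its expectation functional `X ↦ Tr (ρ X)`;
the trace is not normalised, so that branches of a measurement can be described. -/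
structure SubState (A : QSystem) where
  expect : A.Op → ℂ
  normal : IsNormalFunctional expect

/-- A density operator: `Tr ρ = 1`. -/
def SubState.IsState {A : QSystem} (ρ : SubState A) : Prop := ρ.expect 1 = 1

/-! ## Quantum operations and channels -/

/-- A quantum operation from `A` to `B`: a completely positive map `T : B₁(A) → B₁(B)` between
trace class operators, given by its (Heisenberg) dual `T† : B(B) → B(A)`, where
`Tr (T(ρ) X) = Tr (ρ T†(X))`. Normality says that `T†` is the dual of a map on trace class
operators: every vector state `|ψ⟩⟨ψ|` is sent to a positive trace class operator. -/
structure QOperation (A B : QSystem) where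
  dual : B.Op →CP A.Op
  normal : ∀ ψ : A, IsNormalFunctional (fun X : B.Op => ⟪ψ, dual X ψ⟫_ℂ)

/-- A quantum channel: a completely positive trace preserving map, i.e. the dual is unital. -/
structure QChannel (A B : QSystem) extends QOperation A B where
  unital : dual 1 = 1

/-- `V†(X ⊗ Y)V` for an isometry `V` from `A` to `B ⊗ F`. -/
def pullback {A B F : QSystem} (V : A.carrier →ₗᵢ[ℂ] (B ⊗ₛ F).carrier) (X : B.Op) (Y : F.Op) :
    A.Op :=
  (ContinuousLinearMap.adjoint V.toContinuousLinearMap) ∘L (X ⊗ₒ Y) ∘L V.toContinuousLinearMap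

/-- The isometry `V : A → B ⊗ F` is a Stinespring dilation of the channel `Λ`, with environment
`F`: `Λ(ρ) = Tr_F (V ρ V†)`. The complementary channel is then `ρ ↦ Tr_B (V ρ V†)`, whose dual is
`Y ↦ V†(1 ⊗ Y)V`. -/
def IsDilation {A B F : QSystem} (Λ : QChannel A B) (V : A.carrier →ₗᵢ[ℂ] (B ⊗ₛ F).carrier) :
    Prop :=
  ∀ X : B.Op, Λ.dual X = pullback V X 1

/-- `n` copies of a system. -/
def QSystem.pow (A : QSystem) : ℕ → QSystem
  | 0 => trivialSystem
  | n + 1 => A.pow n ⊗ₛ A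

/-- `T` is the `n`-fold tensor power `Λ^{⊗n}`: `n` parallel uses of `Λ`. -/
def IsTensorPower {A B : QSystem} (Λ : QChannel A B) :
    (n : ℕ) → QChannel (A.pow n) (B.pow n) → Prop
  | 0, T => ∀ X : trivialSystem.Op, T.dual X = X
  | n + 1, T => ∃ T' : QChannel (A.pow n) (B.pow n), IsTensorPower Λ n T' ∧
      ∀ (X : (B.pow n).Op) (Y : B.Op), T.dual (X ⊗ₒ Y) = T'.dual X ⊗ₒ Λ.dual Y

/-! ## Single-mode phase-insensitive Gaussian channels -/

/-- The function `t ↦ exp(i a b / 2) exp(i a t) f(t + b)`. -/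
def weylFun (a b : ℝ) (f : ℝ → ℂ) (t : ℝ) : ℂ :=
  Complex.exp ((a * t + a * b / 2 : ℝ) * Complex.I) * f (t + b)

theorem norm_weylFun (a b : ℝ) (f : ℝ → ℂ) (t : ℝ) : ‖weylFun a b f t‖ = ‖f (t + b)‖ := by
  rw [weylFun, norm_mul, Complex.norm_exp_ofReal_mul_I, one_mul]

theorem eLpNorm_weylFun (a b : ℝ) {f : ℝ → ℂ}
    (hf : MeasureTheory.AEStronglyMeasurable f MeasureTheory.volume) :
    MeasureTheory.eLpNorm (weylFun a b f) 2 MeasureTheory.volume =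
      MeasureTheory.eLpNorm f 2 MeasureTheory.volume := by
  rw [MeasureTheory.eLpNorm_congr_norm_ae (g := f ∘ fun t => t + b)
    (Filter.Eventually.of_forall fun t => norm_weylFun a b f t)]
  exact MeasureTheory.eLpNorm_comp_measurePreserving hf
    (MeasureTheory.measurePreserving_add_right MeasureTheory.volume b)

theorem memLp_weylFun (a b : ℝ) {f : ℝ → ℂ} (hf : MeasureTheory.MemLp f 2 MeasureTheory.volume) :
    MeasureTheory.MemLp (weylFun a b f) 2 MeasureTheory.volume := by
  refine ⟨?_, by rw [eLpNorm_weylFun a b hf.1]; exact hf.2⟩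
  refine MeasureTheory.AEStronglyMeasurable.mul ?_ ?_
  · exact (by fun_prop : Continuous fun t : ℝ =>
      Complex.exp ((a * t + a * b / 2 : ℝ) * Complex.I)).aestronglyMeasurable
  · exact hf.1.comp_measurePreserving
      (MeasureTheory.measurePreserving_add_right MeasureTheory.volume b)

theorem weylFun_congr (a b : ℝ) {f g : ℝ → ℂ} (h : f =ᵐ[MeasureTheory.volume] g) :
    weylFun a b f =ᵐ[MeasureTheory.volume] weylFun a b g := by
  have := (MeasureTheory.measurePreserving_add_right
    (MeasureTheory.volume : MeasureTheory.Measure ℝ) b).quasiMeasurePreserving.ae_eq_comp h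
  filter_upwards [this] with t ht
  simp only [Function.comp] at ht
  rw [weylFun, weylFun, ht]

/-- The Weyl operator `W(a, b) = exp(i (a x̂ + b p̂))` on `L²(ℝ)`, where `x̂` is multiplication by
the coordinate and `p̂ = -i d/dt`; it acts by `(W f)(t) = exp(i a b / 2) exp(i a t) f(t + b)`. -/
def weyl (a b : ℝ) : oneMode.Op :=
  LinearIsometry.toContinuousLinearMap
    { toFun := fun f => (memLp_weylFun a b (MeasureTheory.Lp.memLp f)).toLp _
      map_add' := by
        intro f g
        rw [← MeasureTheory.MemLp.toLp_add]
        refine MeasureTheory.MemLp.toLp_congr _ _ ?_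
        refine (weylFun_congr a b (MeasureTheory.Lp.coeFn_add f g)).trans ?_
        exact Filter.Eventually.of_forall fun t => by
          simp only [weylFun, Pi.add_apply, mul_add]
      map_smul' := by
        intro c f
        rw [RingHom.id_apply, ← MeasureTheory.MemLp.toLp_const_smul]
        refine MeasureTheory.MemLp.toLp_congr _ _ ?_
        refine (weylFun_congr a b (MeasureTheory.Lp.coeFn_smul c f)).trans ?_
        exact Filter.Eventually.of_forall fun t => by
          simp only [weylFun, Pi.smul_apply, smul_eq_mul]; ring
      norm_map' := by
        intro f
        change ‖(memLp_weylFun a b (MeasureTheory.Lp.memLp f)).toLp _‖ = _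
        rw [MeasureTheory.Lp.norm_toLp, MeasureTheory.Lp.norm_def,
          eLpNorm_weylFun a b (MeasureTheory.Lp.memLp f).1] }

/-- `Λ` is the phase-insensitive Gaussian channel `Φ_{x,M}` (for `x, M ≥ 0`): on characteristic
functions `χ_ρ(ξ) = Tr (ρ W(ξ))` it acts by
`χ_{Λ(ρ)}(ξ) = exp(-(2M + |1 - x|) |ξ|² / 4) χ_ρ(√x ξ)`.
A Gaussian state with mean `m` and covariance matrix `V` (the vacuum having `V = I`) has
`χ(ξ) = exp(i ξ·m - ξ·Vξ / 4)`, so this is the map `m ↦ √x m`, `V ↦ x V + (2M + |1 - x|) I`. -/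
def IsPIGaussian (x M : ℝ) (Λ : QChannel oneMode oneMode) : Prop :=
  ∀ a b : ℝ, Λ.dual (weyl a b) =
    Complex.exp (-((2 * M + |1 - x|) * (a ^ 2 + b ^ 2) / 4 : ℝ)) •
      weyl (Real.sqrt x * a) (Real.sqrt x * b)

/-- `Λ` is the thermal attenuator `E_{η,N}` (for `0 ≤ η ≤ 1`, `N ≥ 0`). -/
def IsAttenuator (η N : ℝ) (Λ : QChannel oneMode oneMode) : Prop :=
  IsPIGaussian η ((1 - η) * N) Λ

/-- `Λ` is the thermal amplifier `A_{g,N}` (for `g ≥ 1`, `N ≥ 0`). -/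
def IsAmplifier (g N : ℝ) (Λ : QChannel oneMode oneMode) : Prop :=
  IsPIGaussian g ((g - 1) * N) Λ

/-! ## Capacities -/

/-- The entanglement fidelity `⟨Ω| (id ⊗ T)(|Ω⟩⟨Ω|) |Ω⟩` of a map on `d × d` matrices with dual
`T†`, where `Ω = d^{-1/2} ∑ᵢ |i⟩|i⟩`; it equals `d⁻² ∑ᵢⱼ ⟨j| T†(|j⟩⟨i|) |i⟩`. -/
def entanglementFidelity {d : ℕ} (Tdual : (qudit d).Op → (qudit d).Op) : ℝ :=
  (∑ i : Fin d, ∑ j : Fin d,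
    ⟪(EuclideanSpace.single j (1 : ℂ) : EuclideanSpace ℂ (Fin d)),
      Tdual (matrixUnit j i) (EuclideanSpace.single i (1 : ℂ))⟫_ℂ).re / (d : ℝ) ^ 2

/-- A `(n, d, ε)` quantum code for `Λ`: an encoding channel, `n` parallel uses of `Λ` and a
decoding channel preserve `d`-dimensional quantum information up to infidelity `ε`. -/
def QuantumCode {A B : QSystem} (Λ : QChannel A B) (n d : ℕ) (ε : ℝ) : Prop :=
  ∃ (Λn : QChannel (A.pow n) (B.pow n)) (enc : QChannel (qudit d) (A.pow n))
    (dec : QChannel (B.pow n) (qudit d)),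
    IsTensorPower Λ n Λn ∧
      1 - ε ≤ entanglementFidelity fun X => enc.dual (Λn.dual (dec.dual X))

/-- A `(n, d, ε)` private code for `Λ`: `d` classical messages are encoded into states `ρ m`, the
receiver's measurement (POVM) `D` recovers each of them with probability at least `1 - ε`, and the
states of the environment of `Λ^{⊗n}` for different messages are `ε`-close in trace norm. -/
def PrivateCode {A B : QSystem} (Λ : QChannel A B) (n d : ℕ) (ε : ℝ) : Prop :=
  ∃ (Λn : QChannel (A.pow n) (B.pow n)) (ρ : Fin d → SubState (A.pow n))
    (D : Fin d → (B.pow n).Op),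
    IsTensorPower Λ n Λn ∧ (∀ m, (ρ m).IsState) ∧ (∀ m, 0 ≤ D m) ∧ ∑ m, D m = 1 ∧
      (∀ m, 1 - ε ≤ ((ρ m).expect (Λn.dual (D m))).re) ∧
      ∀ (F : QSystem) (W : (A.pow n).carrier →ₗᵢ[ℂ] (B.pow n ⊗ₛ F).carrier), IsDilation Λn W →
        ∀ (m m' : Fin d) (Z : F.Op),
          ‖(ρ m).expect (pullback W 1 Z) - (ρ m').expect (pullback W 1 Z)‖ ≤ ε * ‖Z‖

/-- An instrument with countably many outcomes: the `x`-th outcome transforms the system by the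
quantum operation `I x`, and the probabilities of the outcomes add up to one. -/
def IsInstrument {A : QSystem} {A' : ℕ → QSystem} (I : ∀ x, QOperation A (A' x)) : Prop :=
  ∀ ψ : A, HasSum (fun x => ⟪ψ, (I x).dual 1 ψ⟫_ℂ) ((‖ψ‖ ^ 2 : ℝ) : ℂ)

/-- Adaptive protocols with unlimited two-way public classical communication over a channel with
Stinespring isometry `V : H → K ⊗ F`. `Protocol V loss n A B E ω δ` says that Alice, Bob (holding
`A`, `B`) and an eavesdropper (holding `E` and a copy of all classical communication), starting
from the joint (unnormalised) state `ω`, can run a protocol with exactly `n` uses of the channel,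
such that the total loss, summed over all transcripts, is `δ`; at the end of every branch Alice and
Bob hold one system `ℂ^d` each, and `loss E ω δ` says that `δ` is a bound for the loss of the final
(unnormalised) state `ω`. States are specified by their values on product operators, which
determine them.

* `alice`, `bob`: one party applies a local instrument and announces the outcome.
* `use`: Alice feeds a system `H` into the channel; Bob receives the output `K` and the
  eavesdropper receives the environment `F`. -/
inductive Protocol {H K F : QSystem} (V : H.carrier →ₗᵢ[ℂ] (K ⊗ₛ F).carrier) {d : ℕ}
    (loss : ∀ E : QSystem, SubState (qudit d ⊗ₛ qudit d ⊗ₛ E) → ℝ → Prop) :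
    ℕ → ∀ A B E : QSystem, SubState (A ⊗ₛ B ⊗ₛ E) → ℝ → Prop
  | finish {E : QSystem} (ω : SubState (qudit d ⊗ₛ qudit d ⊗ₛ E)) (δ : ℝ) (h : loss E ω δ) :
      Protocol V loss 0 (qudit d) (qudit d) E ω δ
  | alice {n : ℕ} {A B E : QSystem} {A' : ℕ → QSystem} (I : ∀ x, QOperation A (A' x))
      (hI : IsInstrument I) (ω : SubState (A ⊗ₛ B ⊗ₛ E)) (ω' : ∀ x, SubState (A' x ⊗ₛ B ⊗ₛ E))
      (hω : ∀ (x : ℕ) (X : (A' x).Op) (Y : B.Op) (Z : E.Op),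
        (ω' x).expect (X ⊗ₒ Y ⊗ₒ Z) = ω.expect ((I x).dual X ⊗ₒ Y ⊗ₒ Z))
      (δ : ℝ) (δ' : ℕ → ℝ) (hδ : HasSum δ' δ)
      (next : ∀ x, Protocol V loss n (A' x) B E (ω' x) (δ' x)) :
      Protocol V loss n A B E ω δ
  | bob {n : ℕ} {A B E : QSystem} {B' : ℕ → QSystem} (I : ∀ x, QOperation B (B' x))
      (hI : IsInstrument I) (ω : SubState (A ⊗ₛ B ⊗ₛ E)) (ω' : ∀ x, SubState (A ⊗ₛ B' x ⊗ₛ E))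
      (hω : ∀ (x : ℕ) (X : A.Op) (Y : (B' x).Op) (Z : E.Op),
        (ω' x).expect (X ⊗ₒ Y ⊗ₒ Z) = ω.expect (X ⊗ₒ (I x).dual Y ⊗ₒ Z))
      (δ : ℝ) (δ' : ℕ → ℝ) (hδ : HasSum δ' δ)
      (next : ∀ x, Protocol V loss n A (B' x) E (ω' x) (δ' x)) :
      Protocol V loss n A B E ω δ
  | use {n : ℕ} {A B E : QSystem} (ω : SubState ((A ⊗ₛ H) ⊗ₛ B ⊗ₛ E))
      (ω' : SubState (A ⊗ₛ (B ⊗ₛ K) ⊗ₛ (E ⊗ₛ F)))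
      (hω : ∀ (X : A.Op) (Y : B.Op) (Y' : K.Op) (Z : E.Op) (Z' : F.Op),
        ω'.expect (X ⊗ₒ (Y ⊗ₒ Y') ⊗ₒ (Z ⊗ₒ Z')) =
          ω.expect ((X ⊗ₒ pullback V Y' Z') ⊗ₒ Y ⊗ₒ Z))
      (δ : ℝ) (next : Protocol V loss n A (B ⊗ₛ K) (E ⊗ₛ F) ω' δ) :
      Protocol V loss (n + 1) (A ⊗ₛ H) B E ω δ

/-- `δ` bounds the infidelity `Tr ω - Tr (ω |Ω⟩⟨Ω|)` of Alice's and Bob's final state with the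
maximally entangled state, for which `|Ω⟩⟨Ω| = d⁻¹ ∑ᵢⱼ |i⟩⟨j| ⊗ |i⟩⟨j|`. -/
def entanglementLoss {d : ℕ} (E : QSystem) (ω : SubState (qudit d ⊗ₛ qudit d ⊗ₛ E)) (δ : ℝ) :
    Prop :=
  (ω.expect 1).re - (∑ i : Fin d, ∑ j : Fin d,
    ω.expect (matrixUnit i j ⊗ₒ matrixUnit i j ⊗ₒ (1 : E.Op))).re / d ≤ δ

/-- `δ` bounds the trace norm distance from the final state, after Alice and Bob have measured
their systems in the computational basis, to the ideal key `d⁻¹ ∑ₖ |k k⟩⟨k k| ⊗ Tr_{AB} ω`: the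
`(k, l)` block of the difference has trace norm at most `c k l`. -/
def keyLoss {d : ℕ} (E : QSystem) (ω : SubState (qudit d ⊗ₛ qudit d ⊗ₛ E)) (δ : ℝ) : Prop :=
  ∃ c : Fin d → Fin d → ℝ, (∀ k l, 0 ≤ c k l) ∧
    (∀ (k l : Fin d) (Z : E.Op),
      ‖ω.expect (matrixUnit k k ⊗ₒ matrixUnit l l ⊗ₒ Z) -
        (if k = l then (1 / d : ℂ) else 0) *
          ω.expect ((1 : (qudit d).Op) ⊗ₒ (1 : (qudit d).Op) ⊗ₒ Z)‖ ≤ c k l * ‖Z‖) ∧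
    ∑ k, ∑ l, c k l ≤ δ

/-- A protocol that starts from trivial systems, uses the channel `n` times and has total loss at
most `ε`, whatever dilation of the channel describes the environment. -/
def ProtocolCode {A B : QSystem} {d : ℕ}
    (loss : ∀ E : QSystem, SubState (qudit d ⊗ₛ qudit d ⊗ₛ E) → ℝ → Prop)
    (Λ : QChannel A B) (n : ℕ) (ε : ℝ) : Prop :=
  ∀ (F : QSystem) (V : A.carrier →ₗᵢ[ℂ] (B ⊗ₛ F).carrier), IsDilation Λ V →
    ∃ (ω : SubState (trivialSystem ⊗ₛ trivialSystem ⊗ₛ trivialSystem)) (δ : ℝ),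
      ω.IsState ∧ δ ≤ ε ∧ Protocol V loss n trivialSystem trivialSystem trivialSystem ω δ

/-- The four capacities: the quantum capacity `Q`, the private capacity `P`, the two-way quantum
capacity `Q₂` and the secret-key capacity `K`. -/
inductive CapacityKind
  | quantum
  | privateClassical
  | twoWayQuantum
  | secretKey

/-- The codes with `n` channel uses, size `d` (dimension of the transmitted system, of the
distilled maximally entangled state, number of messages or of keys) and error `ε`. -/
def HasCode : CapacityKind → ∀ {A B : QSystem}, QChannel A B → ℕ → ℕ → ℝ → Prop
  | .quantum, _, _, Λ, n, d, ε => QuantumCode Λ n d ε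
  | .privateClassical, _, _, Λ, n, d, ε => PrivateCode Λ n d ε
  | .twoWayQuantum, _, _, Λ, n, d, ε => ProtocolCode (entanglementLoss (d := d)) Λ n ε
  | .secretKey, _, _, Λ, n, d, ε => ProtocolCode (keyLoss (d := d)) Λ n ε

/-- `R` (in bits or qubits per channel use) is an achievable rate. -/
def Achievable (κ : CapacityKind) {A B : QSystem} (Λ : QChannel A B) (R : ℝ≥0) : Prop :=
  ∀ ε : ℝ, 0 < ε → ∃ n₀ : ℕ, ∀ n : ℕ, n₀ ≤ n →
    ∃ d : ℕ, (2 : ℝ) ^ ((n : ℝ) * (R : ℝ)) ≤ d ∧ HasCode κ Λ n d ε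

/-- The capacity: the supremum of the achievable rates. -/
def capacity (κ : CapacityKind) {A B : QSystem} (Λ : QChannel A B) : ℝ≥0∞ :=
  ⨆ (R : ℝ≥0) (_ : Achievable κ Λ R), (R : ℝ≥0∞)

/-! ## The curves -/

/-- `N^{(3)}_{g,N}(η')`. -/
def curveAmp3 (g N η' : ℝ) : ℝ := N * ((g - 1) / (1 - η')) - 1

/-- `N^{(4)}_{g,N}(η')`. -/
def curveAmp4 (g N η' : ℝ) : ℝ := (N + 1) * ((g - 1) / g) * (η' / (1 - η'))

/-- `N^{(3)}_{η,N}(g')`. -/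
def curveAtt3 (η N g' : ℝ) : ℝ := N * ((1 - η) / η) * (g' / (g' - 1)) - 1

/-- `N^{(4)}_{η,N}(g')`. -/
def curveAtt4 (η N g' : ℝ) : ℝ := (N + 1) * ((1 - η) / (g' - 1))

end

/-! Describe a phase-insensitive Gaussian channel by the pair `(x, y)` in its action `χ(ξ) ↦ exp(-y
|ξ|² / 4) χ(√x ξ)` (`IsGaussianMap`). Along `curveAmp4` and `curveAtt3` the quantity `y - 1` is a
fixed multiple of `x`. A pure-loss attenuator placed after the channel acts by `(x, y) ↦ (t x, t y +
1 - t)` and preserves this relation. Along `curveAmp3` and `curveAtt4` the difference `y - x` is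
constant. A quantum-limited amplifier placed before the channel acts by `(x, y) ↦ (g x, y + x (g -
1))` and preserves that difference. So of two channels on one curve, one is the other with some pre-
or post-processing, and monotonicity is the data processing inequality `capacity_le_of_comp`.

One case escapes. On `curveAmp3` with `η₁ = 0` no amplifier leads away from `x = 0`. There
non-negativity of the curve at `0` means `N (g - 1) ≥ 1`, hence `y ≥ 1 + x` at `η₂`: that channel is
entanglement breaking and must be shown to have capacity zero (`IsGaussianMap.capacity_eq_zero`). It
is heterodyne detection, preparation of a coherent state and amplification. The preparation has a
dilation whose environment is its own input, left undisturbed as far as Bob's data are concerned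
(`IsCommuting`), so an eavesdropper can produce Bob's system herself. Commutativity gives a partial
transpose bound on the fidelity with a maximally entangled state, and her copy of Bob's data rules
out secrecy (`capacity_eq_zero_of_isCommuting`).

Channels are given abstractly by normal completely positive dual maps, so three tools are needed
throughout. Stinespring dilations (`QOperation.exists_stinespring`) give tensor products of
operations and simulations of adaptive protocols (`protocol_simulation`). Normal functionals are
determined by product operators and by Weyl operators (`IsNormalForm.ext_tensor`,
`IsNormalForm.ext_weyl`), so a Gaussian channel is determined by `(x, y)`. Gaussian dilations come
from equality of Gram matrices of displaced Gaussian vectors (`WeylSystem.exists_isometry`). -/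

noncomputable section

/-! ## Total sets and Gram isometries -/

/-- The linear span of `S` is dense. -/
def TotalSet {H : Type*} [NormedAddCommGroup H] [InnerProductSpace ℂ H] (S : Set H) : Prop :=
  Dense (Submodule.span ℂ S : Set H)

section TotalSet

variable {H H' : Type*} [NormedAddCommGroup H] [InnerProductSpace ℂ H]
  [NormedAddCommGroup H'] [InnerProductSpace ℂ H']

theorem total_univ : TotalSet (Set.univ : Set H) := by
  rw [TotalSet, Submodule.span_univ]
  exact dense_univ

theorem TotalSet.mono {S T : Set H} (hS : TotalSet S) (h : S ⊆ T) : TotalSet T :=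
  Dense.mono (Submodule.span_mono h) hS

theorem TotalSet.ext {S : Set H} (hS : TotalSet S) {V W : H →L[ℂ] H'} (h : ∀ s ∈ S, V s = W s) : V = W :=
  ContinuousLinearMap.ext_on hS h

theorem TotalSet.mem_of_isClosed {S : Set H} (hS : TotalSet S) {p : Submodule ℂ H}
    (hp : IsClosed (p : Set H)) (h : S ⊆ p) (x : H) : x ∈ p := by
  have h1 : Submodule.span ℂ S ≤ p := Submodule.span_le.2 h
  have h2 := hS x
  exact (closure_minimal h1 hp) h2

theorem TotalSet.of_forall_mem_closure {S T : Set H} (hS : TotalSet S)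
    (h : ∀ s ∈ S, s ∈ (Submodule.span ℂ T).topologicalClosure) : TotalSet T := by
  intro x
  have := hS.mem_of_isClosed (p := (Submodule.span ℂ T).topologicalClosure)
    (Submodule.isClosed_topologicalClosure _) h x
  rwa [← SetLike.mem_coe, Submodule.topologicalClosure_coe] at this

theorem TotalSet.eq_zero {S : Set H} (hS : TotalSet S) {x : H} (h : ∀ s ∈ S, ⟪s, x⟫_ℂ = 0) : x = 0 := by
  have h1 : innerSL ℂ x = (0 : H →L[ℂ] ℂ) := hS.ext fun s hs => by
    simp only [innerSL_apply_apply, zero_apply]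
    rw [← inner_conj_symm, h s hs, map_zero]
  have := congrArg (fun L : H →L[ℂ] ℂ => L x) h1
  simpa using this

theorem total_of_eq_zero [CompleteSpace H] {S : Set H}
    (h : ∀ x : H, (∀ s ∈ S, ⟪s, x⟫_ℂ = 0) → x = 0) : TotalSet S := by
  have : (Submodule.span ℂ S).topologicalClosure = ⊤ := by
    rw [Submodule.topologicalClosure_eq_top_iff, Submodule.eq_bot_iff]
    intro x hx
    refine h x fun s hs => ?_
    exact (Submodule.mem_orthogonal _ _).1 hx s (Submodule.subset_span hs)
  exact Submodule.dense_iff_topologicalClosure_eq_top.2 this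

theorem TotalSet.image {S : Set H} (hS : TotalSet S) (L : H →L[ℂ] H') (hL : DenseRange L) :
    TotalSet (L '' S) := by
  rw [TotalSet, ← ContinuousLinearMap.coe_coe, Submodule.span_image, Submodule.map_coe]
  exact hL.dense_image L.continuous hS

/-- A family of vectors is mapped isometrically to one with the same Gram matrix. -/
theorem exists_gramIsometry [CompleteSpace H'] {ι : Type*} (v : ι → H) (w : ι → H')
    (hv : TotalSet (Set.range v)) (h : ∀ i j, ⟪w i, w j⟫_ℂ = ⟪v i, v j⟫_ℂ) :
    ∃ L : H →ₗᵢ[ℂ] H', ∀ i, L (v i) = w i := by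
  have hn : ∀ c : ι →₀ ℂ, ‖Finsupp.linearCombination ℂ w c‖ = ‖Finsupp.linearCombination ℂ v c‖ := by
    intro c
    have : ⟪Finsupp.linearCombination ℂ w c, Finsupp.linearCombination ℂ w c⟫_ℂ =
        ⟪Finsupp.linearCombination ℂ v c, Finsupp.linearCombination ℂ v c⟫_ℂ := by
      simp only [Finsupp.linearCombination_apply, Finsupp.sum_inner, Finsupp.inner_sum,
        inner_smul_left, inner_smul_right, h]
    rw [inner_self_eq_norm_sq_to_K, inner_self_eq_norm_sq_to_K] at this
    have h2 : ‖Finsupp.linearCombination ℂ w c‖ ^ 2 = ‖Finsupp.linearCombination ℂ v c‖ ^ 2 := by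
      exact_mod_cast this
    exact (sq_eq_sq₀ (norm_nonneg _) (norm_nonneg _)).1 h2
  have hd : DenseRange (Finsupp.linearCombination ℂ v) := by
    have : Set.range (Finsupp.linearCombination ℂ v) = (Submodule.span ℂ (Set.range v) : Set H) := by
      rw [← Finsupp.range_linearCombination]; rfl
    rw [DenseRange, this]
    exact hv
  let L0 : H →L[ℂ] H' := (Finsupp.linearCombination ℂ w).extendOfNorm (Finsupp.linearCombination ℂ v)
  have hL0 : ∀ c, L0 (Finsupp.linearCombination ℂ v c) = Finsupp.linearCombination ℂ w c := fun c =>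
    LinearMap.extendOfNorm_eq hd ⟨1, fun c => by rw [hn, one_mul]⟩ c
  refine ⟨⟨L0.toLinearMap, fun x => ?_⟩, fun i => ?_⟩
  · refine hd.induction (P := fun x => ‖L0 x‖ = ‖x‖) ?_ (isClosed_eq (by fun_prop) (by fun_prop)) x
    rintro _ ⟨c, rfl⟩
    rw [hL0, hn]
  · have := hL0 (Finsupp.single i 1)
    simpa using this

end TotalSet

/-! ## Tensor products of vectors and operators -/

/-- Bounded operators between systems. -/
abbrev QSystem.Hom (A B : QSystem) : Type := A.carrier →L[ℂ] B.carrier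

/-- The product vector `a ⊗ b`. -/
def tmul {A B : QSystem} (a : A) (b : B) : (A ⊗ₛ B : QSystem) :=
  ((a ⊗ₜ[ℂ] b : A.carrier ⊗[ℂ] B.carrier) : UniformSpace.Completion (A.carrier ⊗[ℂ] B.carrier))

infixl:70 " ⊗ᵥ " => tmul

section Tensor

variable {A B C D A' B' A'' B'' : QSystem}

theorem inner_tmul_tmul (a a' : A) (b b' : B) :
    ⟪a ⊗ᵥ b, a' ⊗ᵥ b'⟫_ℂ = ⟪a, a'⟫_ℂ * ⟪b, b'⟫_ℂ := by
  rw [tmul, tmul, UniformSpace.Completion.inner_coe, TensorProduct.inner_tmul]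

theorem norm_tmul_vec (a : A) (b : B) : ‖a ⊗ᵥ b‖ = ‖a‖ * ‖b‖ := by
  rw [tmul, UniformSpace.Completion.norm_coe, TensorProduct.norm_tmul]

/-- The bilinear map `(a, b) ↦ a ⊗ b`. -/
def tmulL (A B : QSystem) : A.carrier →L[ℂ] B.carrier →L[ℂ] (A ⊗ₛ B).carrier :=
  LinearMap.mkContinuous₂
    (LinearMap.mk₂ ℂ (fun a b => (a ⊗ᵥ b))
      (fun _ _ _ => by simp only [tmul, TensorProduct.add_tmul, UniformSpace.Completion.coe_add])
      (fun _ _ _ => by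
        simp only [tmul, ← TensorProduct.smul_tmul', UniformSpace.Completion.coe_smul])
      (fun _ _ _ => by simp only [tmul, TensorProduct.tmul_add, UniformSpace.Completion.coe_add])
      (fun _ _ _ => by simp only [tmul, TensorProduct.tmul_smul, UniformSpace.Completion.coe_smul]))
    1 (fun a b => by
      rw [one_mul]
      exact (norm_tmul_vec a b).le)

@[simp] theorem tmulL_apply (a : A) (b : B) : tmulL A B a b = a ⊗ᵥ b := rfl

theorem add_tmul_vec (a a' : A) (b : B) : (a + a') ⊗ᵥ b = a ⊗ᵥ b + a' ⊗ᵥ b := by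
  simp -proj only [← tmulL_apply, map_add, add_apply]

theorem tmul_add_vec (a : A) (b b' : B) : a ⊗ᵥ (b + b') = a ⊗ᵥ b + a ⊗ᵥ b' := by
  simp -proj only [← tmulL_apply, map_add]

theorem smul_tmul_vec (c : ℂ) (a : A) (b : B) : (c • a) ⊗ᵥ b = c • (a ⊗ᵥ b) := by
  simp -proj only [← tmulL_apply, map_smul, smul_apply]

theorem tmul_smul_vec (c : ℂ) (a : A) (b : B) : a ⊗ᵥ (c • b) = c • (a ⊗ᵥ b) := by
  simp -proj only [← tmulL_apply, map_smul]

theorem total_tmul {S : Set A.carrier} {T : Set B.carrier} (hS : TotalSet S) (hT : TotalSet T) :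
    TotalSet {x : (A ⊗ₛ B).carrier | ∃ a ∈ S, ∃ b ∈ T, x = a ⊗ᵥ b} := by
  have h0 : TotalSet {x : (A ⊗ₛ B).carrier | ∃ a b, x = a ⊗ᵥ b} := by
    have h1 : TotalSet {x : A.carrier ⊗[ℂ] B.carrier | ∃ a b, a ⊗ₜ[ℂ] b = x} := by
      rw [TotalSet, TensorProduct.span_tmul_eq_top]
      exact dense_univ
    refine (h1.image (UniformSpace.Completion.toComplL) (UniformSpace.Completion.denseRange_coe)).mono ?_
    rintro _ ⟨_, ⟨a, b, rfl⟩, rfl⟩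
    exact ⟨a, b, rfl⟩
  refine h0.of_forall_mem_closure ?_
  rintro _ ⟨a, b, rfl⟩
  set p := (Submodule.span ℂ {x : (A ⊗ₛ B).carrier | ∃ a ∈ S, ∃ b ∈ T, x = a ⊗ᵥ b}).topologicalClosure
  have hp : IsClosed (p : Set (A ⊗ₛ B).carrier) := Submodule.isClosed_topologicalClosure _
  have h2 : ∀ a ∈ S, ∀ b : B, a ⊗ᵥ b ∈ p := fun a ha b =>
    hT.mem_of_isClosed (p := p.comap (tmulL A B a).toLinearMap)
      (hp.preimage (tmulL A B a).continuous)
      (fun b hb => Submodule.le_topologicalClosure _ (Submodule.subset_span ⟨a, ha, b, hb, rfl⟩)) b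
  exact hS.mem_of_isClosed (p := p.comap ((tmulL A B).flip b).toLinearMap)
    (hp.preimage ((tmulL A B).flip b).continuous) (fun a ha => h2 a ha b) a

theorem total_pure (A B : QSystem) : TotalSet {x : (A ⊗ₛ B).carrier | ∃ a b, x = a ⊗ᵥ b} :=
  (total_tmul total_univ total_univ).mono (by rintro _ ⟨a, -, b, -, rfl⟩; exact ⟨a, b, rfl⟩)

theorem hom_ext {H : Type*} [NormedAddCommGroup H] [InnerProductSpace ℂ H]
    {V W : (A ⊗ₛ B).carrier →L[ℂ] H} (h : ∀ a b, V (a ⊗ᵥ b) = W (a ⊗ᵥ b)) : V = W :=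
  (total_pure A B).ext (by rintro _ ⟨a, b, rfl⟩; exact h a b)

/-- The operator `V ⊗ W`. -/
def tmap (V : A.Hom A') (W : B.Hom B') : (A ⊗ₛ B).Hom (A' ⊗ₛ B') :=
  (TensorProduct.mapL V W).completion

theorem tensorOp_eq_tmap (X : A.Op) (Y : B.Op) : X ⊗ₒ Y = tmap X Y := rfl

@[simp] theorem tmap_tmul (V : A.Hom A') (W : B.Hom B') (a : A) (b : B) :
    tmap V W (a ⊗ᵥ b) = V a ⊗ᵥ W b := by
  rw [tmap, tmul, ContinuousLinearMap.completion_apply_coe]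
  rfl

@[simp] theorem tensorOp_tmul (X : A.Op) (Y : B.Op) (a : A) (b : B) :
    (X ⊗ₒ Y) (a ⊗ᵥ b) = X a ⊗ᵥ Y b := tmap_tmul X Y a b

theorem tmap_comp (V' : A'.Hom A'') (W' : B'.Hom B'') (V : A.Hom A') (W : B.Hom B') :
    tmap (V' ∘L V) (W' ∘L W) = tmap V' W' ∘L tmap V W :=
  hom_ext fun a b => by simp -proj

theorem tmap_id : tmap (ContinuousLinearMap.id ℂ A.carrier) (ContinuousLinearMap.id ℂ B.carrier) =
    ContinuousLinearMap.id ℂ (A ⊗ₛ B).carrier :=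
  hom_ext fun a b => by simp -proj

theorem tmap_adjoint (V : A.Hom A') (W : B.Hom B') :
    ContinuousLinearMap.adjoint (tmap V W) =
      tmap (ContinuousLinearMap.adjoint V) (ContinuousLinearMap.adjoint W) := by
  refine hom_ext fun a b => ?_
  refine sub_eq_zero.1 ((total_pure A B).eq_zero ?_)
  rintro _ ⟨a', b', rfl⟩
  rw [inner_sub_right, ContinuousLinearMap.adjoint_inner_right, tmap_tmul, tmap_tmul,
    inner_tmul_tmul, inner_tmul_tmul, ContinuousLinearMap.adjoint_inner_right,
    ContinuousLinearMap.adjoint_inner_right, sub_self]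

theorem norm_tmap_le (V : A.Hom A') (W : B.Hom B') : ‖tmap V W‖ ≤ ‖V‖ * ‖W‖ := by
  refine ContinuousLinearMap.opNorm_le_bound _ (by positivity) fun x => ?_
  refine UniformSpace.Completion.induction_on x (isClosed_le (by fun_prop) (by fun_prop)) fun y => ?_
  rw [tmap, ContinuousLinearMap.completion_apply_coe, UniformSpace.Completion.norm_coe,
    UniformSpace.Completion.norm_coe]
  exact ((TensorProduct.mapL V W).le_opNorm y).trans
    (mul_le_mul_of_nonneg_right (TensorProduct.norm_mapL_le V W) (norm_nonneg _))

theorem tmap_add_left (V V' : A.Hom A') (W : B.Hom B') : tmap (V + V') W = tmap V W + tmap V' W :=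
  hom_ext fun a b => by simp -proj [add_tmul_vec]

theorem tmap_add_right (V : A.Hom A') (W W' : B.Hom B') : tmap V (W + W') = tmap V W + tmap V W' :=
  hom_ext fun a b => by simp -proj [tmul_add_vec]

theorem tmap_smul_left (c : ℂ) (V : A.Hom A') (W : B.Hom B') : tmap (c • V) W = c • tmap V W :=
  hom_ext fun a b => by simp -proj [smul_tmul_vec]

theorem tmap_smul_right (c : ℂ) (V : A.Hom A') (W : B.Hom B') : tmap V (c • W) = c • tmap V W :=
  hom_ext fun a b => by simp -proj [tmul_smul_vec]

/-- The bilinear map `(X, Y) ↦ X ⊗ Y`. -/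
def tensorOpL (A B : QSystem) : A.Op →ₗ[ℂ] B.Op →ₗ[ℂ] (A ⊗ₛ B).Op :=
  LinearMap.mk₂ ℂ (fun X Y => X ⊗ₒ Y) tmap_add_left (fun c X Y => tmap_smul_left c X Y)
    tmap_add_right (fun c X Y => tmap_smul_right c X Y)

@[simp] theorem tensorOpL_apply (X : A.Op) (Y : B.Op) : tensorOpL A B X Y = X ⊗ₒ Y := rfl

theorem add_tensorOp (X X' : A.Op) (Y : B.Op) : (X + X') ⊗ₒ Y = X ⊗ₒ Y + X' ⊗ₒ Y :=
  tmap_add_left X X' Y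

theorem tensorOp_add (X : A.Op) (Y Y' : B.Op) : X ⊗ₒ (Y + Y') = X ⊗ₒ Y + X ⊗ₒ Y' :=
  tmap_add_right X Y Y'

theorem smul_tensorOp (c : ℂ) (X : A.Op) (Y : B.Op) : (c • X) ⊗ₒ Y = c • (X ⊗ₒ Y) :=
  tmap_smul_left c X Y

theorem tensorOp_smul (c : ℂ) (X : A.Op) (Y : B.Op) : X ⊗ₒ (c • Y) = c • (X ⊗ₒ Y) :=
  tmap_smul_right c X Y

theorem sum_tensorOp {ι : Type*} (s : Finset ι) (X : ι → A.Op) (Y : B.Op) :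
    (∑ i ∈ s, X i) ⊗ₒ Y = ∑ i ∈ s, X i ⊗ₒ Y := by
  simp -proj only [← tensorOpL_apply, map_sum, LinearMap.sum_apply]

theorem tensorOp_sum {ι : Type*} (s : Finset ι) (X : A.Op) (Y : ι → B.Op) :
    X ⊗ₒ (∑ i ∈ s, Y i) = ∑ i ∈ s, X ⊗ₒ Y i := by
  simp -proj only [← tensorOpL_apply, map_sum]

theorem tensorOp_sub (X : A.Op) (Y Y' : B.Op) : X ⊗ₒ (Y - Y') = X ⊗ₒ Y - X ⊗ₒ Y' := by
  simp -proj only [← tensorOpL_apply, map_sub]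

theorem tensorOp_mul (X X' : A.Op) (Y Y' : B.Op) : (X ⊗ₒ Y) * (X' ⊗ₒ Y') = (X * X') ⊗ₒ (Y * Y') :=
  (tmap_comp X Y X' Y').symm

@[simp] theorem one_tensorOp_one : (1 : A.Op) ⊗ₒ (1 : B.Op) = 1 := tmap_id

theorem tensorOp_star (X : A.Op) (Y : B.Op) : star (X ⊗ₒ Y) = star X ⊗ₒ star Y := tmap_adjoint X Y

theorem total_range_triple (A B C : QSystem) :
    TotalSet (Set.range fun p : A.carrier × B.carrier × C.carrier => p.1 ⊗ᵥ p.2.1 ⊗ᵥ p.2.2) := by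
  refine (total_tmul (total_pure A B) (total_univ (H := C.carrier))).mono ?_
  rintro _ ⟨_, ⟨a, b, rfl⟩, c, -, rfl⟩
  exact ⟨⟨a, b, c⟩, rfl⟩

end Tensor

end

noncomputable section

/-! ## Normal functionals -/

section Summation

open Filter Topology

variable {H H' : Type*} [NormedAddCommGroup H] [InnerProductSpace ℂ H]
  [NormedAddCommGroup H'] [InnerProductSpace ℂ H']

/-- Uniformly bounded operators are equicontinuous, so the vectors at which they converge form a
closed subspace. -/
theorem TotalSet.tendsto {ι : Type*} {l : Filter ι} {S : Set H} (hS : TotalSet S)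
    (T : ι → H →L[ℂ] H') (T' : H →L[ℂ] H') (K : ℝ≥0) (hK : ∀ i, ‖T i‖₊ ≤ K)
    (h : ∀ s ∈ S, Tendsto (fun i => T i s) l (𝓝 (T' s))) (x : H) :
    Tendsto (fun i => T i x) l (𝓝 (T' x)) := by
  have heq : Equicontinuous (fun i => (T i : H → H')) :=
    (LipschitzWith.uniformEquicontinuous _ K
      fun i => (T i).lipschitz.weaken (hK i)).equicontinuous
  let p : Submodule ℂ H :=
    { carrier := {x | Tendsto (fun i => T i x) l (𝓝 (T' x))}
      add_mem' := fun {x y} hx hy => by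
        simp only [Set.mem_ofPred_eq, map_add] at *
        exact hx.add hy
      zero_mem' := by
        simp only [Set.mem_ofPred_eq, map_zero]
        exact tendsto_const_nhds
      smul_mem' := fun c x hx => by
        simp only [Set.mem_ofPred_eq, map_smul] at *
        exact hx.const_smul c }
  exact hS.mem_of_isClosed (p := p) (heq.isClosed_setOfPred_tendsto T'.continuous) h x

theorem hasSum_of_eq {ι : Type*} {f g : ι → ℂ} {a b : ℂ} (h : HasSum f a) (hfg : ∀ i, g i = f i)
    (hab : b = a) : HasSum g b := by
  obtain rfl : g = f := funext hfg
  rwa [hab]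

theorem summable_inner_of_sq {ι : Type*} {φ χ : ι → H} (hφ : Summable fun i => ‖φ i‖ ^ 2)
    (hχ : Summable fun i => ‖χ i‖ ^ 2) (X : H →L[ℂ] H) :
    Summable fun i => ‖⟪φ i, X (χ i)⟫_ℂ‖ := by
  refine Summable.of_nonneg_of_le (fun i => norm_nonneg _) (fun i => ?_)
    ((hφ.add hχ).mul_left ‖X‖)
  calc ‖⟪φ i, X (χ i)⟫_ℂ‖ ≤ ‖φ i‖ * (‖X‖ * ‖χ i‖) :=
        (norm_inner_le_norm _ _).trans
          (mul_le_mul_of_nonneg_left (X.le_opNorm _) (norm_nonneg _))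
    _ = ‖X‖ * (‖φ i‖ * ‖χ i‖) := by ring
    _ ≤ ‖X‖ * (‖φ i‖ ^ 2 + ‖χ i‖ ^ 2) := by
        refine mul_le_mul_of_nonneg_left ?_ (norm_nonneg _)
        nlinarith [sq_nonneg (‖φ i‖ - ‖χ i‖), sq_nonneg (‖φ i‖), sq_nonneg (‖χ i‖)]

theorem hasSum_sigma_inner {ι : Type*} {κ : ι → Type*} {φ χ : (Σ i, κ i) → H}
    (hφ : Summable fun p => ‖φ p‖ ^ 2) (hχ : Summable fun p => ‖χ p‖ ^ 2) (X : H →L[ℂ] H)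
    {f : ι → ℂ} {a : ℂ} (hf : ∀ i, HasSum (fun j => ⟪φ ⟨i, j⟩, X (χ ⟨i, j⟩)⟫_ℂ) (f i))
    (ha : HasSum f a) : HasSum (fun p => ⟪φ p, X (χ p)⟫_ℂ) a := by
  have hs : Summable fun p => ⟪φ p, X (χ p)⟫_ℂ := (summable_inner_of_sq hφ hχ X).of_norm
  have := hs.hasSum.sigma hf
  rw [ha.unique this]
  exact hs.hasSum

theorem summable_sigma_sq {E : Type*} [NormedAddCommGroup E] {ι : Type*} {κ : ι → Type*}
    {φ : (Σ i, κ i) → E} {f : ι → ℝ}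
    (h : ∀ i, HasSum (fun j => ‖φ ⟨i, j⟩‖ ^ 2) (f i)) (hf : Summable f) :
    Summable fun p => ‖φ p‖ ^ 2 := by
  rw [summable_sigma_of_nonneg fun _ => by positivity]
  refine ⟨fun i => (h i).summable, ?_⟩
  convert hf using 2 with i
  exact (h i).tsum_eq

theorem hasSum_norm_sq {ι : Type*} {φ : ι → H} {a : ℂ}
    (h : HasSum (fun i => ⟪φ i, φ i⟫_ℂ) a) : HasSum (fun i => ‖φ i‖ ^ 2) a.re := by
  have := Complex.hasSum_re h
  convert this using 2 with i
  exact (inner_self_eq_norm_sq (𝕜 := ℂ) _).symm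

end Summation

/-- `IsNormalFunctional` asks for a sequence. A square summable family has countable support, which
is encoded into `ℕ` and padded with zero vectors. -/
theorem isNormalFunctional_of_family {A : QSystem} {ι : Type*} (φ : ι → A.carrier)
    (hφ : Summable fun i => ‖φ i‖ ^ 2) (f : A.Op → ℂ)
    (hf : ∀ X : A.Op, HasSum (fun i => ⟪φ i, X (φ i)⟫_ℂ) (f X)) : IsNormalFunctional f := by
  have hc : (Function.support φ).Countable := by
    refine hφ.countable_support.mono fun i hi => ?_
    simpa using hi
  have := hc.to_subtype
  have := Encodable.ofCountable (Function.support φ)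
  have hinj : Function.Injective (Encodable.encode : Function.support φ → ℕ) :=
    Encodable.encode_injective
  let ψ : ℕ → A.carrier := Function.extend Encodable.encode (fun i : Function.support φ => φ i) 0
  have key : ∀ {β : Type} [AddCommMonoid β] (F : A.carrier → β), F 0 = 0 →
      (fun n => F (ψ n)) =
        Function.extend Encodable.encode (fun i : Function.support φ => F (φ i)) 0 := by
    intro β _ F hF
    funext n
    by_cases h : ∃ i : Function.support φ, Encodable.encode i = n
    · obtain ⟨i, rfl⟩ := h
      simp only [ψ, hinj.extend_apply]
    · simp only [ψ, Function.extend_apply' _ _ _ h, Pi.zero_apply, hF]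
  refine ⟨ψ, ?_, fun X => ?_⟩
  · rw [key (fun x => ‖x‖ ^ 2) (by simp), summable_extend_zero hinj]
    exact hφ.subtype _
  · rw [key (fun x => ⟪x, X x⟫_ℂ) (by simp), hasSum_extend_zero hinj]
    refine (hasSum_subtype_iff_of_support_subset (f := fun i => ⟪φ i, X (φ i)⟫_ℂ) ?_).2 (hf X)
    intro i hi
    simp only [Function.mem_support] at hi ⊢
    rintro h0
    exact hi (by rw [h0]; simp)

/-- `g X = ∑ᵢ ⟪φᵢ, X χᵢ⟫` with square summable families: a normal functional, not necessarily
positive. -/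
def IsNormalForm {A : QSystem} (g : A.Op → ℂ) : Prop :=
  ∃ (ι : Type) (φ χ : ι → A.carrier), (Summable fun i => ‖φ i‖ ^ 2) ∧
    (Summable fun i => ‖χ i‖ ^ 2) ∧ ∀ X : A.Op, HasSum (fun i => ⟪φ i, X (χ i)⟫_ℂ) (g X)

section NormalForm

variable {A B C : QSystem}

theorem IsNormalFunctional.isNormalForm {f : A.Op → ℂ} (hf : IsNormalFunctional f) :
    IsNormalForm f := by
  obtain ⟨φ, h1, h2⟩ := hf
  exact ⟨ℕ, φ, φ, h1, h1, h2⟩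

theorem isNormalForm_inner (φ χ : A.carrier) : IsNormalForm (fun X : A.Op => ⟪φ, X χ⟫_ℂ) :=
  ⟨Unit, fun _ => φ, fun _ => χ, .of_finite, .of_finite, fun X => by
    exact hasSum_unique (fun _ : Unit => ⟪φ, X χ⟫_ℂ)⟩

theorem IsNormalForm.const_mul {g : A.Op → ℂ} (hg : IsNormalForm g) (c : ℂ) :
    IsNormalForm fun X => c * g X := by
  obtain ⟨ι, φ, χ, h1, h2, h3⟩ := hg
  refine ⟨ι, φ, fun i => c • χ i, h1, ?_, fun X => ?_⟩
  · simp only [norm_smul, mul_pow]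
    exact h2.mul_left _
  · simp only [map_smul, inner_smul_right]
    exact (h3 X).mul_left c

theorem IsNormalForm.comp_conj {g : A.Op → ℂ} (hg : IsNormalForm g) (V W : A.Hom B) :
    IsNormalForm fun X : B.Op => g (ContinuousLinearMap.adjoint V ∘L X ∘L W) := by
  obtain ⟨ι, φ, χ, h1, h2, h3⟩ := hg
  have hb : ∀ (V : A.Hom B) (φ : ι → A.carrier), (Summable fun i => ‖φ i‖ ^ 2) →
      Summable fun i => ‖V (φ i)‖ ^ 2 := fun V φ h =>
    Summable.of_nonneg_of_le (fun i => by positivity)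
      (fun i => (pow_le_pow_left₀ (norm_nonneg _) (V.le_opNorm _) 2).trans_eq (mul_pow _ _ 2))
      (h.mul_left (‖V‖ ^ 2))
  refine ⟨ι, fun i => V (φ i), fun i => W (χ i), hb V φ h1, hb W χ h2, fun X => ?_⟩
  refine hasSum_of_eq (h3 (ContinuousLinearMap.adjoint V ∘L X ∘L W)) (fun i => ?_) rfl
  simp only [ContinuousLinearMap.comp_apply, ContinuousLinearMap.adjoint_inner_right]

theorem IsNormalForm.mul_left {g : A.Op → ℂ} (hg : IsNormalForm g) (Z : A.Op) :
    IsNormalForm fun X : A.Op => g (Z * X) := by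
  have := hg.comp_conj (ContinuousLinearMap.adjoint Z) 1
  simp only [ContinuousLinearMap.adjoint_adjoint] at this
  exact this

theorem IsNormalForm.mul_right {g : A.Op → ℂ} (hg : IsNormalForm g) (Z : A.Op) :
    IsNormalForm fun X : A.Op => g (X * Z) := by
  have := hg.comp_conj (1 : A.Op) Z
  rw [show ContinuousLinearMap.adjoint (1 : A.Op) = 1 from star_one _] at this
  exact this

/-- A normal functional is determined by its values on operators of rank one. -/
theorem IsNormalForm.ext {g g' : A.Op → ℂ} (hg : IsNormalForm g) (hg' : IsNormalForm g')
    {S T : Set A.carrier} (hS : TotalSet S) (hT : TotalSet T)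
    (h : ∀ u ∈ S, ∀ v ∈ T, g (InnerProductSpace.rankOne ℂ u v) =
      g' (InnerProductSpace.rankOne ℂ u v)) : g = g' := by
  obtain ⟨ι, φ, χ, hφ, hχ, h3⟩ := hg
  obtain ⟨ι', φ', χ', hφ', hχ', h3'⟩ := hg'
  let Φ : ι ⊕ ι' → A.carrier := Sum.elim φ φ'
  let X' : ι ⊕ ι' → A.carrier := Sum.elim χ (fun i => -χ' i)
  have hΦ : Summable fun i => ‖Φ i‖ ^ 2 :=
    ((hφ.hasSum.sum (f := fun i => ‖Φ i‖ ^ 2) hφ'.hasSum)).summable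
  have hX : Summable fun i => ‖X' i‖ ^ 2 := by
    refine (HasSum.sum (f := fun i => ‖X' i‖ ^ 2) hχ.hasSum (b := ∑' i, ‖χ' i‖ ^ 2) ?_).summable
    simpa [X', Function.comp_def] using hχ'.hasSum
  let d : A.Op → ℂ := fun X => g X - g' X
  have hd : ∀ X : A.Op, HasSum (fun i => ⟪Φ i, X (X' i)⟫_ℂ) (d X) := fun X => by
    have h4 := (h3' X).neg
    have := HasSum.sum (f := fun i => ⟪Φ i, X (X' i)⟫_ℂ) (h3 X) (b := -g' X)
      (hasSum_of_eq h4 (fun i => by simp [Φ, X']) rfl)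
    simpa [d, sub_eq_add_neg] using this
  have hlin : ∀ u v, HasSum (fun i => ⟪v, X' i⟫_ℂ * ⟪Φ i, u⟫_ℂ)
      (d (InnerProductSpace.rankOne ℂ u v)) := fun u v => by
    simpa [inner_smul_right] using hd (InnerProductSpace.rankOne ℂ u v)
  have hbound : ∀ u v, ‖d (InnerProductSpace.rankOne ℂ u v)‖ ≤
      (∑' i, (‖Φ i‖ ^ 2 + ‖X' i‖ ^ 2)) * (‖u‖ * ‖v‖) := fun u v => by
    rw [← (hlin u v).tsum_eq, ← tsum_mul_right]
    refine tsum_of_norm_bounded ((hΦ.add hX).mul_right _).hasSum fun i => ?_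
    rw [norm_mul]
    have h1 := norm_inner_le_norm (𝕜 := ℂ) v (X' i)
    have h2 := norm_inner_le_norm (𝕜 := ℂ) (Φ i) u
    calc _ ≤ (‖v‖ * ‖X' i‖) * (‖Φ i‖ * ‖u‖) :=
          mul_le_mul h1 h2 (norm_nonneg _) (by positivity)
      _ = (‖Φ i‖ * ‖X' i‖) * (‖u‖ * ‖v‖) := by ring
      _ ≤ _ := by
        refine mul_le_mul_of_nonneg_right ?_ (by positivity)
        nlinarith [sq_nonneg (‖Φ i‖ - ‖X' i‖), sq_nonneg (‖Φ i‖), sq_nonneg (‖X' i‖)]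
  -- By `hbound` the difference is a bounded sesquilinear form in `(u, v)`, so vanishing on total
  -- sets forces it to vanish everywhere.
  have hz : ∀ u v, d (InnerProductSpace.rankOne ℂ u v) = 0 := by
    let D : A.carrier →L[ℂ] A.carrier →L⋆[ℂ] ℂ :=
      LinearMap.mkContinuous₂ (LinearMap.mk₂'ₛₗ (RingHom.id ℂ) (starRingEnd ℂ)
        (fun u v => d (InnerProductSpace.rankOne ℂ u v))
        (fun u u' v => by
          refine (hlin _ _).unique ?_
          simpa only [inner_add_right, mul_add] using (hlin u v).add (hlin u' v))
        (fun c u v => by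
          refine (hlin _ _).unique ?_
          exact hasSum_of_eq ((hlin u v).mul_left c)
            (fun i => by rw [inner_smul_right]; ring) rfl)
        (fun u v v' => by
          refine (hlin _ _).unique ?_
          simpa only [inner_add_left, add_mul] using (hlin u v).add (hlin u v'))
        (fun c u v => by
          refine (hlin _ _).unique ?_
          exact hasSum_of_eq ((hlin u v).mul_left ((starRingEnd ℂ) c))
            (fun i => by rw [inner_smul_left]; ring) rfl))
        (∑' i, (‖Φ i‖ ^ 2 + ‖X' i‖ ^ 2)) (fun u v => by
          simpa [mul_assoc] using hbound u v)
    have hD : D = 0 := by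
      refine ContinuousLinearMap.ext_on hS fun u hu => ?_
      exact ContinuousLinearMap.ext_on hT fun v hv => sub_eq_zero.2 (h u hu v hv)
    intro u v
    exact congrArg (fun D : A.carrier →L[ℂ] A.carrier →L⋆[ℂ] ℂ => D u v) hD
  funext X
  refine sub_eq_zero.1 (?_ : d X = 0)
  -- Expanding each `⟪Φ i, X (X' i)⟫` in a Hilbert basis turns `d X` into a double series; `hs1` and
  -- `hs2` make it absolutely summable, so the order of summation may be exchanged.
  obtain ⟨w, b, -⟩ := exists_hilbertBasis ℂ A.carrier
  have hs1 : Summable fun p : Σ _ : ι ⊕ ι', w => ‖⟪b p.2, X' p.1⟫_ℂ‖ ^ 2 := by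
    have hp : ∀ i, HasSum (fun j => ‖⟪b j, X' i⟫_ℂ‖ ^ 2) (‖X' i‖ ^ 2) := fun i => by
      have := hasSum_norm_sq (φ := fun j => ⟪b j, X' i⟫_ℂ) (a := ⟪X' i, X' i⟫_ℂ)
        (hasSum_of_eq (b.hasSum_inner_mul_inner (X' i) (X' i)) (fun j => by
          rw [← inner_conj_symm (X' i) (b j), RCLike.inner_apply, mul_comm]) rfl)
      rwa [← RCLike.re_eq_complex_re, inner_self_eq_norm_sq] at this
    exact summable_sigma_sq (φ := fun p : Σ _ : ι ⊕ ι', w => ⟪b p.2, X' p.1⟫_ℂ) hp hX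
  have hs2 : Summable fun p : Σ _ : ι ⊕ ι', w => ‖⟪X (b p.2), Φ p.1⟫_ℂ‖ ^ 2 := by
    have hp : ∀ i, HasSum (fun j => ‖⟪X (b j), Φ i⟫_ℂ‖ ^ 2)
        (‖ContinuousLinearMap.adjoint X (Φ i)‖ ^ 2) := fun i => by
      have := hasSum_norm_sq (φ := fun j => ⟪X (b j), Φ i⟫_ℂ)
        (a := ⟪ContinuousLinearMap.adjoint X (Φ i), ContinuousLinearMap.adjoint X (Φ i)⟫_ℂ)
        (hasSum_of_eq (b.hasSum_inner_mul_inner (ContinuousLinearMap.adjoint X (Φ i))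
          (ContinuousLinearMap.adjoint X (Φ i))) (fun j => by
          rw [← inner_conj_symm _ (b j), ContinuousLinearMap.adjoint_inner_right,
            RCLike.inner_apply, mul_comm]) rfl)
      rwa [← RCLike.re_eq_complex_re, inner_self_eq_norm_sq] at this
    refine summable_sigma_sq (φ := fun p : Σ _ : ι ⊕ ι', w => ⟪X (b p.2), Φ p.1⟫_ℂ) hp ?_
    exact Summable.of_nonneg_of_le (fun i => by positivity)
      (fun i => (pow_le_pow_left₀ (norm_nonneg _)
        ((ContinuousLinearMap.adjoint X).le_opNorm _) 2).trans_eq (mul_pow _ _ 2))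
      (hΦ.mul_left (‖ContinuousLinearMap.adjoint X‖ ^ 2))
  have hs : Summable fun p : Σ _ : ι ⊕ ι', w => ⟪b p.2, X' p.1⟫_ℂ * ⟪Φ p.1, X (b p.2)⟫_ℂ := by
    refine Summable.of_norm (Summable.of_nonneg_of_le (fun i => norm_nonneg _) (fun p => ?_)
      (hs1.add hs2))
    rw [norm_mul, norm_inner_symm (Φ p.1)]
    nlinarith [sq_nonneg (‖⟪b p.2, X' p.1⟫_ℂ‖ - ‖⟪X (b p.2), Φ p.1⟫_ℂ‖),
      sq_nonneg (‖⟪b p.2, X' p.1⟫_ℂ‖), sq_nonneg ‖⟪X (b p.2), Φ p.1⟫_ℂ‖]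
  have hrow : ∀ i, HasSum (fun j => ⟪b j, X' i⟫_ℂ * ⟪Φ i, X (b j)⟫_ℂ) ⟪Φ i, X (X' i)⟫_ℂ :=
    fun i => hasSum_of_eq
      (b.hasSum_inner_mul_inner (ContinuousLinearMap.adjoint X (Φ i)) (X' i))
      (fun j => by rw [ContinuousLinearMap.adjoint_inner_left, mul_comm])
      (by rw [ContinuousLinearMap.adjoint_inner_left])
  have e1 : HasSum (fun i => ⟪Φ i, X (X' i)⟫_ℂ)
      (∑' p : Σ _ : ι ⊕ ι', w, ⟪b p.2, X' p.1⟫_ℂ * ⟪Φ p.1, X (b p.2)⟫_ℂ) := hs.hasSum.sigma hrow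
  rw [(hd X).unique e1]
  have hs' := (Equiv.sigmaEquivProd (ι ⊕ ι') w).symm.summable_iff.2 hs
  have hs'' := (Equiv.prodComm w (ι ⊕ ι')).summable_iff.2 hs'
  have e2 := (Equiv.sigmaEquivProd (ι ⊕ ι') w).symm.tsum_eq
    (fun p : Σ _ : ι ⊕ ι', w => ⟪b p.2, X' p.1⟫_ℂ * ⟪Φ p.1, X (b p.2)⟫_ℂ)
  rw [← e2, ← (Equiv.prodComm w (ι ⊕ ι')).tsum_eq]
  -- Summed over `i` first, the `j`-th inner series is `d` of the rank one operator `|X (b j)⟩⟨b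
  -- j|`, which vanishes.
  have e3 := hs''.hasSum.prod_fiberwise (g := fun _ => 0) (fun j => by
    have := hlin (X (b j)) (b j)
    rw [hz] at this
    exact this)
  exact e3.unique hasSum_zero

end NormalForm

/-! ## Slices -/

section Slice

variable {A B F : QSystem}

/-- The operator `b ↦ b ⊗ e`. -/
def ket (B : QSystem) {F : QSystem} (e : F.carrier) : B.Hom (B ⊗ₛ F) := (tmulL B F).flip e

@[simp] theorem ket_apply (e : F.carrier) (b : B) : ket B e b = b ⊗ᵥ e := rfl

theorem adjoint_ket_tmul (e f : F.carrier) (b : B) :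
    ContinuousLinearMap.adjoint (ket B e) (b ⊗ᵥ f) = ⟪e, f⟫_ℂ • b := by
  refine ext_inner_left ℂ fun a => ?_
  rw [ContinuousLinearMap.adjoint_inner_right, ket_apply, inner_tmul_tmul, inner_smul_right,
    mul_comm]

theorem tensorOp_one_comp_ket (X : B.Op) (e : F.carrier) :
    (X ⊗ₒ (1 : F.Op)) ∘L ket B e = ket B e ∘L X := by
  ext b
  rw [ContinuousLinearMap.comp_apply, ContinuousLinearMap.comp_apply, ket_apply, ket_apply,
    tensorOp_tmul]
  rfl

/-- The partial sums are `1 ⊗ P` with `P` a finite-rank projection, hence contractions, and strong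
convergence to the identity need only be checked on product vectors. -/
theorem hasSum_ket {w : Type*} (b : HilbertBasis w ℂ F.carrier) (ψ : (B ⊗ₛ F).carrier) :
    HasSum (fun i => ket B (b i) (ContinuousLinearMap.adjoint (ket B (b i)) ψ)) ψ := by
  let P : Finset w → F.Op := fun s => ∑ i ∈ s, InnerProductSpace.rankOne ℂ (b i) (b i)
  have hP : ∀ s, ‖P s‖ ≤ 1 := fun s => by
    refine ContinuousLinearMap.opNorm_le_bound _ zero_le_one fun x => ?_
    have h1 : P s x = ∑ i ∈ s, ⟪b i, x⟫_ℂ • b i := by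
      simp [P]
    have h2 : ‖P s x‖ ^ 2 = ∑ i ∈ s, ‖⟪b i, x⟫_ℂ‖ ^ 2 := by
      have h3 := b.orthonormal.inner_sum (fun i => ⟪b i, x⟫_ℂ) (fun i => ⟪b i, x⟫_ℂ) s
      rw [← h1, inner_self_eq_norm_sq_to_K] at h3
      have h4 : ((‖P s x‖ ^ 2 : ℝ) : ℂ) = ((∑ i ∈ s, ‖⟪b i, x⟫_ℂ‖ ^ 2 : ℝ) : ℂ) := by
        push_cast
        refine h3.trans (Finset.sum_congr rfl fun i _ => ?_)
        rw [RCLike.conj_mul]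
        rfl
      exact_mod_cast h4
    rw [one_mul]
    refine (sq_le_sq₀ (norm_nonneg _) (norm_nonneg _)).1 ?_
    rw [h2]
    exact b.orthonormal.sum_inner_products_le x
  have hT : ∀ s, tmap (1 : B.Op) (P s) =
      ∑ i ∈ s, ket B (b i) ∘L ContinuousLinearMap.adjoint (ket B (b i)) := fun s => by
    refine hom_ext fun a f => ?_
    have h1 : P s f = ∑ i ∈ s, ⟪b i, f⟫_ℂ • b i := by
      simp [P]
    rw [tmap_tmul, h1, sum_apply, ← tmulL_apply, map_sum]
    refine Finset.sum_congr rfl fun i _ => ?_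
    rw [ContinuousLinearMap.comp_apply, adjoint_ket_tmul, ket_apply, map_smul, tmulL_apply,
      smul_tmul_vec]
    rfl
  have := (total_pure B F).tendsto (l := Filter.atTop) (fun s => tmap (1 : B.Op) (P s)) 1 1
    (fun s => by
      have h1 : ‖tmap (1 : B.Op) (P s)‖ ≤ 1 :=
        (norm_tmap_le _ _).trans (mul_le_one₀ ContinuousLinearMap.norm_id_le (norm_nonneg _) (hP s))
      exact_mod_cast h1)
    (by
      rintro _ ⟨a, f, rfl⟩
      have h2 := (b.hasSum_repr f).mapL (tmulL B F a)
      simp only [HasSum, SummationFilter.unconditional_filter] at h2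
      refine h2.congr fun s => ?_
      have h1 : P s f = ∑ i ∈ s, ⟪b i, f⟫_ℂ • b i := by
        simp [P]
      rw [tmap_tmul, ← tmulL_apply, h1, map_sum]
      simp only [b.repr_apply_apply]
      rfl)
    ψ
  simp only [HasSum, SummationFilter.unconditional_filter]
  refine this.congr fun s => ?_
  rw [hT, sum_apply]
  rfl

theorem hasSum_slice {w : Type*} (b : HilbertBasis w ℂ F.carrier) (φ ψ : (B ⊗ₛ F).carrier)
    (X : B.Op) :
    HasSum (fun i => ⟪ContinuousLinearMap.adjoint (ket B (b i)) φ,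
      X (ContinuousLinearMap.adjoint (ket B (b i)) ψ)⟫_ℂ) ⟪φ, (X ⊗ₒ (1 : F.Op)) ψ⟫_ℂ := by
  have := (hasSum_ket b ψ).mapL (innerSL ℂ φ ∘L (X ⊗ₒ (1 : F.Op)))
  refine hasSum_of_eq this (fun i => ?_) rfl
  rw [ContinuousLinearMap.adjoint_inner_left, ← ContinuousLinearMap.comp_apply,
    ← tensorOp_one_comp_ket]
  rfl

theorem hasSum_norm_slice {w : Type*} (b : HilbertBasis w ℂ F.carrier) (ψ : (B ⊗ₛ F).carrier) :
    HasSum (fun i => ‖ContinuousLinearMap.adjoint (ket B (b i)) ψ‖ ^ 2) (‖ψ‖ ^ 2) := by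
  have := hasSum_norm_sq (hasSum_slice b ψ ψ 1)
  rw [one_tensorOp_one] at this
  rwa [one_apply_eq_self, ← RCLike.re_eq_complex_re, inner_self_eq_norm_sq] at this

/-- Composition of a normal functional with `X ↦ X ⊗ 1`. -/
theorem IsNormalForm.comp_ampliation {g : (B ⊗ₛ F).Op → ℂ} (hg : IsNormalForm g) :
    IsNormalForm fun X : B.Op => g (X ⊗ₒ (1 : F.Op)) := by
  obtain ⟨ι, φ, χ, hφ, hχ, h3⟩ := hg
  obtain ⟨w, b, -⟩ := exists_hilbertBasis ℂ F.carrier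
  have hs : ∀ φ : ι → (B ⊗ₛ F).carrier, (Summable fun i => ‖φ i‖ ^ 2) →
      Summable fun p : Σ _ : ι, w =>
        ‖ContinuousLinearMap.adjoint (ket B (b p.2)) (φ p.1)‖ ^ 2 := fun φ hφ =>
    summable_sigma_sq (φ := fun p : Σ _ : ι, w =>
        ContinuousLinearMap.adjoint (ket B (b p.2)) (φ p.1))
      (fun i => hasSum_norm_slice b (φ i)) hφ
  refine ⟨Σ _ : ι, w, fun p => ContinuousLinearMap.adjoint (ket B (b p.2)) (φ p.1),
    fun p => ContinuousLinearMap.adjoint (ket B (b p.2)) (χ p.1), ?_, ?_, fun X => ?_⟩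
  · exact hs φ hφ
  · exact hs χ hχ
  · exact hasSum_sigma_inner (f := fun i => ⟪φ i, (X ⊗ₒ (1 : F.Op)) (χ i)⟫_ℂ)
      (hs φ hφ) (hs χ hχ) X (fun i => hasSum_slice b (φ i) (χ i) X) (h3 _)

theorem IsNormalForm.comp_dilation {g : A.Op → ℂ} (hg : IsNormalForm g) (V W : A.Hom (B ⊗ₛ F)) :
    IsNormalForm fun X : B.Op =>
      g (ContinuousLinearMap.adjoint V ∘L (X ⊗ₒ (1 : F.Op)) ∘L W) :=
  (hg.comp_conj V W).comp_ampliation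

theorem exists_commIsometry (A B : QSystem) : ∃ L : (A ⊗ₛ B).carrier →ₗᵢ[ℂ] (B ⊗ₛ A).carrier,
    ∀ a b, L (a ⊗ᵥ b) = b ⊗ᵥ a := by
  obtain ⟨L, hL⟩ := exists_gramIsometry (fun p : A.carrier × B.carrier => p.1 ⊗ᵥ p.2)
    (fun p => p.2 ⊗ᵥ p.1) ((total_pure A B).mono (by
      rintro _ ⟨a, b, rfl⟩; exact ⟨(a, b), rfl⟩))
    (fun p q => by simp -proj only [inner_tmul_tmul]; ring)
  exact ⟨L, fun a b => hL (a, b)⟩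

/-- Conjugation by an isometry which intertwines two operators. -/
theorem conj_of_intertwine {L : A.carrier →ₗᵢ[ℂ] B.carrier} {X : B.Op} {Y : A.Op}
    (h : X ∘L L.toContinuousLinearMap = L.toContinuousLinearMap ∘L Y) :
    ContinuousLinearMap.adjoint L.toContinuousLinearMap ∘L X ∘L L.toContinuousLinearMap = Y := by
  rw [h, ← ContinuousLinearMap.comp_assoc]
  ext x
  refine ext_inner_left ℂ fun y => ?_
  simp only [ContinuousLinearMap.comp_apply, ContinuousLinearMap.adjoint_inner_right]
  exact L.inner_map_map y (Y x)

theorem IsNormalForm.tensor_left {g : (A ⊗ₛ B).Op → ℂ} (hg : IsNormalForm g) (Y : B.Op) :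
    IsNormalForm fun X : A.Op => g (X ⊗ₒ Y) := by
  have := (hg.mul_right ((1 : A.Op) ⊗ₒ Y)).comp_ampliation
  simpa -proj only [tensorOp_mul, mul_one, one_mul] using this

theorem IsNormalForm.tensor_right {g : (A ⊗ₛ B).Op → ℂ} (hg : IsNormalForm g) (X : A.Op) :
    IsNormalForm fun Y : B.Op => g (X ⊗ₒ Y) := by
  obtain ⟨L, hL⟩ := exists_commIsometry A B
  have h1 := ((hg.mul_right (X ⊗ₒ (1 : B.Op))).comp_conj L.toContinuousLinearMap
    L.toContinuousLinearMap).comp_ampliation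
  have h2 : ∀ Y : B.Op, ContinuousLinearMap.adjoint L.toContinuousLinearMap ∘L
      (Y ⊗ₒ (1 : A.Op)) ∘L L.toContinuousLinearMap = (1 : A.Op) ⊗ₒ Y := fun Y =>
    conj_of_intertwine (hom_ext fun a b => by
      simp -proj only [ContinuousLinearMap.comp_apply, tensorOp_tmul,
        LinearIsometry.coe_toContinuousLinearMap, hL, one_apply_eq_self])
  simp -proj only [h2, tensorOp_mul, mul_one, one_mul] at h1
  exact h1

theorem rankOne_tmul (u v : A.carrier) (u' v' : B.carrier) :
    InnerProductSpace.rankOne ℂ (u ⊗ᵥ u') (v ⊗ᵥ v') =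
      (InnerProductSpace.rankOne ℂ u v : A.Op) ⊗ₒ (InnerProductSpace.rankOne ℂ u' v' : B.Op) := by
  refine hom_ext fun a b => ?_
  rw [tensorOp_tmul, InnerProductSpace.rankOne_apply, InnerProductSpace.rankOne_apply,
    InnerProductSpace.rankOne_apply, inner_tmul_tmul, smul_tmul_vec, tmul_smul_vec, smul_smul]

/-- A normal functional on a composite system is determined by its values on products. -/
theorem IsNormalForm.ext_tensor {g g' : (A ⊗ₛ B).Op → ℂ} (hg : IsNormalForm g)
    (hg' : IsNormalForm g') (h : ∀ (X : A.Op) (Y : B.Op), g (X ⊗ₒ Y) = g' (X ⊗ₒ Y)) : g = g' := by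
  refine hg.ext hg' (total_pure A B) (total_pure A B) ?_
  rintro _ ⟨u, u', rfl⟩ _ ⟨v, v', rfl⟩
  rw [rankOne_tmul]
  exact h _ _

end Slice

end

noncomputable section

/-! ## Completely positive maps -/

section CStar

variable {R : Type*} [NonUnitalCStarAlgebra R] [PartialOrder R] [StarOrderedRing R] {a : R}

theorem exists_eq_star_mul_self (ha : 0 ≤ a) : ∃ b, a = star b * b :=
  CStarAlgebra.nonneg_iff_eq_star_mul_self.1 ha

/-- For the negative part `p` one has `a p = -p²`, so `p a p = -p³`: when positivity is tested by a
quadratic form, evaluating it along `p` shows that `p³` vanishes, and then `p` does. -/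
theorem nonneg_of_forall_negPart (ha : IsSelfAdjoint a)
    (h : ∀ p q : R, star p = p → a * p = -(p * p) → p * p * p = star q * q → q = 0) : 0 ≤ a := by
  set p : R := a⁻ with hp
  have hp0 : 0 ≤ p := CFC.negPart_nonneg a
  have hps : star p = p := (IsSelfAdjoint.of_nonneg hp0).star_eq
  have hMp : a * p = -(p * p) := by
    conv_lhs => rw [← CFC.posPart_sub_negPart a ha]
    rw [sub_mul, CFC.posPart_mul_negPart, zero_sub]
  have hcube : 0 ≤ p * p * p := by
    have := star_left_conjugate_nonneg hp0 p
    rwa [hps] at this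
  obtain ⟨q, hq⟩ := exists_eq_star_mul_self hcube
  have hq0 : q = 0 := h p q hps hMp hq
  rw [hq0, mul_zero] at hq
  have hp2 : p * p = 0 := by
    have : star (p * p) * (p * p) = 0 := by
      rw [star_mul, hps, ← mul_assoc, hq, zero_mul]
    exact CStarRing.star_mul_self_eq_zero_iff _ |>.1 this
  have hp1 : p = 0 := by
    have : star p * p = 0 := by rw [hps, hp2]
    exact CStarRing.star_mul_self_eq_zero_iff _ |>.1 this
  rw [← CFC.posPart_sub_negPart a ha, ← hp, hp1, sub_zero]
  exact CFC.posPart_nonneg a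

end CStar

/-! ### Positivity of operator matrices through their quadratic forms. -/

section CStarMatrixForm

variable {H K : Type*} [NormedAddCommGroup H] [InnerProductSpace ℂ H] [CompleteSpace H]
  [NormedAddCommGroup K] [InnerProductSpace ℂ K] [CompleteSpace K]
  {n : Type*} [Fintype n]

/-- The action of a matrix of operators on a tuple of vectors. -/
def opMatrixMulVec (M : CStarMatrix n n (H →L[ℂ] H)) (f : n → H) (i : n) : H := ∑ j, M i j (f j)

/-- The sesquilinear form of a matrix of operators. -/
def opMatrixForm (M : CStarMatrix n n (H →L[ℂ] H)) (f g : n → H) : ℂ :=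
  ∑ i, ∑ j, ⟪f i, M i j (g j)⟫_ℂ

theorem opMatrixForm_eq (M : CStarMatrix n n (H →L[ℂ] H)) (f g : n → H) :
    opMatrixForm M f g = ∑ i, ⟪f i, opMatrixMulVec M g i⟫_ℂ := by
  simp only [opMatrixForm, opMatrixMulVec, inner_sum]

theorem opMatrixMulVec_mul (M N : CStarMatrix n n (H →L[ℂ] H)) (f : n → H) :
    opMatrixMulVec (M * N) f = opMatrixMulVec M (opMatrixMulVec N f) := by
  funext i
  simp only [opMatrixMulVec, CStarMatrix.mul_apply, sum_apply, map_sum]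
  rw [Finset.sum_comm]
  rfl

theorem opMatrixForm_star_mul (N M : CStarMatrix n n (H →L[ℂ] H)) (f g : n → H) :
    opMatrixForm (star N * M) f g = opMatrixForm M (opMatrixMulVec N f) g := by
  rw [opMatrixForm_eq, opMatrixForm_eq, opMatrixMulVec_mul]
  generalize opMatrixMulVec M g = h
  simp only [opMatrixMulVec, inner_sum, sum_inner, CStarMatrix.star_apply]
  rw [Finset.sum_comm]
  refine Finset.sum_congr rfl fun i _ => Finset.sum_congr rfl fun j _ => ?_
  exact ContinuousLinearMap.adjoint_inner_right _ _ _

theorem opMatrixForm_star_mul_self_re (N : CStarMatrix n n (H →L[ℂ] H)) (f : n → H) :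
    (opMatrixForm (star N * N) f f).re = ∑ i, ‖opMatrixMulVec N f i‖ ^ 2 := by
  rw [opMatrixForm_star_mul, opMatrixForm_eq, Complex.re_sum]
  exact Finset.sum_congr rfl fun i _ => inner_self_eq_norm_sq (𝕜 := ℂ) _

theorem opMatrixForm_re_nonneg {M : CStarMatrix n n (H →L[ℂ] H)} (hM : 0 ≤ M) (f : n → H) :
    0 ≤ (opMatrixForm M f f).re := by
  obtain ⟨N, rfl⟩ := exists_eq_star_mul_self hM
  rw [opMatrixForm_star_mul_self_re]
  positivity

theorem opMatrix_eq_zero {M : CStarMatrix n n (H →L[ℂ] H)}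
    (h : ∀ f, opMatrixMulVec M f = 0) : M = 0 := by
  classical
  ext i j x
  have := congrFun (h (Pi.single j x)) i
  rw [opMatrixMulVec, Finset.sum_eq_single j] at this
  · simpa using this
  · intro k _ hk
    simp [Pi.single_eq_of_ne hk]
  · simp

/-- The order on `CStarMatrix` is the abstract C⋆-algebra order; this criterion makes complete
positivity checkable by hand. At `p f` the form of `M` equals `-∑ ‖q f‖²`, so its non-negativity
kills `q`. -/
theorem opMatrix_nonneg {M : CStarMatrix n n (H →L[ℂ] H)} (hM : IsSelfAdjoint M)
    (h : ∀ f, 0 ≤ (opMatrixForm M f f).re) : 0 ≤ M := by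
  refine nonneg_of_forall_negPart hM fun p q hps hMp hq => opMatrix_eq_zero fun f => ?_
  have h1 := h (opMatrixMulVec p f)
  have h2 : opMatrixForm M (opMatrixMulVec p f) (opMatrixMulVec p f) =
      -opMatrixForm (star q * q) f f := by
    rw [← hq, opMatrixForm_eq, ← opMatrixMulVec_mul, hMp, ← opMatrixForm_eq,
      ← opMatrixForm_star_mul, hps, mul_neg, ← mul_assoc]
    simp [opMatrixForm]
  rw [h2, Complex.neg_re, opMatrixForm_star_mul_self_re] at h1
  have h3 : ∑ i, ‖opMatrixMulVec q f i‖ ^ 2 = 0 :=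
    le_antisymm (by linarith) (by positivity)
  funext i
  have := (Finset.sum_eq_zero_iff_of_nonneg fun i _ => by positivity).1 h3 i (Finset.mem_univ i)
  simpa using this

/-- The completely positive map `X ↦ V† X V`. -/
def conjCP (V : H →L[ℂ] K) : (K →L[ℂ] K) →CP (H →L[ℂ] H) where
  toFun X := ContinuousLinearMap.adjoint V ∘L X ∘L V
  map_add' X Y := by ext; simp
  map_smul' c X := by ext; simp
  map_cstarMatrix_nonneg' k M hM := by
    refine opMatrix_nonneg ?_ fun f => ?_
    · have hMs := (IsSelfAdjoint.of_nonneg hM).star_eq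
      ext i j : 1
      have : star (M j i) = M i j := congrFun (congrFun hMs i) j
      rw [CStarMatrix.star_apply]
      change ContinuousLinearMap.adjoint (ContinuousLinearMap.adjoint V ∘L M j i ∘L V) =
        ContinuousLinearMap.adjoint V ∘L M i j ∘L V
      rw [← this, ContinuousLinearMap.adjoint_comp, ContinuousLinearMap.adjoint_comp,
        ContinuousLinearMap.adjoint_adjoint, ContinuousLinearMap.comp_assoc]
      rfl
    · have := opMatrixForm_re_nonneg hM fun i => V (f i)
      refine this.trans_eq (congrArg Complex.re ?_)
      refine Finset.sum_congr rfl fun i _ => Finset.sum_congr rfl fun j _ => ?_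
      exact (ContinuousLinearMap.adjoint_inner_right _ _ _).symm

end CStarMatrixForm

end

noncomputable section

/-! ## The Stinespring dilation of a quantum operation -/

section Kolmogorov

variable {A : QSystem} {ι : Type}

/-- The semi-inner product defined by a positive kernel. -/
@[reducible]
def kernelCore (k : ι → ι → A.Op) (hk : ∀ i j, ContinuousLinearMap.adjoint (k i j) = k j i)
    (hpos : ∀ (s : Finset ι) (f : ι → A.carrier),
      0 ≤ (∑ i ∈ s, ∑ j ∈ s, ⟪f i, k i j (f j)⟫_ℂ).re) :
    PreInnerProductSpace.Core ℂ (ι →₀ A.carrier) where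
  inner f g := f.sum fun i x => g.sum fun j y => ⟪x, k i j y⟫_ℂ
  conj_inner_symm f g := by
    simp only [Finsupp.sum, map_sum]
    rw [Finset.sum_comm]
    refine Finset.sum_congr rfl fun i _ => Finset.sum_congr rfl fun j _ => ?_
    rw [inner_conj_symm, ← hk, ContinuousLinearMap.adjoint_inner_left]
  re_inner_nonneg f := hpos f.support f
  add_left f g h := by
    refine Finsupp.sum_add_index' (fun i => ?_) fun i x y => ?_
    · simp
    · simp [Finsupp.sum, Finset.sum_add_distrib]
  smul_left f g c := by
    rw [Finsupp.sum_smul_index' (fun i => by simp)]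
    simp only [Finsupp.sum, inner_smul_left, Finset.mul_sum]

/-- A positive operator-valued kernel factors as `k i j = (δ i)† (δ j)`. The space is the completion
of the finitely supported functions with the kernel as semi-inner product, and `δ i` places a vector
at the index `i`. -/
theorem exists_kolmogorov (k : ι → ι → A.Op)
    (hk : ∀ i j, ContinuousLinearMap.adjoint (k i j) = k j i)
    (hpos : ∀ (s : Finset ι) (f : ι → A.carrier),
      0 ≤ (∑ i ∈ s, ∑ j ∈ s, ⟪f i, k i j (f j)⟫_ℂ).re) :
    ∃ (F : QSystem) (δ : ι → A.Hom F), ∀ i j a b, ⟪δ i a, δ j b⟫_ℂ = ⟪a, k i j b⟫_ℂ := by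
  let c := kernelCore k hk hpos
  let _ : SeminormedAddCommGroup (ι →₀ A.carrier) :=
    InnerProductSpace.Core.toSeminormedAddCommGroup (c := c)
  let _ : InnerProductSpace ℂ (ι →₀ A.carrier) := InnerProductSpace.ofCore c
  let F : QSystem := ⟨UniformSpace.Completion (ι →₀ A.carrier)⟩
  let δ0 : ι → A.carrier →ₗ[ℂ] F.carrier := fun i =>
    (UniformSpace.Completion.toComplL (𝕜 := ℂ) (E := ι →₀ A.carrier)).toLinearMap ∘ₗ
      Finsupp.lsingle i
  have h0 : ∀ i j a b, ⟪δ0 i a, δ0 j b⟫_ℂ = ⟪a, k i j b⟫_ℂ := fun i j a b => by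
    refine (UniformSpace.Completion.inner_coe (𝕜 := ℂ) (Finsupp.single i a)
      (Finsupp.single j b)).trans ?_
    change (Finsupp.single i a).sum (fun i x => (Finsupp.single j b).sum
      fun j y => ⟪x, k i j y⟫_ℂ) = _
    rw [Finsupp.sum_single_index (by simp), Finsupp.sum_single_index (by simp)]
  refine ⟨F, fun i => (δ0 i).mkContinuous (Real.sqrt ‖k i i‖) fun a => ?_, fun i j a b => h0 i j a b⟩
  refine (sq_le_sq₀ (norm_nonneg _) (by positivity)).1 ?_
  rw [mul_pow, Real.sq_sqrt (norm_nonneg _), ← inner_self_eq_norm_sq (𝕜 := ℂ), h0]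
  refine (RCLike.re_le_norm _).trans ((norm_inner_le_norm _ _).trans ?_)
  nlinarith [(k i i).le_opNorm a, norm_nonneg a]

end Kolmogorov

section Stinespring

variable {A B F : QSystem}

/-- The quadratic form is `|∑ ⟪e i, f i⟫|²`. This is the block matrix on which complete positivity
is tested. -/
theorem rankOneMatrix_nonneg {n : Type*} [Fintype n] (e : n → B.carrier) :
    0 ≤ (CStarMatrix.ofMatrix fun i j => (InnerProductSpace.rankOne ℂ (e i) (e j) : B.Op) :
      CStarMatrix n n B.Op) := by
  refine opMatrix_nonneg ?_ fun f => ?_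
  · ext i j : 1
    rw [CStarMatrix.star_apply]
    exact InnerProductSpace.adjoint_rankOne (𝕜 := ℂ) (e j) (e i)
  · have : opMatrixForm (CStarMatrix.ofMatrix fun i j =>
        (InnerProductSpace.rankOne ℂ (e i) (e j) : B.Op)) f f =
        starRingEnd ℂ (∑ i, ⟪e i, f i⟫_ℂ) * ∑ i, ⟪e i, f i⟫_ℂ := by
      simp only [opMatrixForm, map_sum, Finset.sum_mul_sum, inner_conj_symm]
      refine Finset.sum_congr rfl fun i _ => Finset.sum_congr rfl fun j _ => ?_
      change ⟪f i, InnerProductSpace.rankOne ℂ (e i) (e j) (f j)⟫_ℂ = _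
      rw [InnerProductSpace.rankOne_apply, inner_smul_right, mul_comm]
    rw [this, ← Complex.normSq_eq_conj_mul_self, Complex.ofReal_re]
    exact Complex.normSq_nonneg _

/-- The image of a positive `2 × 2` block matrix is self-adjoint; the claim is its off-diagonal
entry. -/
theorem adjoint_dual_rankOne (T : B.Op →CP A.Op) (u v : B.carrier) :
    ContinuousLinearMap.adjoint (T (InnerProductSpace.rankOne ℂ u v)) =
      T (InnerProductSpace.rankOne ℂ v u) := by
  have h := (IsSelfAdjoint.of_nonneg
    (T.map_cstarMatrix_nonneg _ (rankOneMatrix_nonneg ![u, v]))).star_eq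
  exact congrFun (congrFun h 1) 0

/-- A quantum operation is of the form `T†(X) = V†(X ⊗ 1)V`. -/
theorem QOperation.exists_stinespring (T : QOperation A B) :
    ∃ (F : QSystem) (V : A.Hom (B ⊗ₛ F)),
      ∀ X : B.Op, T.dual X = ContinuousLinearMap.adjoint V ∘L (X ⊗ₒ (1 : F.Op)) ∘L V := by
  classical
  obtain ⟨w, e, -⟩ := exists_hilbertBasis ℂ B.carrier
  have he : ∀ i j, ⟪e i, e j⟫_ℂ = if i = j then 1 else 0 :=
    orthonormal_iff_ite.1 e.orthonormal
  -- The kernel is the Choi matrix of `T†` in a basis `e`, so `δ i` plays the role of the component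
  -- of the dilation along `e i`; below, `V a = ∑ e i ⊗ δ i a`.
  obtain ⟨F, δ, hδ⟩ := exists_kolmogorov
    (fun i j => T.dual (InnerProductSpace.rankOne ℂ (e i) (e j)))
    (fun i j => adjoint_dual_rankOne _ _ _) (fun s f => by
      have := opMatrixForm_re_nonneg
        (T.dual.map_cstarMatrix_nonneg _ (rankOneMatrix_nonneg fun i : s => e i)) fun i => f i
      refine this.trans_eq (congrArg Complex.re ?_)
      rw [← Finset.sum_coe_sort s]
      refine Finset.sum_congr rfl fun i _ => ?_
      rw [← Finset.sum_coe_sort s]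
      rfl)
  -- Normality enters here: it allows `1 = ∑ |e i⟩⟨e i|` to be pulled through `T†`, which makes the
  -- series for `V a` converge.
  have hnorm : ∀ a, HasSum (fun i => ‖δ i a‖ ^ 2) (⟪a, T.dual 1 a⟫_ℂ).re := fun a => by
    refine hasSum_norm_sq ?_
    obtain ⟨φ, h1, h2⟩ := T.normal a
    have hs : Summable fun p : Σ _ : ℕ, w => ‖⟪e p.2, φ p.1⟫_ℂ‖ ^ 2 := by
      refine summable_sigma_sq (φ := fun p : Σ _ : ℕ, w => ⟪e p.2, φ p.1⟫_ℂ)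
        (f := fun n => ‖φ n‖ ^ 2) (fun n => ?_) h1
      have := hasSum_norm_sq (φ := fun j => ⟪e j, φ n⟫_ℂ) (a := ⟪φ n, φ n⟫_ℂ)
        (hasSum_of_eq (e.hasSum_inner_mul_inner (φ n) (φ n)) (fun j => by
          rw [← inner_conj_symm (φ n) (e j), RCLike.inner_apply, mul_comm]) rfl)
      rwa [← RCLike.re_eq_complex_re, inner_self_eq_norm_sq] at this
    have hs1 : Summable fun p : Σ _ : ℕ, w => ⟪⟪e p.2, φ p.1⟫_ℂ, (1 : ℂ →L[ℂ] ℂ) ⟪e p.2, φ p.1⟫_ℂ⟫_ℂ :=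
      (summable_inner_of_sq hs hs 1).of_norm
    have hrow : ∀ n, HasSum (fun j => ⟪⟪e j, φ n⟫_ℂ, (1 : ℂ →L[ℂ] ℂ) ⟪e j, φ n⟫_ℂ⟫_ℂ)
        ⟪φ n, φ n⟫_ℂ := fun n =>
      hasSum_of_eq (e.hasSum_inner_mul_inner (φ n) (φ n)) (fun j => by
          rw [← inner_conj_symm (φ n) (e j), RCLike.inner_apply, mul_comm]; rfl) rfl
    have e1 := (hs1.hasSum.sigma hrow).unique (h2 1)
    have hs2 := hs1.hasSum
    rw [e1] at hs2
    have hs3 := (Equiv.sigmaEquivProd ℕ w).symm.hasSum_iff.2 hs2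
    have hs4 := (Equiv.prodComm w ℕ).hasSum_iff.2 hs3
    refine hs4.prod_fiberwise fun j => ?_
    rw [hδ]
    refine hasSum_of_eq (h2 (InnerProductSpace.rankOne ℂ (e j) (e j))) (fun n => ?_) rfl
    change ⟪⟪e j, φ n⟫_ℂ, ⟪e j, φ n⟫_ℂ⟫_ℂ = _
    rw [InnerProductSpace.rankOne_apply, inner_smul_right, ← inner_conj_symm (φ n) (e j),
      RCLike.inner_apply]
  let Vf : w → F.carrier →ₗᵢ[ℂ] (B ⊗ₛ F).carrier := fun i =>
    ⟨(tmulL B F (e i)).toLinearMap, fun f => by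
      change ‖e i ⊗ᵥ f‖ = _
      rw [norm_tmul_vec, e.orthonormal.1, one_mul]⟩
  have hVf : OrthogonalFamily ℂ (fun _ => F.carrier) Vf := by
    intro i j hij f g
    change ⟪e i ⊗ᵥ f, e j ⊗ᵥ g⟫_ℂ = 0
    rw [inner_tmul_tmul, he, if_neg hij, zero_mul]
  have hsum : ∀ a, Summable fun i => e i ⊗ᵥ δ i a := fun a =>
    (hVf.summable_iff_norm_sq_summable (fun i => δ i a)).2 (hnorm a).summable
  let V0 : A.carrier →ₗ[ℂ] (B ⊗ₛ F).carrier :=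
    { toFun := fun a => ∑' i, e i ⊗ᵥ δ i a
      map_add' := fun a b => by
        rw [← (hsum a).tsum_add (hsum b)]
        simp only [map_add, tmul_add_vec]
      map_smul' := fun c a => by
        rw [RingHom.id_apply, ← (hsum a).tsum_const_smul c]
        simp only [map_smul, tmul_smul_vec] }
  have hV0 : ∀ a, HasSum (fun i => e i ⊗ᵥ δ i a) (V0 a) := fun a => (hsum a).hasSum
  have hcoef : ∀ i f a, ⟪e i ⊗ᵥ f, V0 a⟫_ℂ = ⟪f, δ i a⟫_ℂ := fun i f a => by
    have h1 := (hV0 a).mapL (innerSL ℂ (e i ⊗ᵥ f))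
    refine h1.unique ?_
    have h2 := hasSum_single (f := fun j => innerSL ℂ (e i ⊗ᵥ f) (e j ⊗ᵥ δ j a)) i
      (fun j hj => by
        rw [innerSL_apply_apply, inner_tmul_tmul, he, if_neg (Ne.symm hj), zero_mul])
    refine hasSum_of_eq h2 (fun _ => rfl) ?_
    rw [innerSL_apply_apply, inner_tmul_tmul, he, if_pos rfl, one_mul]
  have hnormV : ∀ a, ‖V0 a‖ ^ 2 = (⟪a, T.dual 1 a⟫_ℂ).re := fun a => by
    have h1 : HasSum (fun i => ⟪δ i a, δ i a⟫_ℂ) ⟪V0 a, V0 a⟫_ℂ :=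
      hasSum_of_eq ((hV0 a).mapL (innerSL ℂ (V0 a))) (fun i => by
        rw [innerSL_apply_apply, ← inner_conj_symm (V0 a), hcoef, inner_conj_symm]) rfl
    have h2 := hasSum_norm_sq h1
    rw [← RCLike.re_eq_complex_re, inner_self_eq_norm_sq] at h2
    exact h2.unique (hnorm a)
  let V : A.Hom (B ⊗ₛ F) := V0.mkContinuous (Real.sqrt ‖T.dual 1‖) fun a => by
    refine (sq_le_sq₀ (norm_nonneg _) (by positivity)).1 ?_
    rw [mul_pow, Real.sq_sqrt (norm_nonneg _), hnormV]
    refine (RCLike.re_le_norm (K := ℂ) _).trans ((norm_inner_le_norm _ _).trans ?_)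
    nlinarith [(T.dual 1).le_opNorm a, norm_nonneg a]
  refine ⟨F, V, fun X => ?_⟩
  -- Both sides are normal in `X`, so it suffices to compare them on the matrix units of the basis,
  -- where they agree by construction.
  have key : ∀ a, (fun X : B.Op => ⟪a, T.dual X a⟫_ℂ) = fun X : B.Op =>
      ⟪a, (ContinuousLinearMap.adjoint V ∘L (X ⊗ₒ (1 : F.Op)) ∘L V) a⟫_ℂ := fun a => by
    have he' : TotalSet (Set.range e) := by
      have := e.dense_span
      exact Submodule.dense_iff_topologicalClosure_eq_top.2 this
    refine (T.normal a).isNormalForm.ext ((isNormalForm_inner a a).comp_dilation V V) he' he' ?_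
    rintro _ ⟨i, rfl⟩ _ ⟨j, rfl⟩
    rw [← hδ, ContinuousLinearMap.comp_apply, ContinuousLinearMap.adjoint_inner_right,
      ContinuousLinearMap.comp_apply]
    have h1 : ((InnerProductSpace.rankOne ℂ (e i) (e j) : B.Op) ⊗ₒ (1 : F.Op)) (V a) =
        e i ⊗ᵥ δ j a := by
      have h1 := (hV0 a).mapL ((InnerProductSpace.rankOne ℂ (e i) (e j) : B.Op) ⊗ₒ (1 : F.Op))
      refine h1.unique ?_
      have h2 := hasSum_single (f := fun l =>
        ((InnerProductSpace.rankOne ℂ (e i) (e j) : B.Op) ⊗ₒ (1 : F.Op)) (e l ⊗ᵥ δ l a)) j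
        (fun l hl => by
          rw [tensorOp_tmul, InnerProductSpace.rankOne_apply, he, if_neg (Ne.symm hl), zero_smul,
            ← tmulL_apply, map_zero, zero_apply])
      rwa [tensorOp_tmul, InnerProductSpace.rankOne_apply, he, if_pos rfl, one_smul] at h2
    rw [h1, ← inner_conj_symm (V a)]
    change _ = starRingEnd ℂ ⟪e i ⊗ᵥ δ j a, V0 a⟫_ℂ
    rw [hcoef, inner_conj_symm]
  have h2 := (ext_inner_map (T.dual X).toLinearMap
    (ContinuousLinearMap.adjoint V ∘L (X ⊗ₒ (1 : F.Op)) ∘L V).toLinearMap).1 fun a => by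
      have := congrFun (key a) X
      dsimp only at this
      rw [← inner_conj_symm, ← inner_conj_symm (_ : A.carrier) a]
      exact congrArg (starRingEnd ℂ) this
  ext a
  exact congrArg (fun L => L a) h2

end Stinespring
end

noncomputable section

/-! ## Calculus of quantum operations -/

section Operations

variable {A B C D F A' B' : QSystem}

theorem IsNormalFunctional.comp_conj {f : A.Op → ℂ} (hf : IsNormalFunctional f)
    (V : A.Hom B) : IsNormalFunctional fun X : B.Op =>
      f (ContinuousLinearMap.adjoint V ∘L X ∘L V) := by
  obtain ⟨φ, h1, h2⟩ := hf
  refine ⟨fun n => V (φ n), ?_, fun X => ?_⟩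
  · exact Summable.of_nonneg_of_le (fun i => by positivity)
      (fun i => (pow_le_pow_left₀ (norm_nonneg _) (V.le_opNorm _) 2).trans_eq (mul_pow _ _ 2))
      (h1.mul_left (‖V‖ ^ 2))
  · refine hasSum_of_eq (h2 _) (fun n => ?_) rfl
    simp only [ContinuousLinearMap.comp_apply, ContinuousLinearMap.adjoint_inner_right]

theorem IsNormalFunctional.comp_ampliation {f : (B ⊗ₛ F).Op → ℂ} (hf : IsNormalFunctional f) :
    IsNormalFunctional fun X : B.Op => f (X ⊗ₒ (1 : F.Op)) := by
  obtain ⟨φ, h1, h2⟩ := hf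
  obtain ⟨w, b, -⟩ := exists_hilbertBasis ℂ F.carrier
  have hs : Summable fun p : Σ _ : ℕ, w =>
      ‖ContinuousLinearMap.adjoint (ket B (b p.2)) (φ p.1)‖ ^ 2 :=
    summable_sigma_sq (φ := fun p : Σ _ : ℕ, w =>
        ContinuousLinearMap.adjoint (ket B (b p.2)) (φ p.1))
      (fun i => hasSum_norm_slice b (φ i)) h1
  refine isNormalFunctional_of_family (fun p : Σ _ : ℕ, w =>
    ContinuousLinearMap.adjoint (ket B (b p.2)) (φ p.1)) hs _ fun X => ?_
  exact hasSum_sigma_inner (f := fun i => ⟪φ i, (X ⊗ₒ (1 : F.Op)) (φ i)⟫_ℂ)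
      hs hs X (fun i => hasSum_slice b (φ i) (φ i) X) (h2 _)

theorem IsNormalFunctional.comp_dilation {f : A.Op → ℂ} (hf : IsNormalFunctional f)
    (V : A.Hom (B ⊗ₛ F)) : IsNormalFunctional fun X : B.Op =>
      f (ContinuousLinearMap.adjoint V ∘L (X ⊗ₒ (1 : F.Op)) ∘L V) :=
  (hf.comp_conj V).comp_ampliation

theorem isNormalFunctional_inner (ψ : A.carrier) :
    IsNormalFunctional fun X : A.Op => ⟪ψ, X ψ⟫_ℂ :=
  isNormalFunctional_of_family (fun _ : Unit => ψ) .of_finite _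
    fun X => hasSum_unique (fun _ : Unit => ⟪ψ, X ψ⟫_ℂ)

/-- The star homomorphism `X ↦ X ⊗ 1`. -/
def ampliation (B F : QSystem) : B.Op →⋆ₙₐ[ℂ] (B ⊗ₛ F).Op where
  toFun X := X ⊗ₒ 1
  map_smul' c X := smul_tensorOp c X 1
  map_zero' := by rw [← tensorOpL_apply, map_zero, LinearMap.zero_apply]
  map_add' X Y := add_tensorOp X Y 1
  map_mul' X Y := by rw [tensorOp_mul, one_mul]
  map_star' X := by rw [tensorOp_star, star_one]

/-- Composition of completely positive maps. -/
def cpComp {R S T : Type*} [NonUnitalCStarAlgebra R] [NonUnitalCStarAlgebra S]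
    [NonUnitalCStarAlgebra T] [PartialOrder R] [PartialOrder S] [PartialOrder T]
    [StarOrderedRing R] [StarOrderedRing S] [StarOrderedRing T] (g : S →CP T) (f : R →CP S) :
    R →CP T where
  toLinearMap := g.toLinearMap ∘ₗ f.toLinearMap
  map_cstarMatrix_nonneg' k M hM :=
    g.map_cstarMatrix_nonneg' k _ (f.map_cstarMatrix_nonneg' k M hM)

namespace QOperation

/-- The operation `ρ ↦ Tr_F (V ρ V†)`. -/
def ofHom (V : A.Hom (B ⊗ₛ F)) : QOperation A B where
  dual := cpComp (conjCP V)
    (CompletelyPositiveMapClass.toCompletelyPositiveLinearMap (ampliation B F))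
  normal ψ := (isNormalFunctional_inner ψ).comp_dilation V

theorem ofHom_dual (V : A.Hom (B ⊗ₛ F)) (X : B.Op) :
    (ofHom V).dual X = ContinuousLinearMap.adjoint V ∘L (X ⊗ₒ (1 : F.Op)) ∘L V := rfl

/-- The operation `ρ ↦ V ρ V†`. -/
def conj (V : A.Hom B) : QOperation A B where
  dual := conjCP V
  normal ψ := (isNormalFunctional_inner ψ).comp_conj V

theorem conj_dual (V : A.Hom B) (X : B.Op) :
    (conj V).dual X = ContinuousLinearMap.adjoint V ∘L X ∘L V := rfl

end QOperation

theorem IsNormalFunctional.comp_op {f : A.Op → ℂ} (hf : IsNormalFunctional f)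
    (T : QOperation A B) : IsNormalFunctional fun X => f (T.dual X) := by
  obtain ⟨F, V, hV⟩ := T.exists_stinespring
  simp only [hV]
  exact hf.comp_dilation V

theorem IsNormalForm.comp_op {f : A.Op → ℂ} (hf : IsNormalForm f)
    (T : QOperation A B) : IsNormalForm fun X => f (T.dual X) := by
  obtain ⟨F, V, hV⟩ := T.exists_stinespring
  simp only [hV]
  exact hf.comp_dilation V V

/-- The image of a state under an operation. -/
def SubState.map (T : QOperation A B) (ρ : SubState A) : SubState B where
  expect X := ρ.expect (T.dual X)
  normal := ρ.normal.comp_op T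

theorem SubState.map_expect (T : QOperation A B) (ρ : SubState A) (X : B.Op) :
    (ρ.map T).expect X = ρ.expect (T.dual X) := rfl

theorem eq_of_forall_inner {X Y : A.Op} (h : ∀ ψ, ⟪ψ, X ψ⟫_ℂ = ⟪ψ, Y ψ⟫_ℂ) : X = Y := by
  have h2 := (ext_inner_map X.toLinearMap Y.toLinearMap).1 fun a => by
    have := h a
    rw [← inner_conj_symm, ← inner_conj_symm (_ : A.carrier) a]
    exact congrArg (starRingEnd ℂ) this
  ext a
  exact congrArg (fun L => L a) h2

namespace QOperation

/-- Composition of operations. -/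
def comp (S : QOperation B C) (T : QOperation A B) : QOperation A C where
  dual := cpComp T.dual S.dual
  normal ψ := (T.normal ψ).comp_op S

theorem comp_dual (S : QOperation B C) (T : QOperation A B) (X : C.Op) :
    (S.comp T).dual X = T.dual (S.dual X) := rfl

/-- The operation `ρ ↦ c ρ`. -/
def scale (c : ℝ) (T : QOperation A B) : QOperation A B :=
  T.comp (conj ((Real.sqrt c : ℂ) • (1 : A.Op)))

theorem scale_dual {c : ℝ} (hc : 0 ≤ c) (T : QOperation A B) (X : B.Op) :
    (scale c T).dual X = (c : ℂ) • T.dual X := by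
  rw [scale, comp_dual, conj_dual]
  have : ContinuousLinearMap.adjoint ((Real.sqrt c : ℂ) • (1 : A.Op)) =
      (Real.sqrt c : ℂ) • (1 : A.Op) := by
    change star ((Real.sqrt c : ℂ) • (1 : A.Op)) = _
    rw [star_smul, star_one, Complex.star_def, Complex.conj_ofReal]
  rw [this]
  ext a
  have h : (Real.sqrt c : ℂ) * Real.sqrt c = c := by
    rw [← Complex.ofReal_mul, Real.mul_self_sqrt hc]
  simp only [ContinuousLinearMap.comp_apply, smul_apply, one_apply_eq_self, map_smul, smul_smul, h]

/-- The identity operation. -/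
protected def id (A : QSystem) : QOperation A A := conj (ContinuousLinearMap.id ℂ _)

@[simp] theorem id_dual (X : A.Op) : (QOperation.id A).dual X = X := by
  rw [QOperation.id, conj_dual, ContinuousLinearMap.adjoint_id]
  rfl

theorem exists_shuffle (A B C D : QSystem) :
    ∃ L : ((A ⊗ₛ B) ⊗ₛ (C ⊗ₛ D)).carrier →ₗᵢ[ℂ] ((A ⊗ₛ C) ⊗ₛ (B ⊗ₛ D)).carrier,
      ∀ a b c d, L (a ⊗ᵥ b ⊗ᵥ (c ⊗ᵥ d)) = a ⊗ᵥ c ⊗ᵥ (b ⊗ᵥ d) := by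
  obtain ⟨L, hL⟩ := exists_gramIsometry
    (fun p : A.carrier × B.carrier × C.carrier × D.carrier =>
      p.1 ⊗ᵥ p.2.1 ⊗ᵥ (p.2.2.1 ⊗ᵥ p.2.2.2))
    (fun p => p.1 ⊗ᵥ p.2.2.1 ⊗ᵥ (p.2.1 ⊗ᵥ p.2.2.2))
    ((total_tmul (total_pure A B) (total_pure C D)).mono (by
      rintro _ ⟨_, ⟨a, b, rfl⟩, _, ⟨c, d, rfl⟩, rfl⟩
      exact ⟨(a, b, c, d), rfl⟩))
    (fun p q => by simp -proj only [inner_tmul_tmul]; ring)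
  exact ⟨L, fun a b c d => hL (a, b, c, d)⟩

theorem hom_ext₂₂ {H : Type*} [NormedAddCommGroup H] [InnerProductSpace ℂ H]
    {V W : ((A ⊗ₛ B) ⊗ₛ (C ⊗ₛ D)).carrier →L[ℂ] H}
    (h : ∀ a b c d, V (a ⊗ᵥ b ⊗ᵥ (c ⊗ᵥ d)) = W (a ⊗ᵥ b ⊗ᵥ (c ⊗ᵥ d))) : V = W :=
  (total_tmul (total_pure A B) (total_pure C D)).ext (by
    rintro _ ⟨_, ⟨a, b, rfl⟩, _, ⟨c, d, rfl⟩, rfl⟩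
    exact h a b c d)

/-- The two Stinespring operators are tensored and the environments collected on the right. By
normality the values on product operators determine the result, see `dual_ext_tensor`. -/
theorem exists_tensor (T : QOperation A B) (T' : QOperation A' B') :
    ∃ S : QOperation (A ⊗ₛ A') (B ⊗ₛ B'),
      ∀ (X : B.Op) (Y : B'.Op), S.dual (X ⊗ₒ Y) = T.dual X ⊗ₒ T'.dual Y := by
  obtain ⟨F, V, hV⟩ := T.exists_stinespring
  obtain ⟨F', V', hV'⟩ := T'.exists_stinespring
  obtain ⟨L, hL⟩ := exists_shuffle B F B' F'
  refine ⟨ofHom (F := F ⊗ₛ F') (L.toContinuousLinearMap ∘L tmap V V'), fun X Y => ?_⟩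
  have h := conj_of_intertwine (L := L) (X := (X ⊗ₒ Y) ⊗ₒ (1 : (F ⊗ₛ F').Op))
    (Y := (X ⊗ₒ (1 : F.Op)) ⊗ₒ (Y ⊗ₒ (1 : F'.Op))) (hom_ext₂₂ fun a b c d => by
      rw [← one_tensorOp_one]
      simp -proj only [ContinuousLinearMap.comp_apply, tensorOp_tmul,
        LinearIsometry.coe_toContinuousLinearMap, hL])
  rw [ofHom_dual, hV, hV', ContinuousLinearMap.adjoint_comp, tmap_adjoint,
    tensorOp_eq_tmap (ContinuousLinearMap.adjoint V ∘L _), tmap_comp, tmap_comp]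
  exact congrArg (fun M => tmap (ContinuousLinearMap.adjoint V) (ContinuousLinearMap.adjoint V') ∘L
    M ∘L tmap V V') h

/-- The tensor product of operations. -/
def tensor (T : QOperation A B) (T' : QOperation A' B') : QOperation (A ⊗ₛ A') (B ⊗ₛ B') :=
  (exists_tensor T T').choose

theorem tensor_dual (T : QOperation A B) (T' : QOperation A' B') (X : B.Op) (Y : B'.Op) :
    (T.tensor T').dual (X ⊗ₒ Y) = T.dual X ⊗ₒ T'.dual Y :=
  (exists_tensor T T').choose_spec X Y

theorem dual_ext_tensor {S S' : QOperation A (B ⊗ₛ C)}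
    (h : ∀ X Y, S.dual (X ⊗ₒ Y) = S'.dual (X ⊗ₒ Y)) (Z : (B ⊗ₛ C).Op) : S.dual Z = S'.dual Z := by
  refine eq_of_forall_inner fun ψ => ?_
  exact congrFun ((S.normal ψ).isNormalForm.ext_tensor (S'.normal ψ).isNormalForm
    fun X Y => by rw [h]) Z

end QOperation

end Operations

end

noncomputable section

/-! ## Channels and tensor powers -/

section Channels

variable {A B C F G A' B' H K : QSystem}

namespace QChannel

/-- Composition of channels. -/
def comp (S : QChannel B C) (T : QChannel A B) : QChannel A C :=
  { S.toQOperation.comp T.toQOperation with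
    unital := by
      change T.dual (S.dual 1) = 1
      rw [S.unital, T.unital] }

theorem comp_dual (S : QChannel B C) (T : QChannel A B) (X : C.Op) :
    (S.comp T).dual X = T.dual (S.dual X) := rfl

/-- Tensor product of channels. -/
def tensor (T : QChannel A B) (T' : QChannel A' B') : QChannel (A ⊗ₛ A') (B ⊗ₛ B') :=
  { T.toQOperation.tensor T'.toQOperation with
    unital := by
      rw [← one_tensorOp_one, QOperation.tensor_dual, T.unital, T'.unital, one_tensorOp_one] }

theorem tensor_dual (T : QChannel A B) (T' : QChannel A' B') (X : B.Op) (Y : B'.Op) :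
    (T.tensor T').dual (X ⊗ₒ Y) = T.dual X ⊗ₒ T'.dual Y :=
  QOperation.tensor_dual _ _ X Y

theorem adjoint_comp_self (V : A.carrier →ₗᵢ[ℂ] B.carrier) :
    ContinuousLinearMap.adjoint V.toContinuousLinearMap ∘L V.toContinuousLinearMap = 1 :=
  conj_of_intertwine (X := 1) (Y := 1) rfl

/-- The channel `ρ ↦ V ρ V†` of an isometry. -/
def ofIsometry (V : A.carrier →ₗᵢ[ℂ] B.carrier) : QChannel A B :=
  { QOperation.conj V.toContinuousLinearMap with
    unital := adjoint_comp_self V }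

theorem ofIsometry_dual (V : A.carrier →ₗᵢ[ℂ] B.carrier) (X : B.Op) :
    (ofIsometry V).dual X = ContinuousLinearMap.adjoint V.toContinuousLinearMap ∘L X ∘L
      V.toContinuousLinearMap := rfl

/-- The channel with a given Stinespring isometry. -/
def ofDilation (V : A.carrier →ₗᵢ[ℂ] (B ⊗ₛ F).carrier) : QChannel A B :=
  { QOperation.ofHom V.toContinuousLinearMap with
    unital := by
      change ContinuousLinearMap.adjoint V.toContinuousLinearMap ∘L ((1 : B.Op) ⊗ₒ (1 : F.Op)) ∘L _
        = 1
      rw [one_tensorOp_one]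
      exact adjoint_comp_self V }

theorem ofDilation_dual (V : A.carrier →ₗᵢ[ℂ] (B ⊗ₛ F).carrier) (X : B.Op) :
    (ofDilation V).dual X = pullback V X 1 := rfl

/-- The identity channel. -/
protected def id (A : QSystem) : QChannel A A :=
  { QOperation.id A with unital := QOperation.id_dual 1 }

@[simp] theorem id_dual (X : A.Op) : (QChannel.id A).dual X = X := QOperation.id_dual X

/-- The channel discarding the second system. -/
def traceRight (A F : QSystem) : QChannel (A ⊗ₛ F) A :=
  ofDilation (F := F) LinearIsometry.id

theorem traceRight_dual (X : A.Op) : (traceRight A F).dual X = X ⊗ₒ (1 : F.Op) := by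
  rw [traceRight, ofDilation_dual, pullback]
  exact conj_of_intertwine (L := LinearIsometry.id) rfl

/-- The channel exchanging two systems. -/
def swap (A B : QSystem) : QChannel (A ⊗ₛ B) (B ⊗ₛ A) := ofIsometry (exists_commIsometry A B).choose

theorem swap_dual (X : A.Op) (Y : B.Op) : (swap A B).dual (Y ⊗ₒ X) = X ⊗ₒ Y := by
  have hL := (exists_commIsometry A B).choose_spec
  exact conj_of_intertwine (L := (exists_commIsometry A B).choose) (hom_ext fun a b => by
      simp -proj only [ContinuousLinearMap.comp_apply, tensorOp_tmul,
        LinearIsometry.coe_toContinuousLinearMap, hL])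

/-- An operator with `V† V = 1`, as an isometry. -/
def _root_.isometryOfAdjoint (V : A.Hom B) (h : ContinuousLinearMap.adjoint V ∘L V = 1) :
    A.carrier →ₗᵢ[ℂ] B.carrier :=
  ⟨V.toLinearMap, fun x => by
    refine (sq_eq_sq₀ (norm_nonneg _) (norm_nonneg _)).1 ?_
    rw [← inner_self_eq_norm_sq (𝕜 := ℂ), ← inner_self_eq_norm_sq (𝕜 := ℂ)]
    change RCLike.re ⟪V x, V x⟫_ℂ = _
    rw [← ContinuousLinearMap.adjoint_inner_right, ← ContinuousLinearMap.comp_apply, h,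
      one_apply_eq_self]⟩

/-- The tensor product of isometries. -/
def _root_.tmapIsometry (V : A.carrier →ₗᵢ[ℂ] B.carrier) (W : A'.carrier →ₗᵢ[ℂ] B'.carrier) :
    (A ⊗ₛ A').carrier →ₗᵢ[ℂ] (B ⊗ₛ B').carrier :=
  isometryOfAdjoint (tmap V.toContinuousLinearMap W.toContinuousLinearMap) (by
    rw [tmap_adjoint, ← tmap_comp, adjoint_comp_self, adjoint_comp_self]
    exact tmap_id)

theorem exists_dilation (T : QChannel A B) :
    ∃ (F : QSystem) (V : A.carrier →ₗᵢ[ℂ] (B ⊗ₛ F).carrier), IsDilation T V := by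
  obtain ⟨F, V, hV⟩ := T.toQOperation.exists_stinespring
  have h1 : ContinuousLinearMap.adjoint V ∘L V = 1 := by
    have := hV 1
    rw [one_tensorOp_one, T.unital] at this
    exact this.symm
  exact ⟨F, isometryOfAdjoint V h1, fun X => hV X⟩

theorem norm_pullback_le (V : A.carrier →ₗᵢ[ℂ] (B ⊗ₛ F).carrier) (X : B.Op) (Y : F.Op) :
    ‖pullback V X Y‖ ≤ ‖X‖ * ‖Y‖ := by
  have h1 : ‖V.toContinuousLinearMap‖ ≤ 1 := V.norm_toContinuousLinearMap_le
  have h2 : ‖ContinuousLinearMap.adjoint V.toContinuousLinearMap‖ ≤ 1 := by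
    rwa [LinearIsometryEquiv.norm_map]
  calc _ ≤ 1 * (‖X ⊗ₒ Y‖ * 1) :=
        (ContinuousLinearMap.opNorm_comp_le _ _).trans (mul_le_mul h2
          ((ContinuousLinearMap.opNorm_comp_le _ _).trans (mul_le_mul_of_nonneg_left h1
            (norm_nonneg _))) (norm_nonneg _) zero_le_one)
    _ ≤ _ := by
      rw [one_mul, mul_one]
      exact norm_tmap_le X Y

theorem norm_dual_le (T : QChannel A B) (X : B.Op) : ‖T.dual X‖ ≤ ‖X‖ := by
  obtain ⟨F, V, hV⟩ := T.exists_dilation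
  rw [hV]
  refine (norm_pullback_le V X 1).trans ?_
  exact mul_le_of_le_one_right (norm_nonneg _) ContinuousLinearMap.norm_id_le

/-- The `n`-fold tensor power of a channel. -/
def tensorPow (T : QChannel A B) : (n : ℕ) → QChannel (A.pow n) (B.pow n)
  | 0 => QChannel.id trivialSystem
  | n + 1 => (T.tensorPow n).tensor T

theorem isTensorPower_tensorPow (T : QChannel A B) (n : ℕ) : IsTensorPower T n (T.tensorPow n) := by
  induction n with
  | zero => exact fun X => id_dual X
  | succ n ih => exact ⟨_, ih, fun X Y => tensor_dual _ _ X Y⟩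

/-- `IsTensorPower` prescribes values on product operators only; normality makes the tensor power
unique, so any witness may be replaced by `tensorPow`. -/
theorem isTensorPower_dual_eq {T : QChannel A B} : ∀ {n : ℕ} {S : QChannel (A.pow n) (B.pow n)},
    IsTensorPower T n S → ∀ X, S.dual X = (T.tensorPow n).dual X
  | 0, _, h, X => (h X).trans (id_dual X).symm
  | n + 1, S, ⟨S', hS', h⟩, X => by
    refine QOperation.dual_ext_tensor (S := S.toQOperation)
      (S' := (T.tensorPow (n + 1)).toQOperation) (fun X Y => ?_) X
    exact (h X Y).trans ((tensor_dual (T.tensorPow n) T X Y).trans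
      (by rw [isTensorPower_dual_eq hS'])).symm

theorem tensorPow_dual_comp {T' : QChannel A' B'} {T : QChannel A B} {S : QChannel A' A}
    {R : QChannel B B'} (h : ∀ X, T'.dual X = S.dual (T.dual (R.dual X))) (n : ℕ) :
    ∀ X, (T'.tensorPow n).dual X =
      (S.tensorPow n).dual ((T.tensorPow n).dual ((R.tensorPow n).dual X)) := by
  induction n with
  | zero =>
    intro X
    change (QChannel.id trivialSystem).dual X = (QChannel.id trivialSystem).dual
      ((QChannel.id trivialSystem).dual ((QChannel.id trivialSystem).dual X))
    rw [id_dual (A := trivialSystem) X]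
    exact (id_dual (A := trivialSystem) _).symm.trans
      (congrArg _ (id_dual (A := trivialSystem) X).symm)
  | succ n ih =>
    refine QOperation.dual_ext_tensor (S := (T'.tensorPow (n + 1)).toQOperation)
      (S' := (((R.tensorPow (n + 1)).comp (T.tensorPow (n + 1))).comp
        (S.tensorPow (n + 1))).toQOperation) fun X Y => ?_
    change ((T'.tensorPow n).tensor T').dual (X ⊗ₒ Y) =
      ((S.tensorPow n).tensor S).dual (((T.tensorPow n).tensor T).dual
        (((R.tensorPow n).tensor R).dual (X ⊗ₒ Y)))
    rw [tensor_dual, tensor_dual, tensor_dual, tensor_dual, ih, h]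

end QChannel

/-- A dilation of `R ∘ T ∘ S` built from one of `T`; the environment of `T` is a subsystem of the
new environment. -/
theorem exists_dilation_comp {S : QChannel A' A} {R : QChannel B B'}
    (V : A.carrier →ₗᵢ[ℂ] (B ⊗ₛ F).carrier) :
    ∃ (F' : QSystem) (V' : A'.carrier →ₗᵢ[ℂ] (B' ⊗ₛ F').carrier) (J : QChannel F' F),
      ∀ (X : B'.Op) (Z : F.Op),
        pullback V' X (J.dual Z) = S.dual (pullback V (R.dual X) Z) := by
  obtain ⟨G, U, hU⟩ := S.exists_dilation
  obtain ⟨G', U', hU'⟩ := R.exists_dilation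
  obtain ⟨L, hL⟩ := exists_gramIsometry
    (fun p : B'.carrier × G'.carrier × F.carrier × G.carrier =>
      p.1 ⊗ᵥ p.2.1 ⊗ᵥ p.2.2.1 ⊗ᵥ p.2.2.2)
    (fun p => p.1 ⊗ᵥ (p.2.1 ⊗ᵥ p.2.2.1 ⊗ᵥ p.2.2.2))
    ((total_tmul (total_tmul (total_pure B' G') (total_univ (H := F.carrier)))
      (total_univ (H := G.carrier))).mono (by
        rintro _ ⟨_, ⟨_, ⟨a, b, rfl⟩, c, -, rfl⟩, d, -, rfl⟩
        exact ⟨(a, b, c, d), rfl⟩))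
    (fun p q => by simp -proj only [inner_tmul_tmul]; ring)
  -- The new environment consists of those of `R` (`G'`), of `V` (`F`) and of `S` (`G`); the channel
  -- `J` discards `G` and `G'`.
  refine ⟨G' ⊗ₛ F ⊗ₛ G, L.comp ((tmapIsometry (tmapIsometry U' LinearIsometry.id)
      LinearIsometry.id).comp ((tmapIsometry V LinearIsometry.id).comp U)),
    ((QChannel.traceRight F G').comp (QChannel.swap G' F)).comp
      (QChannel.traceRight (G' ⊗ₛ F) G), fun X Z => ?_⟩
  have hid : ∀ A : QSystem, ContinuousLinearMap.adjoint
      (LinearIsometry.id (R := ℂ) (E := A.carrier)).toContinuousLinearMap = 1 := fun A =>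
    ContinuousLinearMap.adjoint_id
  have hconj : ∀ {A B B' : QSystem} (V : A.carrier →ₗᵢ[ℂ] B.carrier) (X : B.Op) (Y : B'.Op),
      ContinuousLinearMap.adjoint (tmapIsometry V (LinearIsometry.id (R := ℂ)
        (E := B'.carrier))).toContinuousLinearMap ∘L (X ⊗ₒ Y) ∘L
          (tmapIsometry V LinearIsometry.id).toContinuousLinearMap =
        (ContinuousLinearMap.adjoint V.toContinuousLinearMap ∘L X ∘L V.toContinuousLinearMap)
          ⊗ₒ Y := by
    intro A B B' V X Y
    change ContinuousLinearMap.adjoint (tmap V.toContinuousLinearMap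
      (LinearIsometry.id (R := ℂ) (E := B'.carrier)).toContinuousLinearMap) ∘L tmap X Y ∘L
      tmap V.toContinuousLinearMap _ = tmap _ Y
    rw [tmap_adjoint, ← tmap_comp, ← tmap_comp, hid]
    rfl
  have hJ : (((QChannel.traceRight F G').comp (QChannel.swap G' F)).comp
      (QChannel.traceRight (G' ⊗ₛ F) G)).dual Z = ((1 : G'.Op) ⊗ₒ Z) ⊗ₒ (1 : G.Op) := by
    rw [QChannel.comp_dual, QChannel.comp_dual, QChannel.traceRight_dual,
      QChannel.traceRight_dual, QChannel.swap_dual]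
  have h1 := conj_of_intertwine (L := L) (X := X ⊗ₒ (((1 : G'.Op) ⊗ₒ Z) ⊗ₒ (1 : G.Op)))
    (Y := ((X ⊗ₒ (1 : G'.Op)) ⊗ₒ Z) ⊗ₒ (1 : G.Op)) ((total_tmul (total_tmul (total_pure B' G')
      (total_univ (H := F.carrier))) (total_univ (H := G.carrier))).ext (by
        rintro _ ⟨_, ⟨_, ⟨a, b, rfl⟩, c, -, rfl⟩, d, -, rfl⟩
        have hL' : ∀ a b c d, L (a ⊗ᵥ b ⊗ᵥ c ⊗ᵥ d) = a ⊗ᵥ (b ⊗ᵥ c ⊗ᵥ d) :=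
          fun a b c d => hL (a, b, c, d)
        simp -proj only [ContinuousLinearMap.comp_apply, tensorOp_tmul,
          LinearIsometry.coe_toContinuousLinearMap, hL']))
  have h2 : ContinuousLinearMap.adjoint U'.toContinuousLinearMap ∘L (X ⊗ₒ (1 : G'.Op)) ∘L
    U'.toContinuousLinearMap = R.dual X := (hU' X).symm
  rw [hU, hJ]
  calc pullback _ X (((1 : G'.Op) ⊗ₒ Z) ⊗ₒ (1 : G.Op))
      = ContinuousLinearMap.adjoint U.toContinuousLinearMap ∘L
        (ContinuousLinearMap.adjoint
            (tmapIsometry V (LinearIsometry.id (E := G.carrier))).toContinuousLinearMap ∘L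
          (ContinuousLinearMap.adjoint (tmapIsometry (tmapIsometry U' (LinearIsometry.id
            (E := F.carrier))) (LinearIsometry.id (E := G.carrier))).toContinuousLinearMap ∘L
          (ContinuousLinearMap.adjoint L.toContinuousLinearMap ∘L
            (X ⊗ₒ (((1 : G'.Op) ⊗ₒ Z) ⊗ₒ (1 : G.Op))) ∘L L.toContinuousLinearMap) ∘L
          (tmapIsometry (tmapIsometry U' LinearIsometry.id)
            LinearIsometry.id).toContinuousLinearMap) ∘L
          (tmapIsometry V LinearIsometry.id).toContinuousLinearMap) ∘L
        U.toContinuousLinearMap := by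
        ext x
        refine ext_inner_left ℂ fun y => ?_
        simp -proj only [pullback, ContinuousLinearMap.comp_apply,
          ContinuousLinearMap.adjoint_inner_right]
        rfl
    _ = _ := by
        rw [h1, hconj, hconj, hconj, h2]
        rfl

end Channels

end

noncomputable section

/-! ## Data processing -/

section DataProcessing

variable {A B C E F E' F' A' B' H K H' K' : QSystem}

theorem IsNormalForm.isLinearMap {f : A.Op → ℂ} (hf : IsNormalForm f) : IsLinearMap ℂ f := by
  obtain ⟨ι, φ, χ, -, -, h⟩ := hf
  refine ⟨fun X Y => (h _).unique (hasSum_of_eq ((h X).add (h Y)) (fun i => ?_) rfl),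
    fun c X => (h _).unique (hasSum_of_eq ((h X).mul_left c) (fun i => ?_) rfl)⟩
  · rw [add_apply, inner_add_right]
  · rw [smul_apply, inner_smul_right]

/-- The expectation functional as a linear map. -/
def SubState.expectL (ρ : SubState A) : A.Op →ₗ[ℂ] ℂ := ρ.normal.isNormalForm.isLinearMap.mk'

@[simp] theorem SubState.expectL_apply (ρ : SubState A) (X : A.Op) : ρ.expectL X = ρ.expect X := rfl

theorem SubState.expect_smul (ρ : SubState A) (c : ℂ) (X : A.Op) :
    ρ.expect (c • X) = c * ρ.expect X := ρ.expectL.map_smul c X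

theorem QuantumCode.of_comp {T' : QChannel A' B'} {T : QChannel A B} {S : QChannel A' A}
    {R : QChannel B B'} (h : ∀ X, T'.dual X = S.dual (T.dual (R.dual X))) {n d : ℕ} {ε : ℝ}
    (hc : QuantumCode T' n d ε) : QuantumCode T n d ε := by
  obtain ⟨Tn, enc, dec, hTn, hf⟩ := hc
  refine ⟨T.tensorPow n, (S.tensorPow n).comp enc, dec.comp (R.tensorPow n),
    QChannel.isTensorPower_tensorPow T n, ?_⟩
  refine hf.trans_eq (congrArg entanglementFidelity (funext fun X => ?_))
  rw [QChannel.isTensorPower_dual_eq hTn, QChannel.tensorPow_dual_comp h]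
  rfl

theorem QChannel.dual_nonneg (T : QChannel A B) {X : B.Op} (hX : 0 ≤ X) : 0 ≤ T.dual X := by
  exact map_nonneg T.dual hX

/-- The sender absorbs `S` and the receiver `R`. Secrecy survives because any environment of `T` is
obtained by discarding part of an environment of the processed channel. -/
theorem PrivateCode.of_comp {T' : QChannel A' B'} {T : QChannel A B} {S : QChannel A' A}
    {R : QChannel B B'} (h : ∀ X, T'.dual X = S.dual (T.dual (R.dual X))) {n d : ℕ} {ε : ℝ}
    (hc : PrivateCode T' n d ε) : PrivateCode T n d ε := by
  obtain ⟨Tn, ρ, D, hTn, hρ, hD, hD1, hrec, hpriv⟩ := hc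
  have hn : ∀ X, Tn.dual X =
      (S.tensorPow n).dual ((T.tensorPow n).dual ((R.tensorPow n).dual X)) := fun X => by
    rw [QChannel.isTensorPower_dual_eq hTn, QChannel.tensorPow_dual_comp h]
  refine ⟨T.tensorPow n, fun m => (ρ m).map (S.tensorPow n).toQOperation,
    fun m => (R.tensorPow n).dual (D m), QChannel.isTensorPower_tensorPow T n, fun m => ?_,
    fun m => (R.tensorPow n).dual_nonneg (hD m), ?_, fun m => ?_, fun F W hW m m' Z => ?_⟩
  · rw [SubState.IsState, SubState.map_expect, QChannel.unital]
    exact hρ m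
  · rw [← map_sum, hD1, QChannel.unital]
  · rw [SubState.map_expect, ← hn]
    exact hrec m
  · obtain ⟨F', W', J, hW'⟩ := exists_dilation_comp (S := S.tensorPow n) (R := R.tensorPow n) W
    have hdil : IsDilation Tn W' := fun X => by
      have := hW' X 1
      rw [J.unital] at this
      rw [this, hn, hW]
    have h1 := hpriv F' W' hdil m m' (J.dual Z)
    have h2 := hW' 1 Z
    rw [(R.tensorPow n).unital] at h2
    rw [h2] at h1
    refine h1.trans (mul_le_mul_of_nonneg_left (J.norm_dual_le Z) ?_)
    -- Only `0 ≤ ε` is missing. For negative `ε`, comparing a message with itself forces `1 = 0` on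
    -- the environment, which contradicts normalisation of the state.
    by_contra hε
    have h4 := hpriv F' W' hdil m m 1
    rw [sub_self, norm_zero] at h4
    have h5 : (1 : F'.Op) = 0 := by
      rw [← norm_eq_zero]
      nlinarith [norm_nonneg (1 : F'.Op)]
    have h6 := hdil 1
    have h7 : pullback W' (1 : (B'.pow n).Op) (0 : F'.Op) = 0 := by
      rw [pullback, ← tensorOpL_apply, map_zero, ContinuousLinearMap.zero_comp,
        ContinuousLinearMap.comp_zero]
    rw [Tn.unital, h5, h7] at h6
    have h8 := hρ m
    rw [SubState.IsState, h6, ← SubState.expectL_apply, map_zero] at h8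
    exact zero_ne_one h8

/-- A bound on the loss survives rescaling and processing of the eavesdropper's system. -/
def LossMonotone {d : ℕ}
    (loss : ∀ E : QSystem, SubState (qudit d ⊗ₛ qudit d ⊗ₛ E) → ℝ → Prop) : Prop :=
  ∀ (E E' : QSystem) (J : QChannel E E') (c : ℝ), 0 ≤ c →
    ∀ (ω : SubState (qudit d ⊗ₛ qudit d ⊗ₛ E)) (ω' : SubState (qudit d ⊗ₛ qudit d ⊗ₛ E')),
      (∀ X Y Z, ω'.expect (X ⊗ₒ Y ⊗ₒ Z) = c * ω.expect (X ⊗ₒ Y ⊗ₒ J.dual Z)) →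
        ∀ δ, loss E ω δ → loss E' ω' (c * δ)

theorem entanglementLoss_monotone (d : ℕ) : LossMonotone (entanglementLoss (d := d)) := by
  intro E E' J c hc ω ω' h δ hδ
  have h1 : ω'.expect 1 = c * ω.expect 1 := by
    have := h 1 1 1
    rwa [J.unital, one_tensorOp_one, one_tensorOp_one, one_tensorOp_one] at this
  have h2 := mul_le_mul_of_nonneg_left hδ hc
  refine le_trans (le_of_eq ?_) h2
  rw [h1]
  simp only [h, J.unital, ← Finset.mul_sum, Complex.re_ofReal_mul]
  ring

theorem keyLoss_monotone (d : ℕ) : LossMonotone (keyLoss (d := d)) := by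
  rintro E E' J c hc ω ω' h δ ⟨b, hb0, hb, hbδ⟩
  refine ⟨fun k l => c * b k l, fun k l => mul_nonneg hc (hb0 k l), fun k l Z => ?_, ?_⟩
  · rw [h, h, ← mul_left_comm, ← mul_sub, norm_mul, Complex.norm_real, Real.norm_of_nonneg hc,
      mul_assoc]
    refine mul_le_mul_of_nonneg_left ((hb k l _).trans ?_) hc
    exact mul_le_mul_of_nonneg_left (J.norm_dual_le Z) (hb0 k l)
  · simp only [← Finset.mul_sum]
    exact mul_le_mul_of_nonneg_left hbδ hc

/-- The instrument that applies a channel and announces an irrelevant outcome. -/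
theorem isInstrument_geometric (T : QChannel A B) :
    IsInstrument (A' := fun _ => B) fun x : ℕ => T.toQOperation.scale (1 / 2 / 2 ^ x) := by
  intro ψ
  -- Every outcome in `ℕ` of a protocol step needs a continuation, so the channel is split into
  -- identical branches of weights `2^{-(x+1)}`, which sum to one.
  have h : HasSum (fun x : ℕ => ((1 / 2 / 2 ^ x : ℝ) : ℂ) * ⟪ψ, ψ⟫_ℂ) (((1 : ℝ) : ℂ) * ⟪ψ, ψ⟫_ℂ) :=
    (Complex.hasSum_ofReal.2 (by simpa using hasSum_geometric_two' 1)).mul_right _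
  refine hasSum_of_eq h (fun x => ?_) ?_
  · rw [QOperation.scale_dual (by positivity), T.unital, smul_apply, one_apply_eq_self,
      inner_smul_right]
  · rw [Complex.ofReal_one, one_mul, inner_self_eq_norm_sq_to_K]
    norm_cast

/-- The constructor `Protocol.use` takes the state after the transmission as data; this supplies it,
by applying `V` and permuting the tensor factors. -/
theorem exists_state_use (V : H.carrier →ₗᵢ[ℂ] (K ⊗ₛ F).carrier)
    (ω : SubState ((A ⊗ₛ H) ⊗ₛ B ⊗ₛ E)) :
    ∃ ω' : SubState (A ⊗ₛ (B ⊗ₛ K) ⊗ₛ (E ⊗ₛ F)), ∀ (X : A.Op) (Y : B.Op) (Y' : K.Op)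
      (Z : E.Op) (Z' : F.Op), ω'.expect (X ⊗ₒ (Y ⊗ₒ Y') ⊗ₒ (Z ⊗ₒ Z')) =
          ω.expect ((X ⊗ₒ pullback V Y' Z') ⊗ₒ Y ⊗ₒ Z) := by
  have htot := total_tmul (total_tmul (total_tmul (total_univ (H := A.carrier)) (total_pure K F))
    (total_univ (H := B.carrier))) (total_univ (H := E.carrier))
  obtain ⟨L, hL⟩ := exists_gramIsometry
    (fun p : A.carrier × K.carrier × F.carrier × B.carrier × E.carrier =>
      p.1 ⊗ᵥ (p.2.1 ⊗ᵥ p.2.2.1) ⊗ᵥ p.2.2.2.1 ⊗ᵥ p.2.2.2.2)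
    (fun p => p.1 ⊗ᵥ (p.2.2.2.1 ⊗ᵥ p.2.1) ⊗ᵥ (p.2.2.2.2 ⊗ᵥ p.2.2.1))
    (htot.mono (by
      rintro _ ⟨_, ⟨_, ⟨a, -, _, ⟨k, f, rfl⟩, rfl⟩, b, -, rfl⟩, e, -, rfl⟩
      exact ⟨(a, k, f, b, e), rfl⟩))
    (fun p q => by simp -proj only [inner_tmul_tmul]; ring)
  have h1 : ∀ (X : A.Op) (Y : B.Op) (Y' : K.Op) (Z : E.Op) (Z' : F.Op),
      ContinuousLinearMap.adjoint L.toContinuousLinearMap ∘L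
        (X ⊗ₒ (Y ⊗ₒ Y') ⊗ₒ (Z ⊗ₒ Z')) ∘L L.toContinuousLinearMap =
      (X ⊗ₒ (Y' ⊗ₒ Z')) ⊗ₒ Y ⊗ₒ Z := fun X Y Y' Z Z' =>
    conj_of_intertwine (htot.ext (by
      rintro _ ⟨_, ⟨_, ⟨a, -, _, ⟨k, f, rfl⟩, rfl⟩, b, -, rfl⟩, e, -, rfl⟩
      have hL' : ∀ a k f b e, L (a ⊗ᵥ (k ⊗ᵥ f) ⊗ᵥ b ⊗ᵥ e) = a ⊗ᵥ (b ⊗ᵥ k) ⊗ᵥ (e ⊗ᵥ f) :=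
        fun a k f b e => hL (a, k, f, b, e)
      simp -proj only [ContinuousLinearMap.comp_apply, tensorOp_tmul,
        LinearIsometry.coe_toContinuousLinearMap, hL']))
  let T : QOperation ((A ⊗ₛ H) ⊗ₛ B ⊗ₛ E) ((A ⊗ₛ (K ⊗ₛ F)) ⊗ₛ B ⊗ₛ E) :=
    (((QOperation.id A).tensor (QOperation.conj V.toContinuousLinearMap)).tensor
      (QOperation.id B)).tensor (QOperation.id E)
  refine ⟨ω.map ((QOperation.conj L.toContinuousLinearMap).comp T), fun X Y Y' Z Z' => ?_⟩
  rw [SubState.map_expect, QOperation.comp_dual, QOperation.conj_dual, h1]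
  simp -proj only [T, QOperation.tensor_dual, QOperation.id_dual]
  rfl

/-- A use of `V'` is replaced by Alice applying `S`, a use of `V`, and Bob applying `R`. The
induction carries two parameters: the eavesdropper of the simulation holds the image of the original
one's system under a channel `M`, and weights and losses are multiplied by `c`, since every local
channel splits into weighted branches. -/
theorem protocol_simulation {S : QChannel H' H} {R : QChannel K K'} {J : QChannel F' F}
    {V : H.carrier →ₗᵢ[ℂ] (K ⊗ₛ F).carrier} {V' : H'.carrier →ₗᵢ[ℂ] (K' ⊗ₛ F').carrier}
    (hV : ∀ (X : K'.Op) (Z : F.Op), pullback V' X (J.dual Z) = S.dual (pullback V (R.dual X) Z))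
    {d : ℕ} {loss : ∀ E : QSystem, SubState (qudit d ⊗ₛ qudit d ⊗ₛ E) → ℝ → Prop}
    (hloss : LossMonotone loss) {n : ℕ} {A B E : QSystem} {ω : SubState (A ⊗ₛ B ⊗ₛ E)} {δ : ℝ}
    (hp : Protocol V' loss n A B E ω δ) :
    ∀ (G : QSystem) (M : QChannel E G) (c : ℝ), 0 ≤ c → ∀ ω' : SubState (A ⊗ₛ B ⊗ₛ G),
      (∀ X Y Z, ω'.expect (X ⊗ₒ Y ⊗ₒ Z) = c * ω.expect (X ⊗ₒ Y ⊗ₒ M.dual Z)) →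
        Protocol V loss n A B G ω' (c * δ) := by
  induction hp with
  | finish ω δ h =>
    intro G M c hc ω' hω'
    exact .finish ω' _ (hloss _ _ M c hc ω ω' hω' δ h)
  | alice I hI ω ω₁ hω δ δ₁ hδ next ih =>
    intro G M c hc ω' hω'
    refine .alice I hI ω' (fun x => ω'.map (((I x).tensor (QOperation.id _)).tensor
      (QOperation.id _))) (fun x X Y Z => ?_) _ (fun x => c * δ₁ x) (hδ.mul_left c)
      fun x => ih x G M c hc _ fun X Y Z => ?_
    · rw [SubState.map_expect]
      simp -proj only [QOperation.tensor_dual, QOperation.id_dual]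
    · rw [SubState.map_expect]
      simp -proj only [QOperation.tensor_dual, QOperation.id_dual]
      rw [hω', hω]
  | bob I hI ω ω₁ hω δ δ₁ hδ next ih =>
    intro G M c hc ω' hω'
    refine .bob I hI ω' (fun x => ω'.map (((QOperation.id _).tensor (I x)).tensor
      (QOperation.id _))) (fun x X Y Z => ?_) _ (fun x => c * δ₁ x) (hδ.mul_left c)
      fun x => ih x G M c hc _ fun X Y Z => ?_
    · rw [SubState.map_expect]
      simp -proj only [QOperation.tensor_dual, QOperation.id_dual]
    · rw [SubState.map_expect]
      simp -proj only [QOperation.tensor_dual, QOperation.id_dual]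
      rw [hω', hω]
  | @use n A B E ω ω₁ hω δ next ih =>
    intro G M c hc ω' hω'
    have hgeo : ∀ a : ℝ, HasSum (fun x : ℕ => (1 / 2 / 2 ^ x : ℝ) * a) a := fun a => by
      simpa using (hasSum_geometric_two' 1).mul_right a
    have hpos : ∀ x : ℕ, (0 : ℝ) ≤ 1 / 2 / 2 ^ x := fun x => by positivity
    let IA := (QChannel.id A).tensor S
    let IB := (QChannel.id B).tensor R
    let ωa : ℕ → SubState ((A ⊗ₛ H) ⊗ₛ B ⊗ₛ G) := fun x =>
      ω'.map (((IA.toQOperation.scale (1 / 2 / 2 ^ x)).tensor (QOperation.id B)).tensor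
        (QOperation.id G))
    choose ωu hωu using fun x => exists_state_use V (ωa x)
    let ωb : ℕ → ℕ → SubState (A ⊗ₛ (B ⊗ₛ K') ⊗ₛ (G ⊗ₛ F)) := fun x y =>
      (ωu x).map (((QOperation.id A).tensor (IB.toQOperation.scale (1 / 2 / 2 ^ y))).tensor
        (QOperation.id (G ⊗ₛ F)))
    -- The simulated state is the original one up to the weights, with the eavesdropper's system
    -- processed by `M ⊗ J`. The identity is computed on products in Bob's and the eavesdropper's
    -- parts and extended by normality.
    have hb : ∀ x y X (Y : (B ⊗ₛ K').Op) (Z : (G ⊗ₛ F).Op),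
        (ωb x y).expect (X ⊗ₒ Y ⊗ₒ Z) =
        ((1 / 2 / 2 ^ y * (1 / 2 / 2 ^ x * c) : ℝ) : ℂ) *
          ω₁.expect (X ⊗ₒ Y ⊗ₒ (M.tensor J).dual Z) := by
      intro x y X
      have hprod : ∀ (Y : B.Op) (Y' : K'.Op) (Z : G.Op) (Z' : F.Op),
          (ωb x y).expect (X ⊗ₒ (Y ⊗ₒ Y') ⊗ₒ (Z ⊗ₒ Z')) =
          ((1 / 2 / 2 ^ y * (1 / 2 / 2 ^ x * c) : ℝ) : ℂ) *
            ω₁.expect (X ⊗ₒ (Y ⊗ₒ Y') ⊗ₒ (M.tensor J).dual (Z ⊗ₒ Z')) := by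
        intro Y Y' Z Z'
        calc (ωb x y).expect (X ⊗ₒ (Y ⊗ₒ Y') ⊗ₒ (Z ⊗ₒ Z'))
            = ((1 / 2 / 2 ^ y : ℝ) : ℂ) *
                (ωu x).expect (X ⊗ₒ (Y ⊗ₒ R.dual Y') ⊗ₒ (Z ⊗ₒ Z')) := by
              rw [SubState.map_expect, QOperation.tensor_dual, QOperation.tensor_dual,
                QOperation.id_dual, QOperation.id_dual, QOperation.scale_dual (hpos y),
                QChannel.tensor_dual, QChannel.id_dual, tensorOp_smul, smul_tensorOp,
                SubState.expect_smul]
          _ = ((1 / 2 / 2 ^ y : ℝ) : ℂ) * (((1 / 2 / 2 ^ x : ℝ) : ℂ) *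
                ω'.expect ((X ⊗ₒ S.dual (pullback V (R.dual Y') Z')) ⊗ₒ Y ⊗ₒ Z)) := by
              rw [hωu, SubState.map_expect, QOperation.tensor_dual, QOperation.tensor_dual,
                QOperation.id_dual, QOperation.id_dual, QOperation.scale_dual (hpos x),
                QChannel.tensor_dual, QChannel.id_dual, smul_tensorOp, smul_tensorOp,
                SubState.expect_smul]
          _ = _ := by
              rw [hω', ← hV, ← hω, QChannel.tensor_dual]
              push_cast
              ring
      have hn1 := (ωb x y).normal.isNormalForm
      have hn2 := ω₁.normal.isNormalForm.const_mul
        ((1 / 2 / 2 ^ y * (1 / 2 / 2 ^ x * c) : ℝ) : ℂ)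
      intro Y Z
      have hY : ∀ (Z : G.Op) (Z' : F.Op), (ωb x y).expect (X ⊗ₒ Y ⊗ₒ (Z ⊗ₒ Z')) =
          ((1 / 2 / 2 ^ y * (1 / 2 / 2 ^ x * c) : ℝ) : ℂ) *
            ω₁.expect (X ⊗ₒ Y ⊗ₒ (M.tensor J).dual (Z ⊗ₒ Z')) := fun Z Z' =>
        congrFun (((hn1.tensor_left (Z ⊗ₒ Z')).tensor_right X).ext_tensor
          ((hn2.tensor_left ((M.tensor J).dual (Z ⊗ₒ Z'))).tensor_right X)
          fun Y Y' => hprod Y Y' Z Z') Y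
      exact congrFun ((hn1.tensor_right (X ⊗ₒ Y)).ext_tensor
        ((hn2.tensor_right (X ⊗ₒ Y)).comp_op (M.tensor J).toQOperation)
        fun Z Z' => hY Z Z') Z
    refine .alice (A' := fun _ => A ⊗ₛ H) _ (isInstrument_geometric IA) ω' ωa
      (fun x X Y Z => ?_) _ _ (hgeo _) fun x => ?_
    · rw [SubState.map_expect, QOperation.tensor_dual, QOperation.tensor_dual,
        QOperation.id_dual, QOperation.id_dual]
    refine .use (ωa x) (ωu x) (hωu x) _ ?_
    refine .bob (B' := fun _ => B ⊗ₛ K') _ (isInstrument_geometric IB) (ωu x) (ωb x)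
      (fun y X Y Z => ?_) _ _ (hgeo _) fun y => ?_
    · rw [SubState.map_expect, QOperation.tensor_dual, QOperation.tensor_dual,
        QOperation.id_dual, QOperation.id_dual]
    have := ih (G ⊗ₛ F) (M.tensor J) _ (by positivity) (ωb x y) (hb x y)
    rwa [mul_assoc, mul_assoc] at this

/-- A code must cope with every dilation of `T`. A given one extends to a dilation of the processed
channel with a larger environment, and the protocol for the latter is simulated. -/
theorem ProtocolCode.of_comp {T' : QChannel A' B'} {T : QChannel A B} {S : QChannel A' A}
    {R : QChannel B B'} (h : ∀ X, T'.dual X = S.dual (T.dual (R.dual X))) {d : ℕ}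
    {loss : ∀ E : QSystem, SubState (qudit d ⊗ₛ qudit d ⊗ₛ E) → ℝ → Prop}
    (hloss : LossMonotone loss) {n : ℕ} {ε : ℝ}
    (hc : ProtocolCode loss T' n ε) : ProtocolCode loss T n ε := by
  intro F V hV
  obtain ⟨F', V', J, hV'⟩ := exists_dilation_comp (S := S) (R := R) V
  obtain ⟨ω, δ, hω, hδ, hp⟩ := hc F' V' fun X => by
    have := hV' X 1
    rw [J.unital] at this
    rw [this, h, hV]
  refine ⟨ω, δ, hω, hδ, ?_⟩
  have := protocol_simulation hV' hloss hp trivialSystem (QChannel.id _) 1 zero_le_one ω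
    fun X Y Z => by rw [QChannel.id_dual, Complex.ofReal_one, one_mul]
  rwa [one_mul] at this

/-- The capacities do not increase under pre- and post-processing. -/
theorem capacity_le_of_comp (κ : CapacityKind) {T' : QChannel A' B'} {T : QChannel A B}
    (S : QChannel A' A) (R : QChannel B B') (h : ∀ X, T'.dual X = S.dual (T.dual (R.dual X))) :
    capacity κ T' ≤ capacity κ T := by
  refine iSup₂_le fun r hr => le_iSup₂_of_le r (fun ε hε => ?_) le_rfl
  obtain ⟨n₀, hn₀⟩ := hr ε hε
  refine ⟨n₀, fun n hn => ?_⟩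
  obtain ⟨d, hd, hcode⟩ := hn₀ n hn
  refine ⟨d, hd, ?_⟩
  cases κ with
  | quantum => exact QuantumCode.of_comp h hcode
  | privateClassical => exact PrivateCode.of_comp h hcode
  | twoWayQuantum => exact ProtocolCode.of_comp h (entanglementLoss_monotone d) hcode
  | secretKey => exact ProtocolCode.of_comp h (keyLoss_monotone d) hcode

end DataProcessing

end

noncomputable section

/-! ## Commuting positive operators -/

section CStarInverse

variable {R : Type*} [CStarAlgebra R] [PartialOrder R] [StarOrderedRing R]

theorem smul_one_nonneg {ε : ℝ} (hε : 0 ≤ ε) : 0 ≤ (ε : ℂ) • (1 : R) := by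
  have h : (ε : ℂ) • (1 : R) = star ((Real.sqrt ε : ℂ) • (1 : R)) * ((Real.sqrt ε : ℂ) • (1 : R)) := by
    rw [star_smul, star_one, smul_mul_smul_comm, one_mul, Complex.star_def, Complex.conj_ofReal,
      ← Complex.ofReal_mul, Real.mul_self_sqrt hε]
  rw [h]
  exact star_mul_self_nonneg _

theorem exists_regularized_inverse {a : R} (ha : 0 ≤ a) {ε : ℝ} (hε : 0 < ε) :
    ∃ s : R, 0 ≤ s ∧ s * (a + (ε : ℂ) • 1) = 1 ∧ (a + (ε : ℂ) • 1) * s = 1 ∧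
      ∀ c, Commute c a → Commute c s := by
  have hu : IsUnit ((ε : ℂ) • (1 : R)) := by
    refine ⟨⟨(ε : ℂ) • 1, (ε : ℂ)⁻¹ • 1, ?_, ?_⟩, rfl⟩ <;>
      rw [smul_mul_smul_comm, one_mul]
    · rw [mul_inv_cancel₀ (by exact_mod_cast hε.ne'), one_smul]
    · rw [inv_mul_cancel₀ (by exact_mod_cast hε.ne'), one_smul]
  have hb : IsUnit (a + (ε : ℂ) • (1 : R)) :=
    CStarAlgebra.isUnit_of_le ((ε : ℂ) • (1 : R)) (le_add_of_nonneg_left ha)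
      (hu.isStrictlyPositive (smul_one_nonneg hε.le))
  obtain ⟨u, hu⟩ := hb
  refine ⟨↑u⁻¹, ?_, ?_, ?_, fun c hc => ?_⟩
  · refine CFC.inv_nonneg_of_nonneg u ?_
    rw [hu]
    exact add_nonneg ha (smul_one_nonneg hε.le)
  · rw [← hu, Units.inv_mul]
  · rw [← hu, Units.mul_inv]
  · refine Commute.units_inv_right ?_
    rw [hu]
    exact hc.add_right ((Commute.one_right c).smul_right _)

/-- Here `s p = (a + ε)⁻¹ p` is a regularised quotient `p / a` of commuting positive elements: a
conditional probability, to be used as a measurement operator. -/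
theorem norm_inverse_mul_le_one {a p s : R} {ε : ℝ} (hε : 0 < ε) (hp : 0 ≤ p) (hpa : p ≤ a)
    (hs : 0 ≤ s) (hsa : s * (a + (ε : ℂ) • 1) = 1) (hcs : Commute p s)
    (hac : Commute a s) : 0 ≤ s * p ∧ s * p ≤ 1 ∧ ‖s * p‖ ≤ 1 := by
  have h0 : 0 ≤ s * p := Commute.mul_nonneg hs hp hcs.symm
  have h1 : s * p ≤ 1 := by
    rw [← sub_nonneg, ← hsa, ← mul_sub]
    refine Commute.mul_nonneg hs ?_ ?_
    · rw [add_sub_right_comm]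
      exact add_nonneg (sub_nonneg.2 hpa) (smul_one_nonneg hε.le)
    · exact (hac.symm.add_right ((Commute.one_right s).smul_right _)).sub_right hcs.symm
  exact ⟨h0, h1, (CStarAlgebra.norm_le_one_iff_of_nonneg _ h0).2 h1⟩

end CStarInverse

/-! ### The partial transpose inequality for maps with commuting range. -/

section PartialTranspose

variable {A B E F K : QSystem}

theorem re_inner_nonneg_of_nonneg {X : A.Op} (hX : 0 ≤ X) (ψ : A.carrier) :
    0 ≤ (⟪ψ, X ψ⟫_ℂ).re := by
  obtain ⟨q, rfl⟩ := exists_eq_star_mul_self hX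
  change 0 ≤ (⟪ψ, ContinuousLinearMap.adjoint q (q ψ)⟫_ℂ).re
  rw [ContinuousLinearMap.adjoint_inner_right]
  exact inner_self_nonneg (𝕜 := ℂ)

theorem inner_apply_of_isSelfAdjoint {X : A.Op} (hX : IsSelfAdjoint X) (φ ψ : A.carrier) :
    ⟪φ, X ψ⟫_ℂ = ⟪X φ, ψ⟫_ℂ := by
  rw [← ContinuousLinearMap.adjoint_inner_left]
  congr 2

/-- A positive `2 × 2` block matrix of commuting operators stays positive when its diagonal blocks
are exchanged. -/
theorem two_re_inner_le_of_commute {a b c : A.Op} (ha : 0 ≤ a) (hac : Commute a c)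
    (hcc : Commute c (star c))
    (h : ∀ f g : A.carrier, 0 ≤ (⟪f, a f⟫_ℂ).re + 2 * (⟪f, c g⟫_ℂ).re + (⟪g, b g⟫_ℂ).re)
    (f g : A.carrier) : 2 * (⟪f, c g⟫_ℂ).re ≤ (⟪f, b f⟫_ℂ).re + (⟪g, a g⟫_ℂ).re := by
  -- Since `a` need not be invertible, the argument runs with `s = (a + ε)⁻¹` and lets `ε` tend to
  -- zero.
  suffices hε : ∀ ε : ℝ, 0 < ε → 2 * (⟪f, c g⟫_ℂ).re ≤
      (⟪f, b f⟫_ℂ).re + (⟪g, a g⟫_ℂ).re + ε * ‖g‖ ^ 2 by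
    refine le_of_forall_pos_le_add fun δ hδ => ?_
    refine (hε (δ / (‖g‖ ^ 2 + 1)) (by positivity)).trans ?_
    have : δ / (‖g‖ ^ 2 + 1) * ‖g‖ ^ 2 ≤ δ := by
      rw [div_mul_eq_mul_div, div_le_iff₀ (by positivity)]
      nlinarith [sq_nonneg ‖g‖]
    linarith
  intro ε hε
  obtain ⟨s, hs0, hs1, hs2, hsc⟩ := exists_regularized_inverse ha hε
  have hsa : IsSelfAdjoint s := .of_nonneg hs0
  have haa : IsSelfAdjoint a := .of_nonneg ha
  have hcs : Commute c s := hsc c hac.symm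
  have hcs' : Commute (star c) s := by
    have := hcs.star_star
    rwa [hsa.star_eq] at this
  have hreg : ∀ x, (⟪x, (a + (ε : ℂ) • (1 : A.Op)) x⟫_ℂ).re = (⟪x, a x⟫_ℂ).re + ε * ‖x‖ ^ 2 := by
    intro x
    rw [add_apply, smul_apply, one_apply_eq_self, inner_add_right, inner_smul_right,
      Complex.add_re, Complex.re_ofReal_mul, ← inner_self_eq_norm_sq (𝕜 := ℂ)]
    rfl
  have hinv : ∀ x, (a + (ε : ℂ) • (1 : A.Op)) (s x) = x := fun x =>
    congrArg (fun L : A.Op => L x) hs2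
  have hbsa : IsSelfAdjoint (a + (ε : ℂ) • (1 : A.Op)) :=
    haa.add (.of_nonneg (smul_one_nonneg hε.le))
  -- This test vector gives the Schur complement inequality `⟪c f, s (c f)⟫ ≤ ⟪f, b f⟫`.
  have h1 := h (-(s (c f))) f
  have e1 : (⟪-(s (c f)), a (-(s (c f)))⟫_ℂ).re ≤ (⟪s (c f), c f⟫_ℂ).re := by
    have := hreg (s (c f))
    rw [hinv] at this
    rw [map_neg, inner_neg_neg, this]
    nlinarith [sq_nonneg ‖s (c f)‖]
  have e2 : (⟪-(s (c f)), c f⟫_ℂ).re = -(⟪s (c f), c f⟫_ℂ).re := by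
    rw [inner_neg_left, Complex.neg_re]
  -- Normality of `c`, together with its commuting with `s`, allows `c` to be exchanged with its
  -- adjoint; this is what permits swapping the diagonal blocks.
  have e3 : ⟪s (c f), c f⟫_ℂ = ⟪s (star c f), star c f⟫_ℂ := by
    rw [← inner_apply_of_isSelfAdjoint hsa, ← inner_apply_of_isSelfAdjoint hsa]
    have e : star c * (s * c) = c * (s * star c) := by
      calc star c * (s * c) = s * (star c * c) := by rw [← mul_assoc, hcs'.eq, mul_assoc]
        _ = c * (s * star c) := by rw [← hcc.eq, ← mul_assoc, ← hcs.eq, mul_assoc]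
    have l : ∀ x y : A.Op, ⟪x f, y f⟫_ℂ = ⟪f, (star x * y) f⟫_ℂ := fun x y => by
      change _ = ⟪f, ContinuousLinearMap.adjoint x (y f)⟫_ℂ
      rw [ContinuousLinearMap.adjoint_inner_right]
    have l1 := l c (s * c)
    have l2 := l (star c) (s * star c)
    rw [star_star] at l2
    exact l1.trans ((congrArg (fun L : A.Op => ⟪f, L f⟫_ℂ) e).trans l2.symm)
  set k := star c f with hk
  -- Completing the square: `2 Re ⟪k, g⟫ ≤ ⟪s k, k⟫ + ⟪g, (a + ε) g⟫`.
  have h2 : 0 ≤ (⟪s k - g, (a + (ε : ℂ) • (1 : A.Op)) (s k - g)⟫_ℂ).re :=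
    re_inner_nonneg_of_nonneg (add_nonneg ha (smul_one_nonneg hε.le)) _
  have e4 : ⟪k, g⟫_ℂ = ⟪f, c g⟫_ℂ := ContinuousLinearMap.adjoint_inner_left _ _ _
  rw [map_sub, hinv, inner_sub_left, inner_sub_right, inner_sub_right,
    inner_apply_of_isSelfAdjoint hbsa (s k), hinv, Complex.sub_re, Complex.sub_re, Complex.sub_re,
    hreg, ← inner_conj_symm g k, Complex.conj_re, e4] at h2
  rw [e2] at h1
  rw [← e3] at h2
  linarith

/-- The positive partial transpose criterion for commuting completely positive maps. -/
theorem re_sum_inner_le_of_commute {n : Type*} [Fintype n] (T : B.Op →CP A.Op)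
    (hT : ∀ X Y, Commute (T X) (T Y)) (e : n → B.carrier) (f : n → A.carrier) :
    (∑ i, ∑ j, ⟪f i, T (InnerProductSpace.rankOne ℂ (e i) (e j)) (f j)⟫_ℂ).re ≤
      ∑ i, ∑ k, (⟪f i, T (InnerProductSpace.rankOne ℂ (e k) (e k)) (f i)⟫_ℂ).re := by
  have hstar : ∀ i j, star (T (InnerProductSpace.rankOne ℂ (e i) (e j))) =
      T (InnerProductSpace.rankOne ℂ (e j) (e i)) := fun i j => adjoint_dual_rankOne T _ _
  have hpair : ∀ i j, ∀ u v : A.carrier,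
      0 ≤ (⟪u, T (InnerProductSpace.rankOne ℂ (e i) (e i)) u⟫_ℂ).re +
        2 * (⟪u, T (InnerProductSpace.rankOne ℂ (e i) (e j)) v⟫_ℂ).re +
          (⟪v, T (InnerProductSpace.rankOne ℂ (e j) (e j)) v⟫_ℂ).re := by
    intro i j u v
    have h := opMatrixForm_re_nonneg (T.map_cstarMatrix_nonneg _ (rankOneMatrix_nonneg ![e i, e j]))
      ![u, v]
    have h1 : (⟪v, T (InnerProductSpace.rankOne ℂ (e j) (e i)) u⟫_ℂ).re =
        (⟪u, T (InnerProductSpace.rankOne ℂ (e i) (e j)) v⟫_ℂ).re := by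
      rw [← hstar, ← inner_conj_symm, Complex.conj_re]
      exact congrArg Complex.re (ContinuousLinearMap.adjoint_inner_left _ _ _)
    simp only [opMatrixForm, Fin.sum_univ_two, Complex.add_re] at h
    change 0 ≤ (⟪u, T (InnerProductSpace.rankOne ℂ (e i) (e i)) u⟫_ℂ).re +
        (⟪u, T (InnerProductSpace.rankOne ℂ (e i) (e j)) v⟫_ℂ).re +
        ((⟪v, T (InnerProductSpace.rankOne ℂ (e j) (e i)) u⟫_ℂ).re +
          (⟪v, T (InnerProductSpace.rankOne ℂ (e j) (e j)) v⟫_ℂ).re) at h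
    rw [h1] at h
    linarith
  have hpos : ∀ i, 0 ≤ T (InnerProductSpace.rankOne ℂ (e i) (e i)) := fun i => by
    refine map_nonneg T ?_
    rw [ContinuousLinearMap.nonneg_iff_isPositive]
    exact InnerProductSpace.isPositive_rankOne_self _
  have key : ∀ i j, 2 * (⟪f i, T (InnerProductSpace.rankOne ℂ (e i) (e j)) (f j)⟫_ℂ).re ≤
      (⟪f i, T (InnerProductSpace.rankOne ℂ (e j) (e j)) (f i)⟫_ℂ).re +
        (⟪f j, T (InnerProductSpace.rankOne ℂ (e i) (e i)) (f j)⟫_ℂ).re := fun i j =>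
    two_re_inner_le_of_commute (hpos i) (hT _ _) (by rw [hstar]; exact hT _ _) (hpair i j) _ _
  have h1 := Finset.sum_le_sum fun i (_ : i ∈ Finset.univ) =>
    Finset.sum_le_sum fun j (_ : j ∈ Finset.univ) => key i j
  simp only [← Finset.mul_sum, Finset.sum_add_distrib] at h1
  rw [Finset.sum_comm (f := fun i j =>
    (⟪f j, T (InnerProductSpace.rankOne ℂ (e i) (e i)) (f j)⟫_ℂ).re)] at h1
  simp only [Complex.re_sum]
  linarith

end PartialTranspose

/-! ## Operations that commute with their reduction -/

section Commuting

variable {A B E F K : QSystem}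

/-- The reduced observables `Θ†(Y ⊗ 1)` can be pulled through `Θ†`. -/
def IsCommuting (Θ : QOperation E (B ⊗ₛ E)) : Prop :=
  ∀ (Y : B.Op) (Z : E.Op) (Y' : B.Op),
    Θ.dual (Y ⊗ₒ (Z * Θ.dual (Y' ⊗ₒ 1))) = Θ.dual (Y ⊗ₒ Z) * Θ.dual (Y' ⊗ₒ 1)

theorem QOperation.dual_star (T : QOperation A B) (X : B.Op) : T.dual (star X) = star (T.dual X) := by
  obtain ⟨F, V, hV⟩ := T.exists_stinespring
  have h := tensorOp_star X (1 : F.Op)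
  rw [star_one] at h
  rw [hV, hV, ← h]
  change _ = ContinuousLinearMap.adjoint _
  rw [ContinuousLinearMap.adjoint_comp, ContinuousLinearMap.adjoint_comp,
    ContinuousLinearMap.adjoint_adjoint, ContinuousLinearMap.comp_assoc]
  rfl

/-- With `Z = 1` the product of the two reduced observables equals `Θ†(Y ⊗ Θ†(Y' ⊗ 1))`. Taking
adjoints of the identity for `Y⋆`, `Y'⋆` leaves this expression unchanged and reverses the product.
-/
theorem IsCommuting.commute {Θ : QOperation E (B ⊗ₛ E)} (h : IsCommuting Θ) (Y Y' : B.Op) :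
    Commute (Θ.dual (Y ⊗ₒ 1)) (Θ.dual (Y' ⊗ₒ 1)) := by
  have hs : ∀ Y : B.Op, star (Θ.dual (Y ⊗ₒ (1 : E.Op))) = Θ.dual (star Y ⊗ₒ 1) := fun Y => by
    rw [← QOperation.dual_star, tensorOp_star, star_one]
  have h1 : ∀ Y Y', Θ.dual (Y ⊗ₒ Θ.dual (Y' ⊗ₒ 1)) = Θ.dual (Y ⊗ₒ 1) * Θ.dual (Y' ⊗ₒ 1) :=
    fun Y Y' => by
    have := h Y 1 Y'
    rwa [one_mul] at this
  have h2 := congrArg star (h1 (star Y) (star Y'))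
  rw [star_mul, hs, hs, ← QOperation.dual_star, tensorOp_star, hs, star_star, star_star, h1] at h2
  exact h2

theorem eq_of_forall_normalForm {X Y : A.Op} (h : ∀ f : A.Op → ℂ, IsNormalForm f → f X = f Y) :
    X = Y :=
  eq_of_forall_inner fun ψ => h _ (isNormalForm_inner ψ ψ)

/-- Both sides are normal in each of the three variables, so the identity is extended from product
operators one variable at a time. -/
theorem isCommuting_of_tensor {Θ₁ : QOperation E (B ⊗ₛ E)} {Θ₂ : QOperation F (K ⊗ₛ F)}
    (h₁ : IsCommuting Θ₁) (h₂ : IsCommuting Θ₂)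
    {Θ : QOperation (E ⊗ₛ F) ((B ⊗ₛ K) ⊗ₛ (E ⊗ₛ F))}
    (h : ∀ Y Y' Z Z', Θ.dual ((Y ⊗ₒ Y') ⊗ₒ (Z ⊗ₒ Z')) = Θ₁.dual (Y ⊗ₒ Z) ⊗ₒ Θ₂.dual (Y' ⊗ₒ Z')) :
    IsCommuting Θ := by
  intro Y Z W
  refine eq_of_forall_normalForm fun f hf => ?_
  have hΘ := hf.comp_op Θ
  have hW : ∀ (Y : B.Op) (Y' : K.Op) (Z : E.Op) (Z' : F.Op) (W : B.Op) (W' : K.Op),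
      f (Θ.dual ((Y ⊗ₒ Y') ⊗ₒ ((Z ⊗ₒ Z') * Θ.dual ((W ⊗ₒ W') ⊗ₒ 1)))) =
        f (Θ.dual ((Y ⊗ₒ Y') ⊗ₒ (Z ⊗ₒ Z')) * Θ.dual ((W ⊗ₒ W') ⊗ₒ 1)) := by
    intro Y Y' Z Z' W W'
    rw [← one_tensorOp_one, h, h, tensorOp_mul, h, tensorOp_mul, h₁, h₂]
  have hY : ∀ (Y : (B ⊗ₛ K).Op) (Z : E.Op) (Z' : F.Op) (W : B.Op) (W' : K.Op),
      f (Θ.dual (Y ⊗ₒ ((Z ⊗ₒ Z') * Θ.dual ((W ⊗ₒ W') ⊗ₒ 1)))) =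
        f (Θ.dual (Y ⊗ₒ (Z ⊗ₒ Z')) * Θ.dual ((W ⊗ₒ W') ⊗ₒ 1)) := fun Y Z Z' W W' =>
    congrFun ((hΘ.tensor_left _).ext_tensor
      (((hf.mul_right (Θ.dual ((W ⊗ₒ W') ⊗ₒ 1))).comp_op Θ).tensor_left (Z ⊗ₒ Z'))
      fun Y Y' => hW Y Y' Z Z' W W') Y
  have hZ : ∀ (Y : (B ⊗ₛ K).Op) (Z : (E ⊗ₛ F).Op) (W : B.Op) (W' : K.Op),
      f (Θ.dual (Y ⊗ₒ (Z * Θ.dual ((W ⊗ₒ W') ⊗ₒ 1)))) =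
        f (Θ.dual (Y ⊗ₒ Z) * Θ.dual ((W ⊗ₒ W') ⊗ₒ 1)) := fun Y Z W W' =>
    congrFun (((hΘ.tensor_right Y).mul_right _).ext_tensor
      (((hf.mul_right (Θ.dual ((W ⊗ₒ W') ⊗ₒ 1))).comp_op Θ).tensor_right Y)
      fun Z Z' => hY Y Z Z' W W') Z
  exact congrFun ((((hΘ.tensor_right Y).mul_left Z).comp_op Θ).tensor_left 1 |>.ext_tensor
    (((hf.mul_left (Θ.dual (Y ⊗ₒ Z))).comp_op Θ).tensor_left 1)
    fun W W' => hZ Y Z W W') W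

theorem adjoint_tmulL_tmul (e b : B.carrier) (a : A.carrier) :
    ContinuousLinearMap.adjoint (tmulL B A e) (b ⊗ᵥ a) = ⟪e, b⟫_ℂ • a := by
  refine ext_inner_left ℂ fun a' => ?_
  rw [ContinuousLinearMap.adjoint_inner_right, tmulL_apply, inner_tmul_tmul, inner_smul_right]

theorem rankOne_tensorOp (u v : B.carrier) (Z : A.Op) :
    (InnerProductSpace.rankOne ℂ u v : B.Op) ⊗ₒ Z =
      tmulL B A u ∘L Z ∘L ContinuousLinearMap.adjoint (tmulL B A v) := by
  refine hom_ext fun b a => ?_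
  rw [tensorOp_tmul, ContinuousLinearMap.comp_apply, ContinuousLinearMap.comp_apply,
    adjoint_tmulL_tmul, InnerProductSpace.rankOne_apply, smul_tmul_vec, map_smul, map_smul,
    tmulL_apply]

theorem conj_tmulL_dual (e : B.carrier) (Y : B.Op) (Z : A.Op) :
    (QOperation.conj (tmulL B A e)).dual (Y ⊗ₒ Z) = ⟪e, Y e⟫_ℂ • Z := by
  ext a
  rw [QOperation.conj_dual, ContinuousLinearMap.comp_apply, ContinuousLinearMap.comp_apply,
    tmulL_apply, tensorOp_tmul, adjoint_tmulL_tmul]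
  rfl

theorem trivialSystem_op_eq (Y : trivialSystem.Op) :
    Y = ⟪(1 : ℂ), Y (1 : ℂ)⟫_ℂ • (1 : trivialSystem.Op) := by
  ext
  simp

end Commuting

end

noncomputable section

/-! ## Entanglement breaking channels have no capacity -/

section Instruments

variable {A B E : QSystem}

theorem hasSum_comm_of_nonneg {ι κ : Type*} {r : ι → κ → ℝ} (h0 : ∀ i j, 0 ≤ r i j) {a : ι → ℝ}
    (ha : ∀ i, HasSum (r i) (a i)) {s : ℝ} (hs : HasSum a s) {b : κ → ℝ}
    (hb : ∀ j, HasSum (fun i => r i j) (b j)) : HasSum b s := by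
  have h1 : Summable fun p : ι × κ => r p.1 p.2 := by
    rw [summable_prod_of_nonneg fun p => h0 p.1 p.2]
    refine ⟨fun i => (ha i).summable, ?_⟩
    simpa only [(ha _).tsum_eq] using hs.summable
  have h2 := h1.hasSum
  rw [(h2.prod_fiberwise ha).unique hs] at h2
  exact ((Equiv.prodComm κ ι).hasSum_iff.2 h2).prod_fiberwise hb

theorem IsInstrument.hasSum {A' : ℕ → QSystem} {I : ∀ x, QOperation A (A' x)} (hI : IsInstrument I)
    {f : A.Op → ℂ} (hf : IsNormalFunctional f) :
    HasSum (fun x => (f ((I x).dual 1)).re) (f 1).re := by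
  obtain ⟨φ, h1, h2⟩ := hf
  refine hasSum_comm_of_nonneg (r := fun n x => (⟪φ n, (I x).dual 1 (φ n)⟫_ℂ).re) (fun n x => ?_)
    (fun n => Complex.hasSum_re (hI (φ n))) (a := fun n => ‖φ n‖ ^ 2) ?_
    fun x => Complex.hasSum_re (h2 _)
  · exact re_inner_nonneg_of_nonneg (map_nonneg (I x).dual zero_le_one) _
  · refine hasSum_norm_sq ?_
    exact h2 1

theorem IsNormalFunctional.re_mono {f : A.Op → ℂ} (hf : IsNormalFunctional f) {X Y : A.Op}
    (h : ∀ ψ, (⟪ψ, X ψ⟫_ℂ).re ≤ (⟪ψ, Y ψ⟫_ℂ).re) : (f X).re ≤ (f Y).re := by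
  obtain ⟨φ, -, h2⟩ := hf
  exact hasSum_le (fun n => h (φ n)) (Complex.hasSum_re (h2 X)) (Complex.hasSum_re (h2 Y))

theorem SubState.re_nonneg (ρ : SubState A) {X : A.Op} (hX : 0 ≤ X) : 0 ≤ (ρ.expect X).re := by
  have := ρ.normal.re_mono (X := 0) (Y := X) fun ψ => by
    simpa using re_inner_nonneg_of_nonneg hX ψ
  rwa [← ρ.expectL_apply 0, map_zero] at this

theorem SubState.re_mono (ρ : SubState A) {X Y : A.Op} (h : X ≤ Y) :
    (ρ.expect X).re ≤ (ρ.expect Y).re := by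
  have := ρ.re_nonneg (sub_nonneg.2 h)
  rw [← ρ.expectL_apply, map_sub, Complex.sub_re] at this
  simpa using this

theorem tensorOp_nonneg {X : A.Op} {Y : B.Op} (hX : 0 ≤ X) (hY : 0 ≤ Y) : 0 ≤ X ⊗ₒ Y := by
  obtain ⟨p, rfl⟩ := exists_eq_star_mul_self hX
  obtain ⟨q, rfl⟩ := exists_eq_star_mul_self hY
  rw [← tensorOp_mul, ← tensorOp_star]
  exact star_mul_self_nonneg _

end Instruments

/-! ### Protocols in which the eavesdropper can produce Bob's system. -/

section EntanglementBreaking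

variable {A B E F K : QSystem}

/-- The state of Alice and the eavesdropper determines the state of Alice and Bob: Bob's system is
produced from the eavesdropper's one, without disturbance of the latter. -/
def IsEveDetermined (ω : SubState (A ⊗ₛ B ⊗ₛ E)) : Prop :=
  ∃ (τ : SubState (A ⊗ₛ E)) (Θ : QOperation E (B ⊗ₛ E)), IsCommuting Θ ∧
    ∀ X Y Z, ω.expect (X ⊗ₒ Y ⊗ₒ Z) = τ.expect (X ⊗ₒ Θ.dual (Y ⊗ₒ Z))

theorem isCommuting_conj_tmulL (E : QSystem) (e : B.carrier) :
    IsCommuting (QOperation.conj (tmulL B E e)) := fun Y Z Y' => by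
  rw [conj_tmulL_dual, conj_tmulL_dual, conj_tmulL_dual, mul_smul_comm, mul_smul_comm, mul_one,
    mul_one, smul_comm]

theorem isEveDetermined_trivial (ω : SubState (A ⊗ₛ trivialSystem ⊗ₛ E)) : IsEveDetermined ω := by
  have hΘ := conj_tmulL_dual (B := trivialSystem) (A := E) (1 : ℂ)
  refine ⟨ω.map ((QChannel.traceRight A trivialSystem).toQOperation.tensor (QOperation.id E)),
    QOperation.conj (tmulL trivialSystem E (1 : ℂ)), isCommuting_conj_tmulL E _,
    fun X Y Z => ?_⟩
  rw [hΘ, SubState.map_expect, QOperation.tensor_dual, QChannel.traceRight_dual,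
    QOperation.id_dual, tensorOp_smul]
  conv_lhs => rw [trivialSystem_op_eq Y]
  rw [tensorOp_smul, smul_tensorOp]

theorem isEveDetermined_alice {A' : QSystem} {ω : SubState (A ⊗ₛ B ⊗ₛ E)} (h : IsEveDetermined ω)
    (I : QOperation A A') {ω' : SubState (A' ⊗ₛ B ⊗ₛ E)}
    (hω : ∀ X Y Z, ω'.expect (X ⊗ₒ Y ⊗ₒ Z) = ω.expect (I.dual X ⊗ₒ Y ⊗ₒ Z)) :
    IsEveDetermined ω' := by
  obtain ⟨τ, Θ, hc, hτ⟩ := h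
  refine ⟨τ.map (I.tensor (QOperation.id E)), Θ, hc, fun X Y Z => ?_⟩
  rw [hω, hτ, SubState.map_expect, QOperation.tensor_dual, QOperation.id_dual]

theorem isEveDetermined_bob {B' : QSystem} {ω : SubState (A ⊗ₛ B ⊗ₛ E)} (h : IsEveDetermined ω)
    (I : QOperation B B') {ω' : SubState (A ⊗ₛ B' ⊗ₛ E)}
    (hω : ∀ X Y Z, ω'.expect (X ⊗ₒ Y ⊗ₒ Z) = ω.expect (X ⊗ₒ I.dual Y ⊗ₒ Z)) :
    IsEveDetermined ω' := by
  obtain ⟨τ, Θ, hc, hτ⟩ := h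
  have hd : ∀ Y Z, ((I.tensor (QOperation.id E)).comp Θ).dual (Y ⊗ₒ Z) =
      Θ.dual (I.dual Y ⊗ₒ Z) := fun Y Z => by
    rw [QOperation.comp_dual, QOperation.tensor_dual, QOperation.id_dual]
  refine ⟨τ, (I.tensor (QOperation.id E)).comp Θ, fun Y Z Y' => ?_, fun X Y Z => ?_⟩
  · rw [hd, hd, hd, hc]
  · rw [hω, hτ, hd]

theorem exists_shuffle_operation (Θ₁ : QOperation E (B ⊗ₛ E)) (Θ₂ : QOperation F (K ⊗ₛ F)) :
    ∃ Θ : QOperation (E ⊗ₛ F) ((B ⊗ₛ K) ⊗ₛ (E ⊗ₛ F)), ∀ Y Y' Z Z',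
      Θ.dual ((Y ⊗ₒ Y') ⊗ₒ (Z ⊗ₒ Z')) = Θ₁.dual (Y ⊗ₒ Z) ⊗ₒ Θ₂.dual (Y' ⊗ₒ Z') := by
  obtain ⟨L, hL⟩ := QOperation.exists_shuffle B E K F
  refine ⟨(QOperation.conj L.toContinuousLinearMap).comp (Θ₁.tensor Θ₂), fun Y Y' Z Z' => ?_⟩
  rw [QOperation.comp_dual, QOperation.conj_dual, conj_of_intertwine
    (Y := (Y ⊗ₒ Z) ⊗ₒ (Y' ⊗ₒ Z')), QOperation.tensor_dual]
  refine QOperation.hom_ext₂₂ fun a b c d => ?_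
  simp -proj only [ContinuousLinearMap.comp_apply, tensorOp_tmul,
    LinearIsometry.coe_toContinuousLinearMap, hL]

/-- The environment of `R` is a copy of the channel input. So the new `τ` is obtained by handing
Alice's input system to the eavesdropper, and the new `Θ` is the old one together with conjugation
by `R`, which makes Bob's output from it. -/
theorem isEveDetermined_use {R : F.carrier →ₗᵢ[ℂ] (K ⊗ₛ F).carrier}
    (hR : IsCommuting (QOperation.conj R.toContinuousLinearMap))
    {ω : SubState ((A ⊗ₛ F) ⊗ₛ B ⊗ₛ E)} (h : IsEveDetermined ω)
    {ω' : SubState (A ⊗ₛ (B ⊗ₛ K) ⊗ₛ (E ⊗ₛ F))}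
    (hω : ∀ (X : A.Op) (Y : B.Op) (Y' : K.Op) (Z : E.Op) (Z' : F.Op),
        ω'.expect (X ⊗ₒ (Y ⊗ₒ Y') ⊗ₒ (Z ⊗ₒ Z')) =
          ω.expect ((X ⊗ₒ pullback R Y' Z') ⊗ₒ Y ⊗ₒ Z)) : IsEveDetermined ω' := by
  obtain ⟨τ, Θ, hc, hτ⟩ := h
  obtain ⟨Θ', hΘ'⟩ := exists_shuffle_operation Θ (QOperation.conj R.toContinuousLinearMap)
  obtain ⟨L, hL⟩ := exists_gramIsometry
    (fun p : A.carrier × F.carrier × E.carrier => p.1 ⊗ᵥ p.2.1 ⊗ᵥ p.2.2)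
    (fun p => p.1 ⊗ᵥ (p.2.2 ⊗ᵥ p.2.1)) (total_range_triple A F E)
    (fun p q => by simp -proj only [inner_tmul_tmul]; ring)
  have hLd : ∀ (X : A.Op) (Z : E.Op) (Z' : F.Op),
      (QOperation.conj L.toContinuousLinearMap).dual (X ⊗ₒ (Z ⊗ₒ Z')) = X ⊗ₒ Z' ⊗ₒ Z :=
    fun X Z Z' => conj_of_intertwine ((total_range_triple A F E).ext (by
      rintro _ ⟨⟨a, f, e⟩, rfl⟩
      have hL' : ∀ a f e, L (a ⊗ᵥ f ⊗ᵥ e) = a ⊗ᵥ (e ⊗ᵥ f) := fun a f e => hL (a, f, e)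
      simp -proj only [ContinuousLinearMap.comp_apply, tensorOp_tmul,
        LinearIsometry.coe_toContinuousLinearMap, hL']))
  refine ⟨τ.map (QOperation.conj L.toContinuousLinearMap), Θ', isCommuting_of_tensor hc hR hΘ',
    fun X => ?_⟩
  set τ' := τ.map (QOperation.conj L.toContinuousLinearMap)
  have hprod : ∀ (Y : B.Op) (Y' : K.Op) (Z : E.Op) (Z' : F.Op),
      ω'.expect (X ⊗ₒ (Y ⊗ₒ Y') ⊗ₒ (Z ⊗ₒ Z')) =
        τ'.expect (X ⊗ₒ Θ'.dual ((Y ⊗ₒ Y') ⊗ₒ (Z ⊗ₒ Z'))) := by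
    intro Y Y' Z Z'
    rw [hω, hτ, hΘ', SubState.map_expect, hLd]
    rfl
  have hn1 := ω'.normal.isNormalForm
  have hn2 := (τ'.normal.isNormalForm.tensor_right X).comp_op Θ'
  intro Y Z
  have hY : ∀ (Z : E.Op) (Z' : F.Op), ω'.expect (X ⊗ₒ Y ⊗ₒ (Z ⊗ₒ Z')) =
      τ'.expect (X ⊗ₒ Θ'.dual (Y ⊗ₒ (Z ⊗ₒ Z'))) := fun Z Z' =>
    congrFun (((hn1.tensor_left (Z ⊗ₒ Z')).tensor_right X).ext_tensor
      (hn2.tensor_left (Z ⊗ₒ Z')) fun Y Y' => hprod Y Y' Z Z') Y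
  exact congrFun ((hn1.tensor_right (X ⊗ₒ Y)).ext_tensor (hn2.tensor_right Y)
    fun Z Z' => hY Z Z') Z

/-- A loss that is at least a quarter of the weight of the state, if Bob's system is produced from
the eavesdropper's one. -/
def IsEveBounded {d : ℕ}
    (loss : ∀ E : QSystem, SubState (qudit d ⊗ₛ qudit d ⊗ₛ E) → ℝ → Prop) : Prop :=
  ∀ (E : QSystem) (ω : SubState (qudit d ⊗ₛ qudit d ⊗ₛ E)) (δ : ℝ), IsEveDetermined ω →
    loss E ω δ → (ω.expect 1).re / 4 ≤ δ

/-- Every step preserves `IsEveDetermined`, and the weights of the branches add up to that of the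
state, so the bound at the leaves sums to the bound at the root. -/
theorem protocol_loss_ge {R : F.carrier →ₗᵢ[ℂ] (K ⊗ₛ F).carrier}
    (hR : IsCommuting (QOperation.conj R.toContinuousLinearMap)) {d : ℕ}
    {loss : ∀ E : QSystem, SubState (qudit d ⊗ₛ qudit d ⊗ₛ E) → ℝ → Prop}
    (hloss : IsEveBounded loss) {n : ℕ} {A B E : QSystem} {ω : SubState (A ⊗ₛ B ⊗ₛ E)} {δ : ℝ}
    (hp : Protocol R loss n A B E ω δ) : IsEveDetermined ω → (ω.expect 1).re / 4 ≤ δ := by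
  induction hp with
  | finish ω δ h => exact fun hω => hloss _ ω δ hω h
  | alice I hI ω ω' hω δ δ' hδ next ih =>
    intro h
    have h1 := hI.hasSum ((ω.map (QChannel.traceRight _ _).toQOperation).map
      (QChannel.traceRight _ _).toQOperation).normal
    simp -proj only [SubState.map_expect, QChannel.traceRight_dual, one_tensorOp_one] at h1
    refine hasSum_le (fun x => ?_) (h1.div_const 4) hδ
    have h2 := ih x (isEveDetermined_alice h (I x) (hω x))
    have h3 := hω x 1 1 1
    rw [one_tensorOp_one, one_tensorOp_one] at h3
    rwa [h3] at h2
  | bob I hI ω ω' hω δ δ' hδ next ih =>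
    intro h
    have h1 := hI.hasSum (((ω.map (QChannel.traceRight _ _).toQOperation).map
      (QChannel.swap _ _).toQOperation).map (QChannel.traceRight _ _).toQOperation).normal
    simp -proj only [SubState.map_expect, QChannel.traceRight_dual, QChannel.swap_dual,
      QChannel.unital] at h1
    refine hasSum_le (fun x => ?_) (h1.div_const 4) hδ
    have h2 := ih x (isEveDetermined_bob h (I x) (hω x))
    have h3 := hω x 1 1 1
    rw [one_tensorOp_one, one_tensorOp_one] at h3
    rwa [h3] at h2
  | use ω ω' hω δ next ih =>
    intro h
    have h1 := ih (isEveDetermined_use hR h hω)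
    have h2 := hω 1 1 1 1 1
    have h3 : pullback R 1 1 = 1 := (QChannel.ofDilation R).unital
    rw [h3] at h2
    simp -proj only [one_tensorOp_one] at h2
    rwa [h2] at h1

theorem sum_matrixUnit (d : ℕ) : ∑ i : Fin d, matrixUnit i i = (1 : (qudit d).Op) := by
  refine ContinuousLinearMap.ext fun x => ?_
  have := (EuclideanSpace.basisFun (Fin d) ℂ).sum_repr x
  simp only [sum_apply, matrixUnit, InnerProductSpace.rankOne_apply, one_apply_eq_self]
  refine Eq.trans (Finset.sum_congr rfl fun i _ => ?_) this
  rw [EuclideanSpace.inner_single_left, map_one, one_mul, EuclideanSpace.basisFun_repr,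
    EuclideanSpace.basisFun_apply]

/-- The map `X ↦ Θ†(X ⊗ 1)` has commuting range, so the partial transpose inequality bounds the
overlap with the maximally entangled state by `1 / d ≤ 1 / 2` of the weight. -/
theorem isEveBounded_entanglementLoss {d : ℕ} (hd : 2 ≤ d) :
    IsEveBounded (entanglementLoss (d := d)) := by
  rintro E ω δ ⟨τ, Θ, hc, hτ⟩ hδ
  let T : (qudit d).Op →CP E.Op := cpComp Θ.dual
    (CompletelyPositiveMapClass.toCompletelyPositiveLinearMap (ampliation (qudit d) E))
  have hTd : ∀ X, T X = Θ.dual (X ⊗ₒ 1) := fun X => rfl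
  have hle : (τ.expect (∑ i, ∑ j, matrixUnit i j ⊗ₒ T (matrixUnit i j))).re ≤
      (τ.expect ((1 : (qudit d).Op) ⊗ₒ T 1)).re := by
    refine τ.normal.re_mono fun ψ => ?_
    let e : Fin d → (qudit d).carrier := fun i => EuclideanSpace.single i (1 : ℂ)
    have h := re_sum_inner_le_of_commute T (fun X Y => hc.commute X Y) e
      fun i => ContinuousLinearMap.adjoint (tmulL (qudit d) E (e i)) ψ
    have hterm : ∀ (i j : Fin d) (Z : E.Op), ⟪ψ, (matrixUnit i j ⊗ₒ Z) ψ⟫_ℂ =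
        ⟪ContinuousLinearMap.adjoint (tmulL (qudit d) E (e i)) ψ,
          Z (ContinuousLinearMap.adjoint (tmulL (qudit d) E (e j)) ψ)⟫_ℂ := fun i j Z => by
      rw [matrixUnit, rankOne_tensorOp, ContinuousLinearMap.adjoint_inner_left]
      rfl
    have hr : ((1 : (qudit d).Op) ⊗ₒ T 1) =
        ∑ i, ∑ k, matrixUnit i i ⊗ₒ T (matrixUnit k k) := by
      rw [← sum_matrixUnit, map_sum, sum_tensorOp]
      exact Finset.sum_congr rfl fun i _ => tensorOp_sum _ _ _
    rw [hr]
    simp -proj only [sum_apply, inner_sum, hterm, Complex.re_sum] at h ⊢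
    exact h
  have h1 : ω.expect 1 = τ.expect ((1 : (qudit d).Op) ⊗ₒ T 1) := by
    have := hτ 1 1 1
    rwa [one_tensorOp_one, one_tensorOp_one] at this
  have h2 : ∑ i : Fin d, ∑ j : Fin d,
      ω.expect (matrixUnit i j ⊗ₒ matrixUnit i j ⊗ₒ (1 : E.Op)) =
      τ.expect (∑ i, ∑ j, matrixUnit i j ⊗ₒ T (matrixUnit i j)) := by
    rw [← τ.expectL_apply, map_sum]
    refine Finset.sum_congr rfl fun i _ => ?_
    rw [map_sum]
    exact Finset.sum_congr rfl fun j _ => hτ _ _ _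
  rw [← h1] at hle
  rw [entanglementLoss, h2] at hδ
  have h0 : 0 ≤ (ω.expect 1).re := ω.re_nonneg zero_le_one
  have hd' : (2 : ℝ) ≤ d := by exact_mod_cast hd
  have h3 : (τ.expect (∑ i, ∑ j, matrixUnit i j ⊗ₒ T (matrixUnit i j))).re / d ≤
      (ω.expect 1).re / 2 := by
    rw [div_le_div_iff₀ (by linarith) two_pos]
    nlinarith
  linarith

/-- The eavesdropper guesses Bob's outcome `k` with the operator `s T(P k)`, where `s = (T 1 +
ε)⁻¹`. Her guess agrees with Alice's key as often as Bob's outcome does, up to `ε`, hence with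
weight at least `w - δ - ε τ(1)`. An ideal key would be uniform and independent of her, giving `w /
d + δ` at most. So `w ≤ w / d + 2 δ` in the limit, and `d ≥ 2` yields `w / 4 ≤ δ`. -/
theorem isEveBounded_keyLoss {d : ℕ} (hd : 2 ≤ d) : IsEveBounded (keyLoss (d := d)) := by
  rintro E ω δ ⟨τ, Θ, hc, hτ⟩ ⟨c, hc0, hcb, hcδ⟩
  let T : (qudit d).Op →CP E.Op := cpComp Θ.dual
    (CompletelyPositiveMapClass.toCompletelyPositiveLinearMap (ampliation (qudit d) E))
  have hTd : ∀ X, T X = Θ.dual (X ⊗ₒ 1) := fun X => rfl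
  have hd' : (2 : ℝ) ≤ d := by exact_mod_cast hd
  have hd0 : (d : ℝ) ≠ 0 := by linarith
  have hcomm : ∀ X Y, Commute (T X) (T Y) := fun X Y => hc.commute X Y
  let P : Fin d → (qudit d).Op := fun k => matrixUnit k k
  have hP : ∀ k, 0 ≤ P k := fun k => by
    rw [ContinuousLinearMap.nonneg_iff_isPositive]
    exact InnerProductSpace.isPositive_rankOne_self _
  have hPsum : ∑ k, P k = 1 := sum_matrixUnit d
  have hTsum : ∑ k, T (P k) = T 1 := by rw [← map_sum, hPsum]
  have hT0 : ∀ k, 0 ≤ T (P k) := fun k => map_nonneg T (hP k)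
  have hω1 : ω.expect ((1 : (qudit d).Op) ⊗ₒ (1 : (qudit d).Op) ⊗ₒ (1 : E.Op)) = ω.expect 1 := by
    rw [one_tensorOp_one, one_tensorOp_one]
  set w := (ω.expect 1).re with hw
  have hw0 : 0 ≤ w := ω.re_nonneg zero_le_one
  have hmul : ∀ (r : ℝ) (z : ℂ), ((r : ℂ) * z).re = r * z.re := fun r z => Complex.re_ofReal_mul r z
  have hone : ‖(1 : E.Op)‖ ≤ 1 := ContinuousLinearMap.norm_id_le
  have hlow : ∀ k, w / d - c k k ≤ (ω.expect (P k ⊗ₒ P k ⊗ₒ 1)).re := fun k => by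
    have h := hcb k k 1
    rw [if_pos rfl, hω1] at h
    have h1 := (abs_le.1 ((Complex.abs_re_le_norm _).trans (h.trans
      (mul_le_of_le_one_right (hc0 k k) hone)))).1
    rw [Complex.sub_re, show (1 / d : ℂ) = ((1 / d : ℝ) : ℂ) by push_cast; rfl, hmul] at h1
    have h2 : 1 / (d : ℝ) * w = w / d := by ring
    rw [← hw, h2] at h1
    change _ ≤ (ω.expect (matrixUnit k k ⊗ₒ matrixUnit k k ⊗ₒ 1)).re
    linarith
  have hdiag : ∑ k, c k k ≤ ∑ k, ∑ l, c k l :=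
    Finset.sum_le_sum fun k _ => Finset.single_le_sum (f := fun l => c k l)
      (fun l _ => hc0 k l) (Finset.mem_univ k)
  suffices hε : ∀ ε : ℝ, 0 < ε → w ≤ w / d + 2 * δ + ε * (τ.expect 1).re by
    have h1 : w ≤ w / d + 2 * δ := by
      refine le_of_forall_pos_le_add fun η hη => ?_
      have hτ0 : 0 ≤ (τ.expect 1).re := τ.re_nonneg zero_le_one
      refine (hε (η / ((τ.expect 1).re + 1)) (by positivity)).trans ?_
      have : η / ((τ.expect 1).re + 1) * (τ.expect 1).re ≤ η := by
        rw [div_mul_eq_mul_div, div_le_iff₀ (by positivity)]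
        nlinarith
      linarith
    have h2 : w / d ≤ w / 2 := div_le_div_of_nonneg_left hw0 two_pos hd'
    linarith
  intro ε hε
  obtain ⟨s, hs0, hs1, hs2, hsc⟩ := exists_regularized_inverse (map_nonneg T zero_le_one) hε
  have hZ : ∀ k, 0 ≤ s * T (P k) ∧ s * T (P k) ≤ 1 ∧ ‖s * T (P k)‖ ≤ 1 := fun k =>
    norm_inverse_mul_le_one hε (hT0 k) (by
      rw [← hTsum]
      exact Finset.single_le_sum (f := fun k => T (P k)) (fun k _ => hT0 k) (Finset.mem_univ k))
      hs0 hs1 (hsc _ (hcomm _ _)) (hsc _ (Commute.refl _))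
  have hZ1 := norm_inverse_mul_le_one hε (map_nonneg T zero_le_one) le_rfl hs0 hs1
    (hsc _ (Commute.refl _)) (hsc _ (Commute.refl (T 1)))
  -- `IsCommuting` pulls `T 1` out of `Θ†(1 ⊗ s (T 1 + ε)) = Θ†(1 ⊗ 1)`; solving gives `Θ†(1 ⊗ s) =
  -- 1 - ε s`.
  have hΘs : Θ.dual ((1 : (qudit d).Op) ⊗ₒ s) * (T 1 + (ε : ℂ) • 1) = T 1 := by
    have h1 := hc 1 s 1
    have h2 : T 1 = Θ.dual ((1 : (qudit d).Op) ⊗ₒ (s * (T 1 + (ε : ℂ) • 1))) := by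
      rw [hs1]
      rfl
    conv_rhs => rw [h2, mul_add, tensorOp_add, map_add, mul_smul_comm, mul_one, tensorOp_smul,
      map_smul]
    rw [mul_add, mul_smul_comm, mul_one]
    exact congrArg (· + (ε : ℂ) • Θ.dual ((1 : (qudit d).Op) ⊗ₒ s)) h1.symm
  have hΘs' : Θ.dual ((1 : (qudit d).Op) ⊗ₒ s) = 1 - (ε : ℂ) • s := by
    have h1 := congrArg (· * s) hΘs
    simp only [mul_assoc, hs2, mul_one] at h1
    rw [h1, eq_sub_iff_add_eq, ← hs2, add_mul, smul_mul_assoc, one_mul]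
  -- Thus measuring the guess after Bob's system has been produced amounts to Bob's own measurement,
  -- up to `ε`.
  have hΘZ : ∀ k, Θ.dual ((1 : (qudit d).Op) ⊗ₒ (s * T (P k))) =
      T (P k) - (ε : ℂ) • (s * T (P k)) := fun k => by
    rw [hTd, hc, hΘs', sub_mul, one_mul, smul_mul_assoc]
  have hA : ∀ k, (ω.expect (P k ⊗ₒ P k ⊗ₒ 1)).re - ε * (τ.expect (P k ⊗ₒ 1)).re ≤
      (ω.expect (P k ⊗ₒ 1 ⊗ₒ (s * T (P k)))).re := fun k => by
    rw [hτ, hτ, hΘZ, tensorOp_sub, tensorOp_smul, ← τ.expectL_apply (_ - _), map_sub, map_smul,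
      smul_eq_mul, Complex.sub_re, hmul]
    have h1 : (τ.expect (P k ⊗ₒ (s * T (P k)))).re ≤ (τ.expect (P k ⊗ₒ 1)).re := by
      refine τ.re_mono ?_
      rw [← sub_nonneg, ← tensorOp_sub]
      exact tensorOp_nonneg (hP k) (sub_nonneg.2 (hZ k).2.1)
    have := mul_le_mul_of_nonneg_left h1 hε.le
    simp only [τ.expectL_apply]
    change (τ.expect (P k ⊗ₒ T (P k))).re - _ ≤ _
    linarith
  have hB : ∀ k, (ω.expect (P k ⊗ₒ 1 ⊗ₒ (s * T (P k)))).re ≤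
      1 / d * (ω.expect (1 ⊗ₒ 1 ⊗ₒ (s * T (P k)))).re + ∑ l, c k l := fun k => by
    have h1 : (ω.expect (P k ⊗ₒ 1 ⊗ₒ (s * T (P k)))).re =
        ∑ l, (ω.expect (P k ⊗ₒ P l ⊗ₒ (s * T (P k)))).re := by
      conv_lhs => rw [← hPsum, tensorOp_sum, sum_tensorOp, ← ω.expectL_apply, map_sum,
        Complex.re_sum]
      rfl
    have h2 : ∀ l, (ω.expect (P k ⊗ₒ P l ⊗ₒ (s * T (P k)))).re ≤
        (if k = l then 1 / d * (ω.expect (1 ⊗ₒ 1 ⊗ₒ (s * T (P k)))).re else 0) + c k l := by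
      intro l
      have h := hcb k l (s * T (P k))
      have h3 := (Complex.re_le_norm _).trans (h.trans
        (mul_le_of_le_one_right (hc0 k l) (hZ k).2.2))
      rw [Complex.sub_re] at h3
      change (ω.expect (P k ⊗ₒ P l ⊗ₒ (s * T (P k)))).re - _ ≤ _ at h3
      split_ifs at h3 ⊢
      · rw [show (1 / d : ℂ) = ((1 / d : ℝ) : ℂ) by push_cast; rfl, hmul] at h3
        linarith
      · rw [zero_mul, Complex.zero_re] at h3
        linarith
    rw [h1]
    refine (Finset.sum_le_sum fun l _ => h2 l).trans_eq ?_
    rw [Finset.sum_add_distrib, Finset.sum_ite_eq, if_pos (Finset.mem_univ k)]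
  have hsum1 : ∑ k, (τ.expect (P k ⊗ₒ 1)).re = (τ.expect 1).re := by
    rw [← one_tensorOp_one, ← hPsum, sum_tensorOp, ← τ.expectL_apply (∑ _, _), map_sum,
      Complex.re_sum]
    rfl
  have hsum2 : ∑ k, (ω.expect (1 ⊗ₒ 1 ⊗ₒ (s * T (P k)))).re ≤ w := by
    have h1 : ∑ k, (ω.expect (1 ⊗ₒ 1 ⊗ₒ (s * T (P k)))).re =
        (ω.expect (1 ⊗ₒ 1 ⊗ₒ (s * T 1))).re := by
      rw [← hTsum, Finset.mul_sum, tensorOp_sum, ← ω.expectL_apply (∑ _, _), map_sum,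
        Complex.re_sum]
      rfl
    rw [h1, hw, ← hω1]
    refine ω.re_mono ?_
    rw [← sub_nonneg, ← tensorOp_sub]
    refine tensorOp_nonneg ?_ (sub_nonneg.2 hZ1.2.1)
    rw [one_tensorOp_one]
    exact zero_le_one
  have h1 := Finset.sum_le_sum fun k (_ : k ∈ Finset.univ) => (hA k).trans (hB k)
  have h2 := Finset.sum_le_sum fun k (_ : k ∈ Finset.univ) => hlow k
  rw [Finset.sum_sub_distrib, ← Finset.mul_sum, hsum1, Finset.sum_add_distrib,
    ← Finset.mul_sum] at h1
  rw [Finset.sum_sub_distrib, Finset.sum_const, Finset.card_univ, Fintype.card_fin,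
    nsmul_eq_mul, mul_div_cancel₀ _ hd0] at h2
  have h3 := mul_le_mul_of_nonneg_left hsum2 (show 0 ≤ 1 / (d : ℝ) by positivity)
  have h4 : 1 / (d : ℝ) * w = w / d := by ring
  linarith

end EntanglementBreaking

end

noncomputable section

/-! ### Parallel codes over a channel with a commuting dilation, and vanishing of all capacities. -/

section EntanglementBreakingCapacity

variable {A B E F K : QSystem}

theorem exists_isometry_tmul (E : QSystem) (e : B.carrier) (he : ‖e‖ = 1) :
    ∃ L : E.carrier →ₗᵢ[ℂ] (B ⊗ₛ E).carrier, L.toContinuousLinearMap = tmulL B E e :=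
  ⟨⟨(tmulL B E e).toLinearMap, fun x => by
    change ‖e ⊗ᵥ x‖ = _
    rw [norm_tmul_vec, he, one_mul]⟩, rfl⟩

theorem exists_commuting_dilation_trivial :
    ∃ W : trivialSystem.carrier →ₗᵢ[ℂ] (trivialSystem ⊗ₛ trivialSystem).carrier,
      IsCommuting (QOperation.conj W.toContinuousLinearMap) ∧
        IsDilation (QChannel.id trivialSystem) W := by
  obtain ⟨L, hL⟩ := exists_isometry_tmul (B := trivialSystem) trivialSystem (1 : ℂ) norm_one
  refine ⟨L, ?_, fun X => ?_⟩
  · rw [hL]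
    exact isCommuting_conj_tmulL (B := trivialSystem) trivialSystem (1 : ℂ)
  · change _ = (QOperation.conj L.toContinuousLinearMap).dual (X ⊗ₒ (1 : trivialSystem.Op))
    rw [hL, conj_tmulL_dual, QChannel.id_dual]
    exact trivialSystem_op_eq X

theorem exists_commuting_dilation_pow {T : QChannel F K} {R : F.carrier →ₗᵢ[ℂ] (K ⊗ₛ F).carrier}
    (hR : IsCommuting (QOperation.conj R.toContinuousLinearMap)) (hT : IsDilation T R) (n : ℕ) :
    ∃ W : (F.pow n).carrier →ₗᵢ[ℂ] (K.pow n ⊗ₛ F.pow n).carrier,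
      IsCommuting (QOperation.conj W.toContinuousLinearMap) ∧ IsDilation (T.tensorPow n) W := by
  induction n with
  | zero =>
    exact exists_commuting_dilation_trivial
  | succ n ih =>
    obtain ⟨W, hW, hTW⟩ := ih
    obtain ⟨L, hL⟩ := QOperation.exists_shuffle (K.pow n) (F.pow n) K F
    have hd : ∀ Y Y' Z Z', (QOperation.conj (L.comp (tmapIsometry W R)).toContinuousLinearMap).dual
        ((Y ⊗ₒ Y') ⊗ₒ (Z ⊗ₒ Z')) = (QOperation.conj W.toContinuousLinearMap).dual (Y ⊗ₒ Z) ⊗ₒ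
          (QOperation.conj R.toContinuousLinearMap).dual (Y' ⊗ₒ Z') := by
      intro Y Y' Z Z'
      have h := conj_of_intertwine (L := L) (X := (Y ⊗ₒ Y') ⊗ₒ (Z ⊗ₒ Z'))
        (Y := (Y ⊗ₒ Z) ⊗ₒ (Y' ⊗ₒ Z')) (QOperation.hom_ext₂₂ fun a b c d => by
          simp -proj only [ContinuousLinearMap.comp_apply, tensorOp_tmul,
            LinearIsometry.coe_toContinuousLinearMap, hL])
      have e : (L.comp (tmapIsometry W R)).toContinuousLinearMap = L.toContinuousLinearMap ∘L
        tmap W.toContinuousLinearMap R.toContinuousLinearMap := rfl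
      rw [QOperation.conj_dual, QOperation.conj_dual, QOperation.conj_dual, e,
        ContinuousLinearMap.adjoint_comp, tmap_adjoint,
        tensorOp_eq_tmap (ContinuousLinearMap.adjoint W.toContinuousLinearMap ∘L _),
        tmap_comp, tmap_comp]
      exact congrArg (fun M => tmap (ContinuousLinearMap.adjoint W.toContinuousLinearMap)
        (ContinuousLinearMap.adjoint R.toContinuousLinearMap) ∘L M ∘L
          tmap W.toContinuousLinearMap R.toContinuousLinearMap) h
    refine ⟨L.comp (tmapIsometry W R), isCommuting_of_tensor hW hR hd, ?_⟩
    refine QOperation.dual_ext_tensor (S := (T.tensorPow (n + 1)).toQOperation)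
      (S' := (QChannel.ofDilation (L.comp (tmapIsometry W R))).toQOperation) fun X Y => ?_
    have h1 := hd X Y 1 1
    rw [one_tensorOp_one] at h1
    exact (QChannel.tensor_dual _ T X Y).trans
      ((congrArg₂ (fun X Y => X ⊗ₒ Y) (hTW X) (hT Y)).trans h1.symm)

/-- Channel and decoder together form a map with commuting range. The partial transpose inequality
at the vectors `U (e i)`, with `U` a dilation of the encoder, bounds the fidelity by `1 / d ≤ 1 /
2`. -/
theorem one_sub_le_of_quantumCode {T : QChannel F K} {R : F.carrier →ₗᵢ[ℂ] (K ⊗ₛ F).carrier}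
    (hR : IsCommuting (QOperation.conj R.toContinuousLinearMap)) (hT : IsDilation T R)
    {n d : ℕ} {ε : ℝ} (hd : 2 ≤ d) (hc : QuantumCode T n d ε) : 1 - ε ≤ 1 / 2 := by
  obtain ⟨Tn, enc, dec, hTn, hf⟩ := hc
  refine hf.trans ?_
  obtain ⟨W, hW, hTW⟩ := exists_commuting_dilation_pow hR hT n
  obtain ⟨G, U, hU⟩ := enc.exists_dilation
  let S : (qudit d).Op →CP (F.pow n ⊗ₛ G).Op := cpComp
    (CompletelyPositiveMapClass.toCompletelyPositiveLinearMap (ampliation (F.pow n) G))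
    (cpComp Tn.dual dec.dual)
  have hSd : ∀ X, S X = Tn.dual (dec.dual X) ⊗ₒ 1 := fun X => rfl
  have hcomm : ∀ X Y, Commute (S X) (S Y) := fun X Y => by
    rw [hSd, hSd, Commute, SemiconjBy, tensorOp_mul, tensorOp_mul,
      QChannel.isTensorPower_dual_eq hTn, QChannel.isTensorPower_dual_eq hTn, hTW, hTW]
    exact congrArg (· ⊗ₒ _) (hW.commute _ _).eq
  let e : Fin d → (qudit d).carrier := fun i => EuclideanSpace.single i (1 : ℂ)
  have h := re_sum_inner_le_of_commute S hcomm e fun i => U (e i)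
  have hterm : ∀ i j X, ⟪U (e i), S X (U (e j))⟫_ℂ =
      ⟪e i, enc.dual (Tn.dual (dec.dual X)) (e j)⟫_ℂ := fun i j X => by
    rw [hU, pullback, ContinuousLinearMap.comp_apply, ContinuousLinearMap.adjoint_inner_right]
    rfl
  simp only [hterm] at h
  have hright : ∀ i, ∑ k, (⟪e i, enc.dual (Tn.dual (dec.dual
      (InnerProductSpace.rankOne ℂ (e k) (e k)))) (e i)⟫_ℂ).re = 1 := fun i => by
    have h1 : ∑ k, enc.dual (Tn.dual (dec.dual (InnerProductSpace.rankOne ℂ (e k) (e k)))) = 1 := by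
      rw [← map_sum, ← map_sum, ← map_sum]
      refine (congrArg (fun X => enc.dual (Tn.dual (dec.dual X))) (sum_matrixUnit d)).trans ?_
      rw [dec.unital, Tn.unital, enc.unital]
    rw [← Complex.re_sum, ← inner_sum, ← sum_apply, h1, one_apply_eq_self]
    simp [e]
  simp only [hright, Finset.sum_const, Finset.card_univ, Fintype.card_fin, nsmul_eq_mul,
    mul_one] at h
  rw [entanglementFidelity, Finset.sum_comm]
  have hd' : (2 : ℝ) ≤ d := by exact_mod_cast hd
  rw [div_le_div_iff₀ (by positivity) two_pos]
  change (∑ i, ∑ j, ⟪e i, enc.dual (Tn.dual (dec.dual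
    (InnerProductSpace.rankOne ℂ (e i) (e j)))) (e j)⟫_ℂ).re * 2 ≤ _
  nlinarith

/-- By `hclone` the environment reproduces Bob's statistics when the images of his POVM elements
under the channel's dual are measured on it. For messages `i ≠ j` it sees outcome `j` with
probabilities at most `ε` and at least `1 - ε`, which secrecy allows to differ by at most `ε`; hence
`1 - 2 ε ≤ ε`. -/
theorem third_le_of_privateCode {T : QChannel F K} {R : F.carrier →ₗᵢ[ℂ] (K ⊗ₛ F).carrier}
    (hR : IsCommuting (QOperation.conj R.toContinuousLinearMap)) (hT : IsDilation T R)
    {n d : ℕ} {ε : ℝ} (hd : 2 ≤ d) (hε : 0 ≤ ε) (hc : PrivateCode T n d ε) : 1 / 3 ≤ ε := by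
  obtain ⟨Tn, ρ, D, hTn, hρ, hD, hD1, hrec, hpriv⟩ := hc
  obtain ⟨W, hW, hTW⟩ := exists_commuting_dilation_pow hR hT n
  have hTd : ∀ X, Tn.dual X = pullback W X 1 := fun X => by
    rw [QChannel.isTensorPower_dual_eq hTn, hTW]
  have hclone : ∀ X, pullback W 1 (Tn.dual X) = Tn.dual X := fun X => by
    have h := hW 1 1 X
    rw [one_mul, one_tensorOp_one] at h
    have h1 : (QOperation.conj W.toContinuousLinearMap).dual 1 = 1 := QChannel.adjoint_comp_self W
    rw [h1, one_mul] at h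
    rw [hTd]
    exact h
  have hnorm : ∀ m, ‖Tn.dual (D m)‖ ≤ 1 := fun m => by
    refine (Tn.norm_dual_le _).trans ((CStarAlgebra.norm_le_one_iff_of_nonneg _ (hD m)).2 ?_)
    rw [← hD1]
    exact Finset.single_le_sum (f := D) (fun k _ => hD k) (Finset.mem_univ m)
  let i : Fin d := ⟨0, by omega⟩
  let j : Fin d := ⟨1, by omega⟩
  have h1 := hpriv _ W hTd j i (Tn.dual (D j))
  rw [hclone] at h1
  have h2 := (Complex.re_le_norm _).trans (h1.trans (mul_le_of_le_one_right hε (hnorm j)))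
  rw [Complex.sub_re] at h2
  have h3 := hrec i
  have h4 := hrec j
  have h5 : ((ρ i).expect (Tn.dual (D i))).re + ((ρ i).expect (Tn.dual (D j))).re ≤ 1 := by
    have h6 : ((ρ i).expect (Tn.dual (D i + D j))).re ≤ ((ρ i).expect (Tn.dual 1)).re := by
      refine (ρ i).re_mono (OrderHomClass.mono Tn.dual ?_)
      rw [← hD1]
      have hij : i ≠ j := by
        intro h
        exact zero_ne_one (congrArg Fin.val h)
      rw [← Finset.sum_pair hij]
      exact Finset.sum_le_sum_of_subset_of_nonneg (Finset.subset_univ _) fun k _ _ => hD k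
    rw [Tn.unital, hρ i, map_add, ← SubState.expectL_apply, map_add, Complex.add_re] at h6
    exact h6
  linarith

/-- A channel with a commuting dilation has no capacity. -/
theorem capacity_eq_zero_of_isCommuting (κ : CapacityKind) {T : QChannel F K}
    {R : F.carrier →ₗᵢ[ℂ] (K ⊗ₛ F).carrier}
    (hR : IsCommuting (QOperation.conj R.toContinuousLinearMap)) (hT : IsDilation T R) :
    capacity κ T = 0 := by
  refine le_antisymm (iSup₂_le fun r hr => ?_) bot_le
  by_contra hr0
  have hr1 : (0 : ℝ) < r := by
    have : 0 < (r : ℝ≥0∞) := not_le.1 hr0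
    exact_mod_cast this
  -- The error `1 / 8` lies below the thresholds `1 / 2`, `1 / 3` and `1 / 4` of the different
  -- codes. Taking `n₀ + 1` uses makes the exponent positive, so that `d ≥ 2`.
  obtain ⟨n₀, hn₀⟩ := hr (1 / 8) (by norm_num)
  obtain ⟨d, hd, hcode⟩ := hn₀ (n₀ + 1) (Nat.le_succ _)
  have hd2 : 2 ≤ d := by
    have h1 : (1 : ℝ) < (2 : ℝ) ^ (((n₀ + 1 : ℕ) : ℝ) * (r : ℝ)) :=
      Real.one_lt_rpow one_lt_two (by positivity)
    have h2 : (1 : ℝ) < d := h1.trans_le hd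
    exact_mod_cast h2
  have hprot : ∀ loss : ∀ E : QSystem, SubState (qudit d ⊗ₛ qudit d ⊗ₛ E) → ℝ → Prop,
      IsEveBounded loss → ¬ ProtocolCode loss T (n₀ + 1) (1 / 8) := by
    intro loss hloss hcode
    obtain ⟨ω, δ, hω, hδ, hp⟩ := hcode F R hT
    have h := protocol_loss_ge hR hloss hp (isEveDetermined_trivial ω)
    rw [hω, Complex.one_re] at h
    linarith
  cases κ with
  | quantum =>
    have := one_sub_le_of_quantumCode hR hT hd2 hcode
    norm_num at this
  | privateClassical =>
    have := third_le_of_privateCode hR hT hd2 (by norm_num) hcode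
    norm_num at this
  | twoWayQuantum => exact hprot _ (isEveBounded_entanglementLoss hd2) hcode
  | secretKey => exact hprot _ (isEveBounded_keyLoss hd2) hcode

end EntanglementBreakingCapacity

end

noncomputable section

/-! ## Weyl operators and Gaussian vectors -/

section Weyl

open MeasureTheory

theorem coeFn_weyl (a b : ℝ) (f : oneMode.carrier) :
    (weyl a b f : oneMode.carrier) =ᵐ[volume] weylFun a b f :=
  MemLp.coeFn_toLp (memLp_weylFun a b (Lp.memLp f))

/-- The phase in the Weyl relations. -/
def weylPhase (a b c d : ℝ) : ℂ := Complex.exp (((b * c - a * d) / 2 : ℝ) * Complex.I)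

theorem weyl_mul (a b c d : ℝ) :
    weyl a b * weyl c d = weylPhase a b c d • weyl (a + c) (b + d) := by
  refine ContinuousLinearMap.ext fun f => ?_
  change (weyl a b (weyl c d f) : oneMode.carrier) = weylPhase a b c d • weyl (a + c) (b + d) f
  refine Lp.ext ?_
  have h1 := coeFn_weyl a b (weyl c d f)
  have h2 := weylFun_congr a b (coeFn_weyl c d f)
  have h3 := coeFn_weyl (a + c) (b + d) f
  have h4 := Lp.coeFn_smul (weylPhase a b c d) (weyl (a + c) (b + d) f : oneMode.carrier)
  filter_upwards [h1, h2, h3, h4] with t e1 e2 e3 e4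
  rw [e1, e2, e4, Pi.smul_apply, e3, smul_eq_mul]
  simp only [weylFun, weylPhase]
  rw [← mul_assoc, ← mul_assoc, ← Complex.exp_add, ← Complex.exp_add, add_assoc]
  congr 2
  push_cast
  ring

@[simp] theorem weyl_zero : weyl 0 0 = 1 := by
  refine ContinuousLinearMap.ext fun f => ?_
  change (weyl 0 0 f : oneMode.carrier) = f
  refine Lp.ext ?_
  filter_upwards [coeFn_weyl 0 0 f] with t e1
  rw [e1]
  simp [weylFun]

theorem weylPhase_self_neg (a b : ℝ) : weylPhase a b (-a) (-b) = 1 := by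
  rw [weylPhase, show (b * -a - a * -b) / 2 = 0 by ring]
  simp

theorem weyl_mul_neg (a b : ℝ) : weyl a b * weyl (-a) (-b) = 1 := by
  rw [weyl_mul, weylPhase_self_neg, one_smul, add_neg_cancel, add_neg_cancel, weyl_zero]

theorem norm_weyl_apply (a b : ℝ) (f : oneMode.carrier) : ‖weyl a b f‖ = ‖f‖ := by
  change ‖(memLp_weylFun a b (Lp.memLp f)).toLp _‖ = _
  rw [Lp.norm_toLp, Lp.norm_def, eLpNorm_weylFun a b (Lp.memLp f).1]

/-- The Weyl operators as isometries. -/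
def weylIsometry (a b : ℝ) : oneMode.carrier →ₗᵢ[ℂ] oneMode.carrier :=
  { (weyl a b).toLinearMap with norm_map' := norm_weyl_apply a b }

theorem inner_weyl_weyl (a b : ℝ) (f g : oneMode.carrier) :
    ⟪weyl a b f, weyl a b g⟫_ℂ = ⟪f, g⟫_ℂ :=
  (weylIsometry a b).inner_map_map f g

theorem adjoint_weyl (a b : ℝ) : ContinuousLinearMap.adjoint (weyl a b) = weyl (-a) (-b) := by
  refine ContinuousLinearMap.ext fun f => ext_inner_left ℂ fun g => ?_
  rw [ContinuousLinearMap.adjoint_inner_right, ← inner_weyl_weyl (-a) (-b)]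
  have h : weyl (-a) (-b) (weyl a b g) = g := by
    have := weyl_mul_neg (-a) (-b)
    rw [neg_neg, neg_neg] at this
    exact congrArg (fun L : oneMode.Op => L g) this
  rw [h]

/-- The function `exp(-s t² / 2)`. -/
def gaussFun (s t : ℝ) : ℂ := Complex.exp (-s / 2 * t ^ 2)

theorem memLp_gaussFun {s : ℝ} (hs : 0 < s) : MemLp (gaussFun s) 2 volume := by
  have hc : Continuous (gaussFun s) := by unfold gaussFun; fun_prop
  rw [memLp_two_iff_integrable_sq_norm hc.aestronglyMeasurable]
  refine (integrable_exp_neg_mul_sq hs).congr (Filter.Eventually.of_forall fun t => ?_)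
  simp only [gaussFun, Complex.norm_exp, ← Real.exp_nat_mul]
  congr 1
  have : (-(s : ℂ) / 2 * (t : ℂ) ^ 2).re = -s / 2 * t ^ 2 := by
    rw [show (-(s : ℂ) / 2 * (t : ℂ) ^ 2) = ((-s / 2 * t ^ 2 : ℝ) : ℂ) by push_cast; ring,
      Complex.ofReal_re]
  rw [this]
  push_cast
  ring

/-- The function `exp(-s t² / 2)` as a vector. -/
def gaussLp {s : ℝ} (hs : 0 < s) : oneMode.carrier := (memLp_gaussFun hs).toLp (gaussFun s)

theorem integral_gaussFun_weyl {s : ℝ} (hs : 0 < s) (a b : ℝ) :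
    ⟪gaussLp hs, (weyl a b (gaussLp hs) : oneMode.carrier)⟫_ℂ =
      (Real.pi / s : ℂ) ^ (1 / 2 : ℂ) * Complex.exp (-(a ^ 2 / s + s * b ^ 2) / 4 : ℝ) := by
  rw [L2.inner_def]
  have h1 : (gaussLp hs : oneMode.carrier) =ᵐ[volume] gaussFun s :=
    MemLp.coeFn_toLp (memLp_gaussFun hs)
  have h2 := (coeFn_weyl a b (gaussLp hs)).trans (weylFun_congr a b h1)
  have h3 : ∀ᵐ t ∂volume, ⟪(gaussLp hs : oneMode.carrier) t,
      (weyl a b (gaussLp hs) : oneMode.carrier) t⟫_ℂ =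
        Complex.exp (-s * t ^ 2 + (a * Complex.I - s * b) * t +
          (a * b / 2 * Complex.I - s * b ^ 2 / 2)) := by
    filter_upwards [h1, h2] with t e1 e2
    rw [e1, e2, RCLike.inner_apply]
    simp only [gaussFun, weylFun]
    rw [← Complex.exp_conj, ← Complex.exp_add, ← Complex.exp_add]
    congr 1
    have : (starRingEnd ℂ) (-(s : ℂ) / 2 * (t : ℂ) ^ 2) = -(s : ℂ) / 2 * (t : ℂ) ^ 2 := by
      rw [show (-(s : ℂ) / 2 * (t : ℂ) ^ 2) = ((-s / 2 * t ^ 2 : ℝ) : ℂ) by push_cast; ring,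
        Complex.conj_ofReal]
    rw [this]
    push_cast
    ring
  rw [integral_congr_ae h3, integral_cexp_quadratic (by simpa using hs), neg_neg]
  congr 2
  have hs' : (s : ℂ) ≠ 0 := by exact_mod_cast hs.ne'
  push_cast
  field_simp
  ring_nf
  rw [Complex.I_sq]
  ring

/-- The normalised Gaussian vector with wave function proportional to `exp(-s t² / 2)`. -/
theorem exists_gaussian {s : ℝ} (hs : 0 < s) :
    ∃ v : oneMode.carrier, (∃ c : ℂ, c ≠ 0 ∧ v = c • gaussLp hs) ∧ ∀ a b : ℝ,
      ⟪v, weyl a b v⟫_ℂ = Complex.exp (-(a ^ 2 / s + s * b ^ 2) / 4 : ℝ) := by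
  set f : oneMode.carrier := gaussLp hs
  have h0 := integral_gaussFun_weyl hs 0 0
  rw [weyl_zero, one_apply_eq_self] at h0
  have hk : (Real.pi / s : ℂ) ^ (1 / 2 : ℂ) ≠ 0 := by
    have : (Real.pi / s : ℂ) ≠ 0 :=
      div_ne_zero (by exact_mod_cast Real.pi_ne_zero) (by exact_mod_cast hs.ne')
    simp [Complex.cpow_eq_zero_iff, Real.pi_ne_zero, hs.ne']
  have hf : (Real.pi / s : ℂ) ^ (1 / 2 : ℂ) = ((‖f‖ ^ 2 : ℝ) : ℂ) := by
    have := inner_self_eq_norm_sq_to_K (𝕜 := ℂ) f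
    rw [h0] at this
    simpa using this
  have hf0 : ‖f‖ ≠ 0 := fun h => hk (by rw [hf, h]; simp)
  refine ⟨(‖f‖ : ℂ)⁻¹ • f, ⟨_, inv_ne_zero (by exact_mod_cast hf0), rfl⟩, fun a b => ?_⟩
  rw [map_smul, inner_smul_left, inner_smul_right, integral_gaussFun_weyl hs, hf, map_inv₀,
    Complex.conj_ofReal]
  have hf1 : (‖f‖ : ℂ) ≠ 0 := by exact_mod_cast hf0
  push_cast
  field_simp

/-- The vacuum vector. -/
def vac : oneMode.carrier := (exists_gaussian one_pos).choose

theorem inner_vac_weyl (a b : ℝ) :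
    ⟪vac, weyl a b vac⟫_ℂ = Complex.exp (-(a ^ 2 + b ^ 2) / 4 : ℝ) := by
  have := (exists_gaussian one_pos).choose_spec.2 a b
  rw [div_one, one_mul] at this
  exact this

theorem norm_vac : ‖vac‖ = 1 := by
  have h := inner_vac_weyl 0 0
  rw [weyl_zero, one_apply_eq_self, inner_self_eq_norm_sq_to_K] at h
  have h2 : ‖vac‖ ^ 2 = 1 := by
    have h' : ((‖vac‖ ^ 2 : ℝ) : ℂ) = 1 := by simpa using h
    exact Complex.ofReal_injective (by rw [h', Complex.ofReal_one])
  nlinarith [norm_nonneg vac]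

theorem inner_weyl_weyl_apply (v : oneMode.carrier) (a b c d : ℝ) :
    ⟪weyl a b v, weyl c d v⟫_ℂ = weylPhase (-a) (-b) c d * ⟪v, weyl (c - a) (d - b) v⟫_ℂ := by
  rw [← ContinuousLinearMap.adjoint_inner_right, adjoint_weyl, sub_eq_neg_add, sub_eq_neg_add]
  have := weyl_mul (-a) (-b) c d
  rw [← inner_smul_right]
  exact congrArg (fun L : oneMode.Op => ⟪v, L v⟫_ℂ) this

end Weyl

end

noncomputable section

/-! ## Totality of the coherent vectors -/

section Coherent

open MeasureTheory FourierTransform SchwartzMap ContDiff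

/-- A test function is the Fourier transform of a Schwartz function, and the transform can be moved
onto `f` under the integral. -/
theorem ae_eq_zero_of_fourier_eq_zero {f : ℝ → ℂ} (hf : Integrable f) (h : ∀ w, 𝓕 f w = 0) :
    ∀ᵐ t, f t = 0 := by
  refine ae_eq_zero_of_integral_contDiff_smul_eq_zero hf.locallyIntegrable fun g hg hg' => ?_
  have h1 : HasCompactSupport fun t => (g t : ℂ) := hg'.comp_left Complex.ofReal_zero
  have h2 : ContDiff ℝ ∞ fun t => (g t : ℂ) := Complex.ofRealCLM.contDiff.comp hg
  set G : 𝓢(ℝ, ℂ) := h1.toSchwartzMap h2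
  have h3 : ∀ t, 𝓕 ((𝓕⁻ G : 𝓢(ℝ, ℂ)) : ℝ → ℂ) t = g t := fun t => by
    rw [← SchwartzMap.fourier_coe, FourierTransform.fourier_fourierInv_eq]
    rfl
  have h4 := VectorFourier.integral_fourierIntegral_smul_eq_flip (L := innerₗ ℝ) (μ := volume)
    (ν := volume) Real.continuous_fourierChar continuous_inner (𝓕⁻ G : 𝓢(ℝ, ℂ)).integrable hf
  calc ∫ t, g t • f t = ∫ t, 𝓕 ((𝓕⁻ G : 𝓢(ℝ, ℂ)) : ℝ → ℂ) t • f t := by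
        refine integral_congr_ae (Filter.Eventually.of_forall fun t => ?_)
        simp only [h3]
        rw [Complex.coe_smul]
    _ = ∫ t, (𝓕⁻ G : 𝓢(ℝ, ℂ)) t • 𝓕 f t := by
        refine h4.trans (integral_congr_ae (Filter.Eventually.of_forall fun t => ?_))
        simp [Real.fourier_eq, VectorFourier.fourierIntegral]
    _ = 0 := by simp [h]

/-- Already the operators `weyl a 0`, multiplication by `exp(i a t)`, suffice: orthogonality of `h`
to their images of the vacuum says that the Fourier transform of a nowhere vanishing Gaussian times
`h` is zero. -/
theorem total_coherent : TotalSet (Set.range fun p : ℝ × ℝ => weyl p.1 p.2 vac) := by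
  refine total_of_eq_zero fun h hh => ?_
  obtain ⟨c, hc, hv⟩ := (exists_gaussian one_pos).choose_spec.1
  change vac = c • gaussLp one_pos at hv
  set G : ℝ → ℂ := fun t => gaussFun 1 t * h t
  have hG : Integrable G := MemLp.integrable_mul (memLp_gaussFun one_pos) (Lp.memLp h)
  have h1 : (gaussLp one_pos : oneMode.carrier) =ᵐ[volume] gaussFun 1 :=
    MemLp.coeFn_toLp (memLp_gaussFun one_pos)
  have hconj : ∀ t : ℝ, (starRingEnd ℂ) (gaussFun 1 t) = gaussFun 1 t := fun t => by
    rw [gaussFun, ← Complex.exp_conj]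
    congr 1
    simp [map_ofNat]
  have h2 : ∀ w, 𝓕 G w = 0 := fun w => by
    have e := hh (weyl (2 * Real.pi * w) 0 vac) ⟨(2 * Real.pi * w, 0), rfl⟩
    rw [hv, map_smul, inner_smul_left, mul_eq_zero, map_eq_zero, L2.inner_def] at e
    have e := e.resolve_left hc
    rw [← e, Real.fourier_real_eq_integral_exp_smul]
    refine integral_congr_ae ?_
    have h3 := (coeFn_weyl (2 * Real.pi * w) 0 (gaussLp one_pos)).trans (weylFun_congr _ _ h1)
    filter_upwards [h3] with t e3
    rw [e3, RCLike.inner_apply]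
    simp only [weylFun, map_mul, ← Complex.exp_conj, G, add_zero, hconj, smul_eq_mul]
    rw [← mul_assoc, mul_comm (h t)]
    congr 3
    simp [map_ofNat]
    ring
  have h3 := ae_eq_zero_of_fourier_eq_zero hG h2
  refine Lp.ext ?_
  filter_upwards [h3, Lp.coeFn_zero ℂ 2 (volume : Measure ℝ)] with t e1 e2
  rw [e2, Pi.zero_apply]
  exact (mul_eq_zero.1 e1).resolve_left (Complex.exp_ne_zero _)

end Coherent

end

noncomputable section

/-! ## Normal functionals are determined by their values on Weyl operators -/

section WeylUniqueness

open MeasureTheory Filter Topology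

theorem weyl_weyl_apply (a b c d : ℝ) (χ : oneMode.carrier) :
    weyl a b (weyl c d χ) = weylPhase a b c d • weyl (a + c) (b + d) χ :=
  congrArg (fun L : oneMode.Op => L χ) (weyl_mul a b c d)

theorem continuous_weyl_vac : Continuous fun z : ℝ × ℝ => weyl z.1 z.2 vac := by
  rw [continuous_iff_continuousAt]
  intro z₀
  rw [ContinuousAt, tendsto_iff_norm_sub_tendsto_zero]
  have h : ∀ z : ℝ × ℝ, ‖weyl z.1 z.2 vac - weyl z₀.1 z₀.2 vac‖ =
      Real.sqrt (2 - 2 * (weylPhase (-z.1) (-z.2) z₀.1 z₀.2 *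
        Complex.exp (-((z₀.1 - z.1) ^ 2 + (z₀.2 - z.2) ^ 2) / 4 : ℝ)).re) := fun z => by
    rw [← Real.sqrt_sq (norm_nonneg _), norm_sub_sq (𝕜 := ℂ), inner_weyl_weyl_apply,
      inner_vac_weyl, norm_weyl_apply, norm_weyl_apply, norm_vac]
    congr 1
    simp only [RCLike.re_to_complex]
    ring
  simp only [h]
  refine Continuous.tendsto' ?_ _ _ ?_
  · unfold weylPhase
    fun_prop
  · simp [weylPhase, mul_comm]

theorem norm_weyl_le (a b : ℝ) : ‖weyl a b‖₊ ≤ 1 :=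
  ContinuousLinearMap.opNorm_le_bound _ zero_le_one fun f => by rw [norm_weyl_apply]; simp

theorem continuous_weyl_coherent (c d : ℝ) :
    Continuous fun z : ℝ × ℝ => weyl z.1 z.2 (weyl c d vac) := by
  have h1 : Continuous fun z : ℝ × ℝ => weylPhase z.1 z.2 c d := by
    unfold weylPhase
    fun_prop
  have h2 : Continuous fun z : ℝ × ℝ => weyl (z.1 + c) (z.2 + d) vac :=
    Continuous.comp (g := fun z : ℝ × ℝ => weyl z.1 z.2 vac)
      (f := fun z : ℝ × ℝ => (z.1 + c, z.2 + d)) continuous_weyl_vac (by fun_prop)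
  exact (h1.smul h2).congr fun z => (weyl_weyl_apply _ _ _ _ _).symm

theorem continuous_weyl_apply (χ : oneMode.carrier) :
    Continuous fun z : ℝ × ℝ => weyl z.1 z.2 χ := by
  rw [continuous_iff_continuousAt]
  intro z₀
  have h : ∀ s ∈ Set.range fun p : ℝ × ℝ => weyl p.1 p.2 vac,
      Tendsto (fun z : ℝ × ℝ => weyl z.1 z.2 s) (𝓝 z₀) (𝓝 (weyl z₀.1 z₀.2 s)) := by
    rintro _ ⟨q, rfl⟩
    exact (continuous_weyl_coherent q.1 q.2).tendsto z₀
  exact total_coherent.tendsto (fun z : ℝ × ℝ => weyl z.1 z.2) (weyl z₀.1 z₀.2) 1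
    (fun z => norm_weyl_le _ _) h χ

/-- The Gaussian weight on phase space. -/
def gaussWeight (z : ℝ × ℝ) : ℂ := Complex.exp (-(z.1 ^ 2 + z.2 ^ 2) / 4 : ℝ)

theorem integrable_gaussWeight : Integrable gaussWeight := by
  have h : Integrable fun t : ℝ => Complex.exp (-(t ^ 2) / 4 : ℝ) := by
    refine (integrable_cexp_quadratic' (b := -1 / 4) (by norm_num) 0 0).congr
      (Eventually.of_forall fun t => ?_)
    simp only
    congr 1
    push_cast
    ring
  refine (h.mul_prod h).congr (Eventually.of_forall fun z => ?_)
  simp only [gaussWeight]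
  rw [← Complex.exp_add]
  congr 1
  push_cast
  ring

theorem integrable_weyl_apply (χ : oneMode.carrier) :
    Integrable fun z : ℝ × ℝ => gaussWeight z • weyl z.1 z.2 χ := by
  refine (integrable_gaussWeight.norm.mul_const ‖χ‖).mono' ?_ (Eventually.of_forall fun z => ?_)
  · exact integrable_gaussWeight.1.smul (continuous_weyl_apply χ).aestronglyMeasurable
  · rw [norm_smul, norm_weyl_apply]

theorem integral_gauss_half (c d : ℂ) :
    ∫ t : ℝ, Complex.exp (-1 / 2 * t ^ 2 + c * t + d) =
      (2 * Real.pi : ℂ) ^ (1 / 2 : ℂ) * Complex.exp (d + c ^ 2 / 2) := by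
  rw [integral_cexp_quadratic (by norm_num)]
  congr 2
  · ring
  · ring

theorem integral_coherent (a b c d : ℝ) :
    ∫ z : ℝ × ℝ, ⟪weyl a b vac, gaussWeight z • weyl z.1 z.2 (weyl c d vac)⟫_ℂ =
      2 * Real.pi * (⟪weyl a b vac, vac⟫_ℂ * ⟪vac, weyl c d vac⟫_ℂ) := by
  have h : ∀ z : ℝ × ℝ, ⟪weyl a b vac, gaussWeight z • weyl z.1 z.2 (weyl c d vac)⟫_ℂ =
      Complex.exp (-1 / 2 * z.1 ^ 2 + (-(c - a) / 2 - (d + b) / 2 * Complex.I) * z.1 + 0) *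
      Complex.exp (-1 / 2 * z.2 ^ 2 + (-(d - b) / 2 + (c + a) / 2 * Complex.I) * z.2 +
        ((a * d - b * c) / 2 * Complex.I - ((c - a) ^ 2 + (d - b) ^ 2) / 4)) := fun z => by
    rw [weyl_weyl_apply, inner_smul_right, inner_smul_right, inner_weyl_weyl_apply, inner_vac_weyl,
      gaussWeight, weylPhase, weylPhase, ← Complex.exp_add, ← Complex.exp_add, ← Complex.exp_add,
      ← Complex.exp_add]
    congr 1
    push_cast
    ring
  simp only [h]
  rw [Measure.volume_eq_prod, integral_prod_mul
    (fun t : ℝ => Complex.exp (-1 / 2 * t ^ 2 + (-(c - a) / 2 - (d + b) / 2 * Complex.I) * t + 0))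
    (fun t : ℝ => Complex.exp (-1 / 2 * t ^ 2 + (-(d - b) / 2 + (c + a) / 2 * Complex.I) * t +
        ((a * d - b * c) / 2 * Complex.I - ((c - a) ^ 2 + (d - b) ^ 2) / 4))),
    integral_gauss_half, integral_gauss_half]
  have h2 : (2 * Real.pi : ℂ) ^ (1 / 2 : ℂ) * (2 * Real.pi : ℂ) ^ (1 / 2 : ℂ) = 2 * Real.pi := by
    rw [← Complex.cpow_add _ _ (by simp [Real.pi_ne_zero])]
    norm_num
  have h3 : ⟪weyl a b vac, vac⟫_ℂ = Complex.exp (-(a ^ 2 + b ^ 2) / 4 : ℝ) := by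
    rw [← inner_conj_symm, inner_vac_weyl, ← Complex.exp_conj, Complex.conj_ofReal]
  rw [mul_mul_mul_comm, h2, h3, inner_vac_weyl, ← Complex.exp_add, ← Complex.exp_add]
  congr 2
  push_cast
  ring_nf
  simp only [Complex.I_sq]
  ring

/-- The vacuum projection is a Gaussian average of Weyl operators. -/
theorem integral_weyl_apply (χ : oneMode.carrier) :
    ∫ z : ℝ × ℝ, gaussWeight z • weyl z.1 z.2 χ = (2 * Real.pi * ⟪vac, χ⟫_ℂ) • vac := by
  let P : oneMode.Op := LinearMap.mkContinuous
    { toFun := fun χ => ∫ z : ℝ × ℝ, gaussWeight z • weyl z.1 z.2 χ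
      map_add' := fun χ χ' => by
        rw [← integral_add (integrable_weyl_apply χ) (integrable_weyl_apply χ')]
        simp only [map_add, smul_add]
      map_smul' := fun c χ => by
        rw [RingHom.id_apply, ← integral_smul]
        simp only [map_smul, smul_comm c] } (∫ z : ℝ × ℝ, ‖gaussWeight z‖) fun χ => by
    refine (norm_integral_le_integral_norm _).trans (le_of_eq ?_)
    rw [← integral_mul_const]
    exact integral_congr_ae (Eventually.of_forall fun z =>
      (norm_smul _ _).trans (congrArg _ (norm_weyl_apply _ _ _)))
  have hP : P = (2 * Real.pi : ℂ) • InnerProductSpace.rankOne ℂ vac vac := by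
    refine total_coherent.ext ?_
    rintro _ ⟨q, rfl⟩
    refine sub_eq_zero.1 (total_coherent.eq_zero ?_)
    rintro _ ⟨p, rfl⟩
    rw [inner_sub_right, sub_eq_zero]
    change ⟪weyl p.1 p.2 vac, ∫ z : ℝ × ℝ, gaussWeight z • weyl z.1 z.2 (weyl q.1 q.2 vac)⟫_ℂ = _
    rw [← integral_inner (integrable_weyl_apply _), integral_coherent, smul_apply,
      InnerProductSpace.rankOne_apply, inner_smul_right, inner_smul_right,
      mul_comm ⟪vac, weyl q.1 q.2 vac⟫_ℂ]
  have := congrArg (fun L : oneMode.Op => L χ) hP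
  rw [mul_smul]
  exact this

/-- The Gaussian average of Weyl operators is `2π |vac⟩⟨vac|`, and sum and integral may be
exchanged. So the Weyl values of `g` determine its value on the vacuum projection. -/
theorem IsNormalForm.integral_weyl {g : oneMode.Op → ℂ} (hg : IsNormalForm g) :
    ∫ z : ℝ × ℝ, gaussWeight z * g (weyl z.1 z.2) =
      2 * Real.pi * g (InnerProductSpace.rankOne ℂ vac vac) := by
  obtain ⟨ι, φ, χ, hφ, hχ, hs⟩ := hg
  -- The exchange of sum and integral needs a countable index set, so the family is restricted to
  -- its support.
  set s : Set ι := Function.support fun i => ‖φ i‖ ^ 2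
  have hcount : Countable s := hφ.countable_support.to_subtype
  have hs' : ∀ X : oneMode.Op, HasSum (fun i : s => ⟪φ i, X (χ i)⟫_ℂ) (g X) := fun X => by
    refine (hasSum_subtype_iff_of_support_subset (f := fun i => ⟪φ i, X (χ i)⟫_ℂ) ?_).2 (hs X)
    intro i hi hi'
    refine hi ?_
    have : φ i = 0 := by simpa using hi'
    simp only [this, inner_zero_left]
  have hsum : Summable fun i : s => ‖φ i‖ * ‖χ i‖ := by
    refine Summable.of_nonneg_of_le (fun i => by positivity) (fun i => ?_)
      ((hφ.subtype s).add (hχ.subtype s))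
    simp only [Function.comp]
    nlinarith [sq_nonneg (‖φ i‖ - ‖χ i‖), sq_nonneg (‖φ i‖), sq_nonneg ‖χ i‖]
  have h1 := hasSum_integral_of_summable_integral_norm (μ := (volume : Measure (ℝ × ℝ)))
    (F := fun (i : s) z => ⟪φ i, gaussWeight z • weyl z.1 z.2 (χ i)⟫_ℂ)
    (fun i => (integrable_weyl_apply (χ i)).const_inner _) ?_
  · have h2 : ∀ z : ℝ × ℝ, ∑' i : s, ⟪φ i, gaussWeight z • weyl z.1 z.2 (χ i)⟫_ℂ =
        gaussWeight z * g (weyl z.1 z.2) := fun z => by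
      simp only [inner_smul_right]
      rw [tsum_mul_left, (hs' _).tsum_eq]
    simp only [h2] at h1
    have h3 := (hs' (InnerProductSpace.rankOne ℂ vac vac)).mul_left (2 * Real.pi : ℂ)
    refine h1.unique (hasSum_of_eq h3 (fun i => ?_) rfl)
    rw [integral_inner (integrable_weyl_apply _), integral_weyl_apply,
      InnerProductSpace.rankOne_apply, inner_smul_right, inner_smul_right, mul_assoc, mul_assoc]
  · refine Summable.of_nonneg_of_le (fun i => integral_nonneg fun z => norm_nonneg _) (fun i => ?_)
      (hsum.mul_left (∫ z : ℝ × ℝ, ‖gaussWeight z‖))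
    rw [← integral_mul_const]
    refine integral_mono ((integrable_weyl_apply (χ i)).const_inner _).norm
      (integrable_gaussWeight.norm.mul_const _) fun z => ?_
    refine (norm_inner_le_norm _ _).trans (le_of_eq ?_)
    rw [norm_smul, norm_weyl_apply]
    ring

/-- A normal functional is determined by its values on the Weyl operators. -/
theorem IsNormalForm.ext_weyl {f g : oneMode.Op → ℂ} (hf : IsNormalForm f) (hg : IsNormalForm g)
    (h : ∀ a b, f (weyl a b) = g (weyl a b)) : f = g := by
  refine hf.ext hg total_coherent total_coherent ?_
  rintro _ ⟨p, rfl⟩ _ ⟨q, rfl⟩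
  -- A rank one operator between coherent vectors is the vacuum projection with a Weyl operator on
  -- each side. The averaging formula is applied to `X ↦ f (weyl p X weyl (-q))`, whose Weyl values
  -- are again Weyl values of `f` up to phases.
  have key : InnerProductSpace.rankOne ℂ (weyl p.1 p.2 vac) (weyl q.1 q.2 vac) =
      weyl p.1 p.2 * (InnerProductSpace.rankOne ℂ vac vac * weyl (-q.1) (-q.2)) := by
    refine ContinuousLinearMap.ext fun x => ?_
    change _ = weyl p.1 p.2 (InnerProductSpace.rankOne ℂ vac vac (weyl (-q.1) (-q.2) x))
    rw [InnerProductSpace.rankOne_apply, InnerProductSpace.rankOne_apply, map_smul, ← adjoint_weyl,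
      ContinuousLinearMap.adjoint_inner_right]
  have hW : ∀ z : ℝ × ℝ, weyl p.1 p.2 * (weyl z.1 z.2 * weyl (-q.1) (-q.2)) =
      (weylPhase z.1 z.2 (-q.1) (-q.2) * weylPhase p.1 p.2 (z.1 + -q.1) (z.2 + -q.2)) •
        weyl (p.1 + (z.1 + -q.1)) (p.2 + (z.2 + -q.2)) := fun z => by
    rw [weyl_mul, mul_smul_comm, weyl_mul, smul_smul]
  have h1 := ((hf.mul_left (weyl p.1 p.2)).mul_right (weyl (-q.1) (-q.2))).integral_weyl
  have h2 := ((hg.mul_left (weyl p.1 p.2)).mul_right (weyl (-q.1) (-q.2))).integral_weyl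
  simp only [hW, hf.isLinearMap.map_smul, hg.isLinearMap.map_smul, h] at h1 h2
  rw [key]
  exact mul_left_cancel₀ (by simp [Real.pi_ne_zero] : (2 * Real.pi : ℂ) ≠ 0) (h1.symm.trans h2)

/-- Operations into a mode are determined by their action on Weyl operators. -/
theorem QOperation.ext_weyl {A : QSystem} {S T : QOperation A oneMode}
    (h : ∀ a b, S.dual (weyl a b) = T.dual (weyl a b)) (X : oneMode.Op) : S.dual X = T.dual X :=
  eq_of_forall_inner fun ψ => congrFun (IsNormalForm.ext_weyl (S.normal ψ).isNormalForm
    (T.normal ψ).isNormalForm fun a b => by rw [h]) X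

end WeylUniqueness

end

noncomputable section

/-! ## Weyl systems and Gaussian isometries -/

/-- A representation of the canonical commutation relations, in exponentiated form, which
determines the normal functionals. -/
structure WeylSystem (A : QSystem) (E : Type) [AddCommGroup E] where
  op : E → A.Op
  form : E → E → ℝ
  form_swap : ∀ i j, form j i = -form i j
  form_add : ∀ i j k, form i (j + k) = form i j + form i k
  op_mul : ∀ i j, op i * op j = Complex.exp ((form i j / 2 : ℝ) * Complex.I) • op (i + j)
  adjoint_op : ∀ i, ContinuousLinearMap.adjoint (op i) = op (-i)
  ext_op : ∀ f g : A.Op → ℂ, IsNormalForm f → IsNormalForm g → (∀ i, f (op i) = g (op i)) → f = g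

/-- A vector whose characteristic function is `exp(-q / 4)`. -/
def IsGaussianVector {A : QSystem} {E : Type} [AddCommGroup E] (𝒲 : WeylSystem A E) (v : A.carrier)
    (q : E → ℝ) : Prop :=
  ∀ i, ⟪v, 𝒲.op i v⟫_ℂ = Complex.exp (-(q i) / 4 : ℝ)

section WeylSystem

variable {A B : QSystem} {E E' : Type} [AddCommGroup E] [AddCommGroup E']

namespace WeylSystem

theorem form_neg (𝒲 : WeylSystem A E) (i j : E) : 𝒲.form i (-j) = -𝒲.form i j := by
  have h0 := 𝒲.form_add i 0 0
  rw [add_zero] at h0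
  have h1 := 𝒲.form_add i j (-j)
  rw [add_neg_cancel] at h1
  linarith

theorem op_op_apply (𝒲 : WeylSystem A E) (i j : E) (v : A.carrier) :
    𝒲.op i (𝒲.op j v) = Complex.exp ((𝒲.form i j / 2 : ℝ) * Complex.I) • 𝒲.op (i + j) v :=
  congrArg (fun L : A.Op => L v) (𝒲.op_mul i j)

/-- If `x` is orthogonal to all displaced vectors, the normal functional `X ↦ ⟪x, X v⟫` vanishes on
Weyl operators, hence on `|x⟩⟨v|`, where its value is `‖v‖² ‖x‖²`. -/
theorem total_op (𝒲 : WeylSystem A E) {v : A.carrier} {q : E → ℝ} (hv : IsGaussianVector 𝒲 v q) :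
    TotalSet (Set.range fun i => 𝒲.op i v) := by
  refine total_of_eq_zero fun x hx => ?_
  have h1 := 𝒲.ext_op (fun X => ⟪x, X v⟫_ℂ) (fun X => ⟪x, X 0⟫_ℂ) (isNormalForm_inner x v)
    (isNormalForm_inner x 0) fun i => by
      rw [map_zero, inner_zero_right, ← inner_conj_symm, hx _ ⟨i, rfl⟩, map_zero]
  have h2 := congrFun h1 (InnerProductSpace.rankOne ℂ x v)
  simp only [map_zero, inner_zero_right, InnerProductSpace.rankOne_apply, inner_smul_right,
    mul_eq_zero, inner_self_eq_zero] at h2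
  refine h2.resolve_left fun h => ?_
  have h3 := hv 0
  rw [h, inner_zero_left] at h3
  exact Complex.exp_ne_zero _ h3.symm

theorem inner_op_op (𝒲 : WeylSystem A E) {v : A.carrier} {q : E → ℝ}
    (hv : IsGaussianVector 𝒲 v q) (i j : E) :
    ⟪𝒲.op i v, 𝒲.op j v⟫_ℂ = Complex.exp ((-(𝒲.form i j) / 2 : ℝ) * Complex.I) *
      Complex.exp (-(q (j - i)) / 4 : ℝ) := by
  rw [← ContinuousLinearMap.adjoint_inner_right, 𝒲.adjoint_op, op_op_apply, inner_smul_right, hv,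
    neg_add_eq_sub, 𝒲.form_swap j (-i), 𝒲.form_neg, 𝒲.form_swap i j, neg_neg]

theorem inner_op_op_op (𝒲 : WeylSystem A E) {v : A.carrier} {q : E → ℝ}
    (hv : IsGaussianVector 𝒲 v q) (i x j : E) :
    ⟪𝒲.op i v, 𝒲.op x (𝒲.op j v)⟫_ℂ =
      Complex.exp (((𝒲.form x j + 𝒲.form x i - 𝒲.form i j) / 2 : ℝ) * Complex.I) *
        Complex.exp (-(q (x + (j - i))) / 4 : ℝ) := by
  rw [op_op_apply, inner_smul_right, inner_op_op 𝒲 hv, ← mul_assoc, ← Complex.exp_add,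
    𝒲.form_add, 𝒲.form_swap x i, add_sub_assoc]
  congr 2
  push_cast
  ring

/-- A symplectic map which respects the characteristic functions of Gaussian vectors is implemented
by an isometry. -/
theorem exists_isometry (𝒲 : WeylSystem A E) (𝒲' : WeylSystem B E') {v : A.carrier}
    {w : B.carrier} {q : E → ℝ} {q' : E' → ℝ} (hv : IsGaussianVector 𝒲 v q)
    (hw : IsGaussianVector 𝒲' w q') (T : E →+ E')
    (hT : ∀ i j, 𝒲'.form (T i) (T j) = 𝒲.form i j) (hq : ∀ i, q' (T i) = q i) :
    ∃ L : A.carrier →ₗᵢ[ℂ] B.carrier,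
      (∀ i, 𝒲'.op (T i) ∘L L.toContinuousLinearMap = L.toContinuousLinearMap ∘L 𝒲.op i) ∧
      ∀ (x : E') (y : E) (n : ℝ), (∀ i, 𝒲'.form x (T i) = 𝒲.form y i) →
        (∀ i, q' (x + T i) = q (y + i) + n) →
        ContinuousLinearMap.adjoint L.toContinuousLinearMap ∘L 𝒲'.op x ∘L
          L.toContinuousLinearMap = Complex.exp (-n / 4 : ℝ) • 𝒲.op y := by
  -- The Gram matrix of the displaced vectors depends only on the symplectic form and on `q`, both
  -- of which `T` respects.
  obtain ⟨L, hL⟩ := exists_gramIsometry (fun i => 𝒲.op i v) (fun i => 𝒲'.op (T i) w)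
    (𝒲.total_op hv) fun i j => by
      rw [inner_op_op 𝒲' hw, inner_op_op 𝒲 hv, hT, ← map_sub, hq]
  refine ⟨L, fun i => ?_, fun x y n h1 h2 => ?_⟩
  · refine (𝒲.total_op hv).ext ?_
    rintro _ ⟨j, rfl⟩
    change 𝒲'.op (T i) (L (𝒲.op j v)) = L (𝒲.op i (𝒲.op j v))
    rw [hL, op_op_apply, op_op_apply, map_smul, hL, hT, map_add]
  -- The point `x` need not lie in the range of `T`. Matrix elements between displaced vectors see
  -- it only through its pairing with the range and through `q'`, and the excess `n` becomes a
  -- Gaussian damping factor.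
  · refine (𝒲.total_op hv).ext ?_
    rintro _ ⟨j, rfl⟩
    refine sub_eq_zero.1 ((𝒲.total_op hv).eq_zero ?_)
    rintro _ ⟨i, rfl⟩
    rw [inner_sub_right, sub_eq_zero, ContinuousLinearMap.comp_apply,
      ContinuousLinearMap.adjoint_inner_right]
    change ⟪L (𝒲.op i v), 𝒲'.op x (L (𝒲.op j v))⟫_ℂ = ⟪𝒲.op i v,
      Complex.exp (-n / 4 : ℝ) • 𝒲.op y (𝒲.op j v)⟫_ℂ
    rw [hL, hL, inner_smul_right, inner_op_op_op 𝒲 hv, inner_op_op_op 𝒲' hw, h1, h1, hT, ← map_sub,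
      h2, ← Complex.exp_add, ← Complex.exp_add, ← Complex.exp_add]
    congr 1
    push_cast
    ring

/-- Composite Weyl systems. -/
def tensor (𝒲 : WeylSystem A E) (𝒲' : WeylSystem B E') : WeylSystem (A ⊗ₛ B) (E × E') where
  op p := 𝒲.op p.1 ⊗ₒ 𝒲'.op p.2
  form p p' := 𝒲.form p.1 p'.1 + 𝒲'.form p.2 p'.2
  form_swap p p' := by rw [𝒲.form_swap p.1, 𝒲'.form_swap p.2, neg_add]
  form_add p p' p'' := by
    rw [Prod.fst_add, Prod.snd_add, 𝒲.form_add, 𝒲'.form_add]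
    ring
  op_mul p p' := by
    rw [tensorOp_mul, 𝒲.op_mul, 𝒲'.op_mul, smul_tensorOp, tensorOp_smul, smul_smul,
      ← Complex.exp_add, Prod.fst_add, Prod.snd_add]
    congr 2
    push_cast
    ring
  adjoint_op p := (tensorOp_star _ _).trans
    (congrArg₂ tensorOp (𝒲.adjoint_op p.1) (𝒲'.adjoint_op p.2))
  ext_op f g hf hg h := by
    refine hf.ext_tensor hg fun X Y => ?_
    refine congrFun (𝒲.ext_op _ _ (hf.tensor_left Y) (hg.tensor_left Y) fun i => ?_) X
    exact congrFun (𝒲'.ext_op _ _ (hf.tensor_right (𝒲.op i)) (hg.tensor_right (𝒲.op i))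
      fun j => h (i, j)) Y

end WeylSystem

theorem IsGaussianVector.tensor {𝒲 : WeylSystem A E} {𝒲' : WeylSystem B E'} {v : A.carrier}
    {w : B.carrier} {q : E → ℝ} {q' : E' → ℝ} (hv : IsGaussianVector 𝒲 v q)
    (hw : IsGaussianVector 𝒲' w q') :
    IsGaussianVector (𝒲.tensor 𝒲') (v ⊗ᵥ w) fun p => q p.1 + q' p.2 := fun p => by
  change ⟪v ⊗ᵥ w, (𝒲.op p.1 ⊗ₒ 𝒲'.op p.2) (v ⊗ᵥ w)⟫_ℂ = _
  rw [tensorOp_tmul, inner_tmul_tmul, hv, hw, ← Complex.exp_add]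
  congr 1
  push_cast
  ring

/-- The image of a Gaussian vector under an isometry implementing a symplectic map. -/
theorem IsGaussianVector.map {𝒲 : WeylSystem A E} {𝒲' : WeylSystem B E'} {v : A.carrier}
    {q : E → ℝ} (hv : IsGaussianVector 𝒲 v q) {L : A.carrier →ₗᵢ[ℂ] B.carrier} {S : E' → E}
    (hL : ∀ j, 𝒲'.op j ∘L L.toContinuousLinearMap = L.toContinuousLinearMap ∘L 𝒲.op (S j)) :
    IsGaussianVector 𝒲' (L v) fun j => q (S j) := fun j => by
  have h : 𝒲'.op j (L v) = L (𝒲.op (S j) v) := congrArg (fun M : A.Hom B => M v) (hL j)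
  rw [h, L.inner_map_map, hv]

/-- The Weyl operators of one mode. -/
def modeWeyl : WeylSystem oneMode (ℝ × ℝ) where
  op z := weyl z.1 z.2
  form z z' := z.2 * z'.1 - z.1 * z'.2
  form_swap z z' := by ring
  form_add z z' z'' := by
    rw [Prod.fst_add, Prod.snd_add]
    ring
  op_mul z z' := weyl_mul _ _ _ _
  adjoint_op z := adjoint_weyl _ _
  ext_op f g hf hg h := hf.ext_weyl hg fun a b => h (a, b)

end WeylSystem

end

noncomputable section

/-! ## Gaussian vectors and channels -/

section GaussianChannels

theorem isGaussianVector_vac : IsGaussianVector modeWeyl vac fun z => z.1 ^ 2 + z.2 ^ 2 :=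
  fun z => inner_vac_weyl z.1 z.2

theorem exists_squeezed {s : ℝ} (hs : 0 < s) :
    ∃ v, IsGaussianVector modeWeyl v fun z => z.1 ^ 2 / s + s * z.2 ^ 2 :=
  let ⟨v, _, hv⟩ := exists_gaussian hs
  ⟨v, fun z => hv z.1 z.2⟩

/-- The characteristic function of a two-mode squeezed vacuum. -/
def squeezedForm (s : ℝ) (p : (ℝ × ℝ) × ℝ × ℝ) : ℝ :=
  (s + s⁻¹) / 2 * (p.1.1 ^ 2 + p.1.2 ^ 2 + p.2.1 ^ 2 + p.2.2 ^ 2) +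
    (s - s⁻¹) * (p.1.1 * p.2.1 - p.1.2 * p.2.2)

/-- A balanced beam splitter is a rotation of phase space that fixes the form of the vacuum, so it
is implemented by an isometry. Applied to two oppositely squeezed vectors it gives a two-mode
squeezed vacuum; the factor `v` is a spectator. -/
theorem exists_beamSplitter_vector {s : ℝ} (hs : 0 < s) {B : QSystem} {E : Type} [AddCommGroup E]
    {𝒲 : WeylSystem B E} {v : B.carrier} {q : E → ℝ} (hv : IsGaussianVector 𝒲 v q) :
    ∃ w, IsGaussianVector (modeWeyl.tensor (modeWeyl.tensor 𝒲)) w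
      fun p => squeezedForm s (p.1, p.2.1) + q p.2.2 := by
  obtain ⟨c, h2⟩ : ∃ c : ℝ, c * c = 1 / 2 := ⟨Real.sqrt (1 / 2), Real.mul_self_sqrt (by norm_num)⟩
  let T : (ℝ × ℝ) × (ℝ × ℝ) × E →+ (ℝ × ℝ) × (ℝ × ℝ) × E := AddMonoidHom.mk'
    (fun p => ((c * (p.1.1 + p.2.1.1), c * (p.1.2 + p.2.1.2)),
      (c * (p.2.1.1 - p.1.1), c * (p.2.1.2 - p.1.2)), p.2.2)) (by
      rintro ⟨⟨a, b⟩, ⟨a', b'⟩, e⟩ ⟨⟨x, y⟩, ⟨x', y'⟩, e'⟩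
      simp only [Prod.mk_add_mk, Prod.mk.injEq, and_true]
      refine ⟨⟨?_, ?_⟩, ?_, ?_⟩ <;> ring)
  have hvac := isGaussianVector_vac.tensor (isGaussianVector_vac.tensor hv)
  obtain ⟨L, hL, -⟩ := (modeWeyl.tensor (modeWeyl.tensor 𝒲)).exists_isometry
    (modeWeyl.tensor (modeWeyl.tensor 𝒲)) hvac hvac T (by
      rintro ⟨⟨a, b⟩, ⟨a', b'⟩, e⟩ ⟨⟨x, y⟩, ⟨x', y'⟩, e'⟩
      simp only [WeylSystem.tensor, modeWeyl, T, AddMonoidHom.mk'_apply]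
      linear_combination (2 * (b * x + b' * x' - a * y - a' * y')) * h2) (by
      rintro ⟨⟨a, b⟩, ⟨a', b'⟩, e⟩
      simp only [T, AddMonoidHom.mk'_apply]
      linear_combination (2 * (a ^ 2 + a' ^ 2 + b ^ 2 + b' ^ 2)) * h2)
  obtain ⟨v₁, hv₁⟩ := exists_squeezed hs
  obtain ⟨v₂, hv₂⟩ := exists_squeezed (inv_pos.2 hs)
  -- The inverse of `T`: the characteristic function of the image vector is pulled back along it.
  let S : (ℝ × ℝ) × (ℝ × ℝ) × E → (ℝ × ℝ) × (ℝ × ℝ) × E := fun p =>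
    ((c * (p.1.1 - p.2.1.1), c * (p.1.2 - p.2.1.2)),
      (c * (p.1.1 + p.2.1.1), c * (p.1.2 + p.2.1.2)), p.2.2)
  have h := (hv₁.tensor (hv₂.tensor hv)).map (L := L)
    (𝒲' := modeWeyl.tensor (modeWeyl.tensor 𝒲)) (S := S) fun j => by
      have hTj : T (S j) = j := by
        obtain ⟨⟨a, b⟩, ⟨a', b'⟩, e⟩ := j
        simp only [S, T, AddMonoidHom.mk'_apply, Prod.mk.injEq, and_true]
        refine ⟨⟨?_, ?_⟩, ?_, ?_⟩
        · linear_combination 2 * a * h2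
        · linear_combination 2 * b * h2
        · linear_combination 2 * a' * h2
        · linear_combination 2 * b' * h2
      have := hL (S j)
      rwa [hTj] at this
  refine ⟨_, fun p => (h p).trans ?_⟩
  obtain ⟨⟨a, b⟩, ⟨a', b'⟩, e⟩ := p
  simp only [squeezedForm, S]
  congr 4
  rw [div_eq_mul_inv, div_eq_mul_inv, inv_inv]
  linear_combination (s⁻¹ * (a - a') ^ 2 + s * (b - b') ^ 2 + s * (a + a') ^ 2 +
    s⁻¹ * (b + b') ^ 2) * h2

end GaussianChannels

end

noncomputable section

/-! ### Gaussian channels, pure-loss attenuators and quantum-limited amplifiers. -/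

section GaussianChannels

/-- The channel acts on characteristic functions by `χ(ξ) ↦ exp(-y |ξ|² / 4) χ(√x ξ)`. -/
def IsGaussianMap (x y : ℝ) (Λ : QChannel oneMode oneMode) : Prop :=
  ∀ a b : ℝ, Λ.dual (weyl a b) = Complex.exp (-(y * (a ^ 2 + b ^ 2) / 4 : ℝ)) •
    weyl (Real.sqrt x * a) (Real.sqrt x * b)

theorem IsGaussianMap.dual_eq {x y : ℝ} {Λ Λ' : QChannel oneMode oneMode}
    (h : IsGaussianMap x y Λ) (h' : IsGaussianMap x y Λ') (X : oneMode.Op) :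
    Λ.dual X = Λ'.dual X :=
  QOperation.ext_weyl (S := Λ.toQOperation) (T := Λ'.toQOperation)
    (fun a b => (h a b).trans (h' a b).symm) X

theorem IsGaussianMap.comp {x y x' y' : ℝ} {Λ Λ' : QChannel oneMode oneMode} (hx : 0 ≤ x')
    (h : IsGaussianMap x y Λ) (h' : IsGaussianMap x' y' Λ') :
    IsGaussianMap (x' * x) (x' * y + y') (Λ'.comp Λ) := fun a b => by
  rw [QChannel.comp_dual, h', map_smul, h, smul_smul, ← Complex.exp_add, mul_pow, mul_pow, Real.sq_sqrt hx,
    Real.sqrt_mul hx, mul_left_comm _ _ a, mul_left_comm _ _ b, mul_assoc _ _ a, mul_assoc _ _ b]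
  congr 2
  push_cast
  ring

theorem pullback_weyl {A F : QSystem} {E : Type} [AddCommGroup E] {𝒲 : WeylSystem F E}
    (h0 : 𝒲.op 0 = 1) {V : A.carrier →ₗᵢ[ℂ] (oneMode ⊗ₛ F).carrier} (z : ℝ × ℝ) :
    pullback V (weyl z.1 z.2) 1 = ContinuousLinearMap.adjoint V.toContinuousLinearMap ∘L
      (modeWeyl.tensor 𝒲).op (z, 0) ∘L V.toContinuousLinearMap := by
  rw [pullback, ← h0]
  rfl

/-- A beam splitter with vacuum in the second port: the displacement `z` splits into `√t z` and
`-√(1-t) z`, and the damping `(1-t) |z|²` is the vacuum noise left in the output. -/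
theorem exists_attenuator {t : ℝ} (h0 : 0 ≤ t) (h1 : t ≤ 1) :
    ∃ Λ : QChannel oneMode oneMode, IsGaussianMap t (1 - t) Λ := by
  obtain ⟨c, hc, hct⟩ : ∃ c : ℝ, c * c = t ∧ c = Real.sqrt t := ⟨_, Real.mul_self_sqrt h0, rfl⟩
  obtain ⟨s, hs⟩ : ∃ s : ℝ, s * s = 1 - t := ⟨_, Real.mul_self_sqrt (sub_nonneg.2 h1)⟩
  let T : ℝ × ℝ →+ (ℝ × ℝ) × ℝ × ℝ := AddMonoidHom.mk'
    (fun z => ((c * z.1, c * z.2), -s * z.1, -s * z.2)) (by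
      rintro ⟨a, b⟩ ⟨a', b'⟩
      simp only [Prod.mk_add_mk, Prod.mk.injEq]
      refine ⟨⟨?_, ?_⟩, ?_, ?_⟩ <;> ring)
  obtain ⟨V, -, hV⟩ := modeWeyl.exists_isometry (modeWeyl.tensor modeWeyl) isGaussianVector_vac
    (isGaussianVector_vac.tensor isGaussianVector_vac) T (by
      rintro ⟨a, b⟩ ⟨a', b'⟩
      simp only [WeylSystem.tensor, modeWeyl, T, AddMonoidHom.mk'_apply]
      linear_combination (b * a' - a * b') * hc + (b * a' - a * b') * hs) (by
      rintro ⟨a, b⟩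
      simp only [T, AddMonoidHom.mk'_apply]
      linear_combination (a ^ 2 + b ^ 2) * hc + (a ^ 2 + b ^ 2) * hs)
  refine ⟨QChannel.ofDilation V, fun a b => ?_⟩
  rw [QChannel.ofDilation_dual, pullback_weyl (𝒲 := modeWeyl) weyl_zero (a, b),
    hV ((a, b), 0) (c * a, c * b) ((1 - t) * (a ^ 2 + b ^ 2)), ← hct]
  · rw [neg_div, Complex.ofReal_neg]
    rfl
  · rintro ⟨a', b'⟩
    simp only [WeylSystem.tensor, modeWeyl, T, AddMonoidHom.mk'_apply, Prod.fst_zero, Prod.snd_zero]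
    ring
  · rintro ⟨a', b'⟩
    simp only [T, AddMonoidHom.mk'_apply, Prod.mk_add_mk, Prod.fst_add, Prod.snd_add, Prod.fst_zero,
      Prod.snd_zero]
    linear_combination (a' ^ 2 + b' ^ 2) * hs + (a' ^ 2 + b' ^ 2 - a ^ 2 - b ^ 2) * hc

/-- With `p = √g` and `q = √(g-1)`, the map `z ↦ (p z, q z̄)` is symplectic because `p² - q² = 1`.
The reference vector is the two-mode squeezed vacuum with `s = (p - q)²`, `s⁻¹ = (p + q)²`, whose
form restricts to `|z|²` along this map. The third mode is idle. -/
theorem exists_amplifier {g : ℝ} (hg : 1 ≤ g) :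
    ∃ Λ : QChannel oneMode oneMode, IsGaussianMap g (g - 1) Λ := by
  obtain ⟨p, hp, hp0, hpg⟩ : ∃ p : ℝ, p * p = g ∧ 0 ≤ p ∧ p = Real.sqrt g :=
    ⟨_, Real.mul_self_sqrt (by linarith), Real.sqrt_nonneg _, rfl⟩
  obtain ⟨q, hq, hq0⟩ : ∃ q : ℝ, q * q = g - 1 ∧ 0 ≤ q :=
    ⟨_, Real.mul_self_sqrt (by linarith), Real.sqrt_nonneg _⟩
  have hpq : (p - q) ^ 2 * (p + q) ^ 2 = 1 := by
    rw [← mul_pow, show (p - q) * (p + q) = 1 by linear_combination hp - hq, one_pow]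
  have hs : 0 < (p - q) ^ 2 := by
    rcases (sq_nonneg (p - q)).lt_or_eq with h | h
    · exact h
    · rw [← h, zero_mul] at hpq
      exact absurd hpq zero_ne_one
  have hinv : ((p - q) ^ 2)⁻¹ = (p + q) ^ 2 := inv_eq_of_mul_eq_one_right hpq
  obtain ⟨w, hw⟩ := exists_beamSplitter_vector hs isGaussianVector_vac
  let T : ℝ × ℝ →+ (ℝ × ℝ) × (ℝ × ℝ) × ℝ × ℝ := AddMonoidHom.mk'
    (fun z => ((p * z.1, p * z.2), (q * z.1, -q * z.2), 0)) (by
      rintro ⟨a, b⟩ ⟨a', b'⟩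
      simp only [Prod.mk_add_mk, Prod.mk.injEq, add_zero, and_true]
      refine ⟨⟨?_, ?_⟩, ?_, ?_⟩ <;> ring)
  obtain ⟨V, -, hV⟩ := modeWeyl.exists_isometry (modeWeyl.tensor (modeWeyl.tensor modeWeyl))
    isGaussianVector_vac hw T (by
      rintro ⟨a, b⟩ ⟨a', b'⟩
      simp only [WeylSystem.tensor, modeWeyl, T, AddMonoidHom.mk'_apply, Prod.fst_zero,
        Prod.snd_zero]
      linear_combination (b * a' - a * b') * hp - (b * a' - a * b') * hq) (by
      rintro ⟨a, b⟩
      simp only [T, AddMonoidHom.mk'_apply, squeezedForm, hinv, Prod.fst_zero, Prod.snd_zero]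
      linear_combination (a ^ 2 + b ^ 2) * hpq)
  have h0 : (modeWeyl.tensor modeWeyl).op 0 = 1 := by
    change weyl 0 0 ⊗ₒ weyl 0 0 = 1
    rw [weyl_zero, one_tensorOp_one]
  refine ⟨QChannel.ofDilation V, fun a b => ?_⟩
  rw [QChannel.ofDilation_dual, pullback_weyl h0 (a, b),
    hV ((a, b), 0) (p * a, p * b) ((g - 1) * (a ^ 2 + b ^ 2)), ← hpg]
  · rw [neg_div, Complex.ofReal_neg]
    rfl
  · rintro ⟨a', b'⟩
    simp only [WeylSystem.tensor, modeWeyl, T, AddMonoidHom.mk'_apply, Prod.fst_zero, Prod.snd_zero]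
    ring
  · rintro ⟨a', b'⟩
    simp only [T, AddMonoidHom.mk'_apply, Prod.mk_add_mk, Prod.fst_add, Prod.snd_add, Prod.fst_zero,
      Prod.snd_zero, squeezedForm, hinv]
    have e : p * p - q * q = 1 := by rw [hp, hq]; ring
    linear_combination (a ^ 2 + b ^ 2) * hq + (a' ^ 2 + b' ^ 2) * hpq +
      2 * p * (a * a' + b * b') * e 

end GaussianChannels

end

noncomputable section

/-! ### Heterodyne detection and preparation of coherent states. -/

section MeasureAndPrepare

theorem conj_mul_of_intertwine {A B : QSystem} {V : A.Hom B} {N : B.Op} {U : A.Op} (M : B.Op)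
    (h : N ∘L V = V ∘L U) :
    ContinuousLinearMap.adjoint V ∘L (M * N) ∘L V = (ContinuousLinearMap.adjoint V ∘L M ∘L V) * U :=
  ContinuousLinearMap.ext fun x => congrArg (fun y => ContinuousLinearMap.adjoint V (M y))
    (congrArg (fun L : A.Hom B => L x) h)

/-- An isometry which copies the (commuting) information about the output into the environment. -/
theorem isCommuting_conj_of_weyl {F K : QSystem} {E : Type} [AddCommGroup E]
    (𝒲 : WeylSystem K E) {R : F.carrier →ₗᵢ[ℂ] (K ⊗ₛ F).carrier} (U : E → F.Op)
    (h1 : ∀ i, ((1 : K.Op) ⊗ₒ U i) ∘L R.toContinuousLinearMap = R.toContinuousLinearMap ∘L U i)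
    (h2 : ∀ i, ContinuousLinearMap.adjoint R.toContinuousLinearMap ∘L (𝒲.op i ⊗ₒ (1 : F.Op)) ∘L
      R.toContinuousLinearMap = U i) :
    IsCommuting (QOperation.conj R.toContinuousLinearMap) := by
  intro Y Z Y'
  have hV : ∀ X : (K ⊗ₛ F).Op, (QOperation.conj R.toContinuousLinearMap).dual X =
      ContinuousLinearMap.adjoint R.toContinuousLinearMap ∘L X ∘L R.toContinuousLinearMap :=
    QOperation.conj_dual _
  rw [hV, hV, hV]
  generalize R.toContinuousLinearMap = V at h1 h2
  refine eq_of_forall_inner fun ψ => ?_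
  have hg : IsNormalForm fun X : K.Op => ⟪ψ, (ContinuousLinearMap.adjoint V ∘L
      (Y ⊗ₒ (Z * (ContinuousLinearMap.adjoint V ∘L (X ⊗ₒ (1 : F.Op)) ∘L V))) ∘L V) ψ⟫_ℂ :=
    ((((isNormalForm_inner ψ ψ).comp_conj V V).tensor_right Y).mul_left Z).comp_dilation V V
  have hg' : IsNormalForm fun X : K.Op => ⟪ψ, ((ContinuousLinearMap.adjoint V ∘L
      (Y ⊗ₒ Z) ∘L V) * (ContinuousLinearMap.adjoint V ∘L (X ⊗ₒ (1 : F.Op)) ∘L V)) ψ⟫_ℂ :=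
    ((isNormalForm_inner ψ ψ).mul_left
      (ContinuousLinearMap.adjoint V ∘L (Y ⊗ₒ Z) ∘L V)).comp_dilation V V
  have key := 𝒲.ext_op _ _ hg hg' fun i => by
    have h4 : Y ⊗ₒ (Z * U i) = (Y ⊗ₒ Z) * ((1 : K.Op) ⊗ₒ U i) := by
      rw [tensorOp_mul, mul_one]
    rw [h2, h4, conj_mul_of_intertwine _ (h1 i)]
  exact congrFun key Y'

/-- Three modes. -/
abbrev threeWeyl : WeylSystem (oneMode ⊗ₛ (oneMode ⊗ₛ oneMode)) ((ℝ × ℝ) × (ℝ × ℝ) × ℝ × ℝ) :=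
  modeWeyl.tensor (modeWeyl.tensor modeWeyl)

/-- The commuting phase space directions of the first two of three modes. -/
def jointPoint (z : ℝ × ℝ) : (ℝ × ℝ) × (ℝ × ℝ) × ℝ × ℝ := ((z.1, -z.2), z, 0)

/-- A non-demolition readout: the operators at `jointPoint z` commute and act as a classical
variable stored in the first two modes. `R` creates an output mode with vacuum noise, displaced by
`l` times this variable, and leaves the variable itself intact. The third mode is idle. -/
theorem exists_prepare {l : ℝ} (h0 : 0 ≤ l) (h1 : l < 1) :
    ∃ R : (oneMode ⊗ₛ (oneMode ⊗ₛ oneMode)).carrier →ₗᵢ[ℂ]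
        (oneMode ⊗ₛ (oneMode ⊗ₛ (oneMode ⊗ₛ oneMode))).carrier,
      (∀ z, ((1 : oneMode.Op) ⊗ₒ threeWeyl.op (jointPoint z)) ∘L R.toContinuousLinearMap =
        R.toContinuousLinearMap ∘L threeWeyl.op (jointPoint z)) ∧
      ∀ z : ℝ × ℝ, pullback R (weyl z.1 z.2) 1 = Complex.exp (-(z.1 ^ 2 + z.2 ^ 2) / 4 : ℝ) •
        threeWeyl.op (jointPoint (l * z.1, l * z.2)) := by
  have hl : 0 < 1 - l := by linarith
  have hl' : 0 < 1 + l := by linarith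
  -- The two squeezing parameters are matched so that `T` below carries the form of `w` to that of
  -- `v`, and so that displacing the output by `z` costs exactly the vacuum noise `|z|²`. They are
  -- positive because `l < 1`.
  obtain ⟨v, hv⟩ := exists_beamSplitter_vector (s := ((1 - l) * (1 + l))⁻¹) (by positivity)
    isGaussianVector_vac
  obtain ⟨w, hw⟩ := exists_beamSplitter_vector (s := (1 + l) / (1 - l)) (by positivity)
    (isGaussianVector_vac.tensor isGaussianVector_vac)
  -- The terms with `l ^ 2 / 2` are the back action that keeps `T` symplectic; they vanish on the
  -- joint points, which therefore pass unchanged.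
  let T : (ℝ × ℝ) × (ℝ × ℝ) × ℝ × ℝ →+ (ℝ × ℝ) × (ℝ × ℝ) × (ℝ × ℝ) × ℝ × ℝ := AddMonoidHom.mk'
    (fun p => ((l * (p.2.1.1 - p.1.1), l * (p.2.1.2 + p.1.2)),
      (p.1.1 - l ^ 2 / 2 * (p.2.1.1 - p.1.1), p.1.2 + l ^ 2 / 2 * (p.2.1.2 + p.1.2)),
      (p.2.1.1 - l ^ 2 / 2 * (p.2.1.1 - p.1.1), p.2.1.2 - l ^ 2 / 2 * (p.2.1.2 + p.1.2)), p.2.2)) (by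
      rintro ⟨⟨a, b⟩, ⟨a', b'⟩, e⟩ ⟨⟨x, y⟩, ⟨x', y'⟩, e'⟩
      simp only [Prod.mk_add_mk, Prod.mk.injEq, and_true]
      refine ⟨⟨?_, ?_⟩, ⟨?_, ?_⟩, ?_, ?_⟩ <;> ring)
  obtain ⟨R, hR, hR'⟩ := threeWeyl.exists_isometry (modeWeyl.tensor threeWeyl) hv hw T (by
      rintro ⟨⟨a, b⟩, ⟨a', b'⟩, e⟩ ⟨⟨x, y⟩, ⟨x', y'⟩, e'⟩
      simp only [WeylSystem.tensor, modeWeyl, T, AddMonoidHom.mk'_apply]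
      ring) (by
      rintro ⟨⟨a, b⟩, ⟨a', b'⟩, e⟩
      simp only [T, AddMonoidHom.mk'_apply, squeezedForm, inv_inv, inv_div]
      field_simp
      ring)
  refine ⟨R, fun z => ?_, fun z => ?_⟩
  · have h : T (jointPoint z) = (0, jointPoint z) := by
      simp only [T, AddMonoidHom.mk'_apply, jointPoint, sub_self, add_neg_cancel, mul_zero, sub_zero,
        add_zero]
      rfl
    have := hR (jointPoint z)
    rw [h] at this
    rw [← this, ← weyl_zero]
    rfl
  · have h0 : threeWeyl.op 0 = 1 := by
      change weyl 0 0 ⊗ₒ (weyl 0 0 ⊗ₒ weyl 0 0) = 1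
      rw [weyl_zero, one_tensorOp_one, one_tensorOp_one]
    have hp := pullback_weyl (V := R) h0 z
    rw [hp, hR' (z, 0) (jointPoint (l * z.1, l * z.2)) (z.1 ^ 2 + z.2 ^ 2)]
    · rintro ⟨⟨a, b⟩, ⟨a', b'⟩, e⟩
      simp only [WeylSystem.tensor, modeWeyl, T, AddMonoidHom.mk'_apply, jointPoint, Prod.fst_zero,
        Prod.snd_zero]
      ring
    · obtain ⟨x, y⟩ := z
      rintro ⟨⟨a, b⟩, ⟨a', b'⟩, e⟩
      simp only [T, AddMonoidHom.mk'_apply, squeezedForm, inv_inv, inv_div, jointPoint,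
        Prod.mk_add_mk, Prod.fst_add, Prod.snd_add, Prod.fst_zero, Prod.snd_zero]
      field_simp
      ring

/-- The input enters as the second mode, next to vacua. The commuting joint quadratures of the first
two modes then carry both quadratures of the input, at the price of one unit of vacuum noise. -/
theorem exists_heterodyne :
    ∃ C : QChannel oneMode (oneMode ⊗ₛ (oneMode ⊗ₛ oneMode)), ∀ z : ℝ × ℝ,
      C.dual (threeWeyl.op (jointPoint z)) = Complex.exp (-(z.1 ^ 2 + z.2 ^ 2) / 4 : ℝ) •
        weyl z.1 z.2 := by
  let T : ℝ × ℝ →+ (ℝ × ℝ) × (ℝ × ℝ) × ℝ × ℝ := AddMonoidHom.mk' (fun z => (0, z, 0)) (by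
    intro z z'
    simp only [Prod.mk_add_mk, add_zero])
  obtain ⟨V, -, hV⟩ := modeWeyl.exists_isometry threeWeyl isGaussianVector_vac
    (isGaussianVector_vac.tensor (isGaussianVector_vac.tensor isGaussianVector_vac)) T (by
      rintro ⟨a, b⟩ ⟨a', b'⟩
      simp only [WeylSystem.tensor, modeWeyl, T, AddMonoidHom.mk'_apply, Prod.fst_zero,
        Prod.snd_zero]
      ring) (by
      rintro ⟨a, b⟩
      simp only [T, AddMonoidHom.mk'_apply, Prod.fst_zero, Prod.snd_zero]
      ring)
  refine ⟨QChannel.ofIsometry V, fun z => ?_⟩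
  rw [QChannel.ofIsometry_dual, hV (jointPoint z) z (z.1 ^ 2 + z.2 ^ 2)]
  · rfl
  · rintro ⟨a', b'⟩
    simp only [WeylSystem.tensor, modeWeyl, T, AddMonoidHom.mk'_apply, jointPoint, Prod.fst_zero,
      Prod.snd_zero]
    ring
  · rintro ⟨a', b'⟩
    simp only [T, AddMonoidHom.mk'_apply, jointPoint, Prod.mk_add_mk, Prod.fst_add, Prod.snd_add,
      Prod.fst_zero, Prod.snd_zero]
    ring

/-- Heterodyne measurement followed by the preparation of a coherent state has zero capacity. -/
theorem exists_measurePrepare {l : ℝ} (h0 : 0 ≤ l) (h1 : l < 1) :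
    ∃ Λ : QChannel oneMode oneMode, IsGaussianMap (l ^ 2) (1 + l ^ 2) Λ ∧
      ∀ κ, capacity κ Λ = 0 := by
  obtain ⟨R, hR, hR'⟩ := exists_prepare h0 h1
  obtain ⟨C, hC⟩ := exists_heterodyne
  have hcomm : IsCommuting (QOperation.conj R.toContinuousLinearMap) := by
    refine isCommuting_conj_of_weyl modeWeyl _ (fun z => ?_) hR'
    rw [tensorOp_smul, ContinuousLinearMap.smul_comp, ContinuousLinearMap.comp_smul, hR]
  refine ⟨(QChannel.ofDilation R).comp C, fun a b => ?_, fun κ => ?_⟩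
  · rw [QChannel.comp_dual, QChannel.ofDilation_dual, hR' (a, b), map_smul, hC, smul_smul,
      ← Complex.exp_add, Real.sqrt_sq h0]
    congr 2
    push_cast
    ring
  · refine le_antisymm ?_ bot_le
    rw [← capacity_eq_zero_of_isCommuting κ (T := QChannel.ofDilation R) hcomm
      (QChannel.ofDilation_dual R)]
    exact capacity_le_of_comp κ C (QChannel.id _) fun X => by
      rw [QChannel.id_dual, QChannel.comp_dual]

end MeasureAndPrepare

end

noncomputable section

/-! ### Comparison of the capacities of Gaussian channels. -/

section GaussianCapacities

variable {x y x' y' : ℝ} {Λ Λ' : QChannel oneMode oneMode}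

/-- Attenuating the output does not increase the capacities. -/
theorem IsGaussianMap.capacity_le_of_attenuator (κ : CapacityKind) (h : IsGaussianMap x y Λ)
    (h' : IsGaussianMap x' y' Λ') {t : ℝ} (h0 : 0 ≤ t) (h1 : t ≤ 1) (hx : x' = t * x)
    (hy : y' = t * y + (1 - t)) : capacity κ Λ' ≤ capacity κ Λ := by
  obtain ⟨S, hS⟩ := exists_attenuator h0 h1
  subst hx hy
  exact capacity_le_of_comp κ (QChannel.id _) S fun X => by
    rw [QChannel.id_dual, h'.dual_eq (h.comp h0 hS), QChannel.comp_dual]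

/-- Amplifying the input does not increase the capacities. -/
theorem IsGaussianMap.capacity_le_of_amplifier (κ : CapacityKind) (h : IsGaussianMap x y Λ)
    (h' : IsGaussianMap x' y' Λ') {g : ℝ} (hg : 1 ≤ g) (hx0 : 0 ≤ x) (hx : x' = x * g)
    (hy : y' = x * (g - 1) + y) : capacity κ Λ' ≤ capacity κ Λ := by
  obtain ⟨S, hS⟩ := exists_amplifier hg
  subst hx hy
  exact capacity_le_of_comp κ S (QChannel.id _) fun X => by
    rw [QChannel.id_dual, h'.dual_eq (hS.comp hx0 h), QChannel.comp_dual]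

/-- Entanglement breaking attenuators have zero capacity. -/
theorem IsGaussianMap.capacity_eq_zero (κ : CapacityKind) (h : IsGaussianMap x y Λ) (hx0 : 0 ≤ x)
    (hx1 : x < 1) (hy : 1 + x ≤ y) : capacity κ Λ = 0 := by
  -- Measure and prepare with `l² = x / g`, then amplify by `g`: the noise is `g (1 + x / g) + (g -
  -- 1) = 2 g + x - 1`, and this is `y` for the present `g`. The hypothesis `1 + x ≤ y` says `g ≥
  -- 1`, which with `x < 1` gives `l < 1`.
  set g : ℝ := (y + 1 - x) / 2 with hg
  have hg1 : 1 ≤ g := by rw [hg]; linarith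
  have hxg : x < g := by linarith
  have hl : Real.sqrt (x / g) ^ 2 = x / g := Real.sq_sqrt (by positivity)
  obtain ⟨Γ, hΓ, hΓ0⟩ := exists_measurePrepare (Real.sqrt_nonneg (x / g))
    (by rw [Real.sqrt_lt' one_pos, one_pow, div_lt_one (by linarith)]; exact hxg)
  obtain ⟨S, hS⟩ := exists_amplifier hg1
  rw [hl] at hΓ
  have hc := hΓ.comp (by linarith : 0 ≤ g) hS
  have e1 : g * (x / g) = x := mul_div_cancel₀ x (by linarith)
  rw [mul_add, mul_one, e1, show g + x + (g - 1) = y by rw [hg]; ring] at hc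
  refine le_antisymm ?_ bot_le
  rw [← hΓ0 κ]
  exact capacity_le_of_comp κ (QChannel.id _) S fun X => by
    rw [QChannel.id_dual, h.dual_eq hc, QChannel.comp_dual]

theorem IsAttenuator.isGaussianMap {η N : ℝ} (hη : η ≤ 1) (h : IsAttenuator η N Λ)
    (hy : y = 2 * ((1 - η) * N) + (1 - η)) : IsGaussianMap η y Λ := by
  rw [hy]
  have : IsGaussianMap η (2 * ((1 - η) * N) + |1 - η|) Λ := h
  rwa [abs_of_nonneg (sub_nonneg.2 hη)] at this

theorem IsAmplifier.isGaussianMap {g N : ℝ} (hg : 1 ≤ g) (h : IsAmplifier g N Λ)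
    (hy : y = 2 * ((g - 1) * N) + (g - 1)) : IsGaussianMap g y Λ := by
  rw [hy]
  have : IsGaussianMap g (2 * ((g - 1) * N) + |1 - g|) Λ := h
  rwa [abs_of_nonpos (sub_nonpos.2 hg), neg_sub] at this

end GaussianCapacities

end

/-! ### Monotonicity along the four curves. -/

theorem corollary3 (κ : CapacityKind) :
    -- attenuators along `N' = N^{(4)}_{g,N}(η')`: non-decreasing
    (∀ g N : ℝ, 1 ≤ g → 0 ≤ N → ∀ η₁ η₂ : ℝ, 0 ≤ η₁ → η₁ ≤ η₂ → η₂ < 1 →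
      ∀ Λ₁ Λ₂ : QChannel oneMode oneMode,
        IsAttenuator η₁ (curveAmp4 g N η₁) Λ₁ → IsAttenuator η₂ (curveAmp4 g N η₂) Λ₂ →
          capacity κ Λ₁ ≤ capacity κ Λ₂) ∧
    -- attenuators along `N' = N^{(3)}_{g,N}(η')`, where it is non-negative: non-increasing
    (∀ g N : ℝ, 1 ≤ g → 0 ≤ N → ∀ η₁ η₂ : ℝ, 0 ≤ η₁ → η₁ ≤ η₂ → η₂ < 1 →
      0 ≤ curveAmp3 g N η₁ → 0 ≤ curveAmp3 g N η₂ →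
      ∀ Λ₁ Λ₂ : QChannel oneMode oneMode,
        IsAttenuator η₁ (curveAmp3 g N η₁) Λ₁ → IsAttenuator η₂ (curveAmp3 g N η₂) Λ₂ →
          capacity κ Λ₂ ≤ capacity κ Λ₁) ∧
    -- amplifiers along `N' = N^{(4)}_{η,N}(g')`: non-increasing
    (∀ η N : ℝ, 0 ≤ η → η ≤ 1 → 0 ≤ N → ∀ g₁ g₂ : ℝ, 1 < g₁ → g₁ ≤ g₂ →
      ∀ Λ₁ Λ₂ : QChannel oneMode oneMode,
        IsAmplifier g₁ (curveAtt4 η N g₁) Λ₁ → IsAmplifier g₂ (curveAtt4 η N g₂) Λ₂ →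
          capacity κ Λ₂ ≤ capacity κ Λ₁) ∧
    -- amplifiers along `N' = N^{(3)}_{η,N}(g')`, where it is non-negative: non-decreasing
    (∀ η N : ℝ, 0 < η → η ≤ 1 → 0 ≤ N → ∀ g₁ g₂ : ℝ, 1 < g₁ → g₁ ≤ g₂ →
      0 ≤ curveAtt3 η N g₁ → 0 ≤ curveAtt3 η N g₂ →
      ∀ Λ₁ Λ₂ : QChannel oneMode oneMode,
        IsAmplifier g₁ (curveAtt3 η N g₁) Λ₁ → IsAmplifier g₂ (curveAtt3 η N g₂) Λ₂ →
          capacity κ Λ₁ ≤ capacity κ Λ₂) := by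
  refine ⟨fun g N hg hN η₁ η₂ h0 h12 h1 Λ₁ Λ₂ H₁ H₂ => ?_,
    fun g N hg hN η₁ η₂ h0 h12 h1 hN₁ hN₂ Λ₁ Λ₂ H₁ H₂ => ?_,
    fun η N hη hη1 hN g₁ g₂ h1 h12 Λ₁ Λ₂ H₁ H₂ => ?_,
    fun η N hη hη1 hN g₁ g₂ h1 h12 hN₁ hN₂ Λ₁ Λ₂ H₁ H₂ => ?_⟩
  -- On this curve `y - 1` is a fixed multiple of `x = η`, so the channel at `η₁` is the one at `η₂`
  -- followed by an attenuator of transmissivity `η₁ / η₂`.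
  · have e : ∀ η : ℝ, η < 1 → 1 + η * (2 * ((N + 1) * ((g - 1) / g)) - 1) =
        2 * ((1 - η) * curveAmp4 g N η) + (1 - η) := fun η hη => by
      have : 1 - η ≠ 0 := by linarith
      rw [curveAmp4]
      field_simp
      ring
    have G₁ := H₁.isGaussianMap (h12.trans h1.le) (e _ (h12.trans_lt h1))
    have G₂ := H₂.isGaussianMap h1.le (e _ h1)
    -- For `η₂ = 0` the quotient is meaningless, but the two channels coincide and transmissivity
    -- one serves.
    rcases (h0.trans h12).eq_or_lt with h2 | h2
    · have h3 : η₁ = η₂ := le_antisymm h12 (h2 ▸ h0)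
      exact G₂.capacity_le_of_attenuator κ G₁ zero_le_one le_rfl (by rw [h3, one_mul])
        (by rw [h3]; ring)
    · have h3 : η₁ / η₂ * η₂ = η₁ := div_mul_cancel₀ _ h2.ne'
      refine G₂.capacity_le_of_attenuator κ G₁ (div_nonneg h0 h2.le) ((div_le_one h2).2 h12)
        h3.symm ?_
      linear_combination -(2 * ((N + 1) * ((g - 1) / g)) - 1) * h3
  -- On this curve `y - x` is constant, so the channel at `η₂` is the one at `η₁` preceded by an
  -- amplifier of gain `η₂ / η₁`.
  · have e : ∀ η : ℝ, η < 1 → η + (2 * (N * (g - 1)) - 1) =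
        2 * ((1 - η) * curveAmp3 g N η) + (1 - η) := fun η hη => by
      have : 1 - η ≠ 0 := by linarith
      rw [curveAmp3]
      field_simp
      ring
    have G₁ := H₁.isGaussianMap (h12.trans h1.le) (e _ (h12.trans_lt h1))
    have G₂ := H₂.isGaussianMap h1.le (e _ h1)
    -- For `η₁ = 0` there is no such gain. Instead non-negativity of the curve at `0` gives `N (g -
    -- 1) ≥ 1`, so the channel at `η₂` is entanglement breaking and its capacity is zero.
    rcases h0.eq_or_lt with h2 | h2
    · rw [G₂.capacity_eq_zero κ (h0.trans h12) h1]
      · exact bot_le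
      · rw [← h2, curveAmp3, sub_zero, div_one] at hN₁
        linarith
    · have h3 : η₁ * (η₂ / η₁) = η₂ := mul_div_cancel₀ _ h2.ne'
      refine G₁.capacity_le_of_amplifier κ G₂ ((one_le_div h2).2 h12) h0 h3.symm ?_
      linear_combination -h3
  -- Again `y - x` is constant; the input is amplified by `g₂ / g₁`.
  · have e : ∀ g : ℝ, 1 < g → 2 * ((N + 1) * (1 - η)) + (g - 1) =
        2 * ((g - 1) * curveAtt4 η N g) + (g - 1) := fun g hg => by
      have : g - 1 ≠ 0 := by linarith
      rw [curveAtt4]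
      field_simp
    have G₁ := H₁.isGaussianMap h1.le (e _ h1)
    have G₂ := H₂.isGaussianMap (h1.le.trans h12) (e _ (h1.trans_le h12))
    have h2 : 0 < g₁ := by linarith
    have h3 : g₁ * (g₂ / g₁) = g₂ := mul_div_cancel₀ _ h2.ne'
    refine G₁.capacity_le_of_amplifier κ G₂ ((one_le_div h2).2 h12) h2.le h3.symm ?_
    linear_combination -h3
  -- Again `y - 1` is proportional to `x`; the output is attenuated by `g₁ / g₂`.
  · have e : ∀ g : ℝ, 1 < g → 1 + g * (2 * (N * ((1 - η) / η)) - 1) =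
        2 * ((g - 1) * curveAtt3 η N g) + (g - 1) := fun g hg => by
      have : g - 1 ≠ 0 := by linarith
      rw [curveAtt3]
      field_simp
      ring
    have G₁ := H₁.isGaussianMap h1.le (e _ h1)
    have G₂ := H₂.isGaussianMap (h1.le.trans h12) (e _ (h1.trans_le h12))
    have h2 : 0 < g₂ := by linarith
    have h3 : g₁ / g₂ * g₂ = g₁ := div_mul_cancel₀ _ h2.ne'
    refine G₂.capacity_le_of_attenuator κ G₁ (by positivity) ((div_le_one h2).2 h12) h3.symm ?_
    linear_combination -(2 * (N * ((1 - η) / η)) - 1) * h3
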